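/- Let $I$ be a set and let $(A,P,\Pi,P^\vee,\Pi^\vee)$ be a Cartan datum: $A=(a_{ij})_{i,j\in I}$ is a symmetrizable generalized Cartan matrix with positive integers $d_i$ such that $d_ia_{ij}=d_ja_{ji}$; $P$ is a free abelian group of finite rank and $P^\vee=\operatorname{Hom}(P,\mathbb Z)$; $\Pi=\{\alpha_i\}_{i\in I}\subset P$ is linearly independent, $\Pi^\vee=\{\alpha_i^\vee\}_{i\in I}\subset P^\vee$, $\langle\alpha_i^\vee,\alpha_j\rangle=a_{ij}$, and for each $i$ there is $\Lambda_i\in P$ with $\langle\alpha_j^\vee,\Lambda_i\rangle=\delta_{ij}$ for all $j$. Put $(\alpha_i,\alpha_j)=d_ia_{ij}$. Let $\mathbf k=\bigoplus_{m\ge 0}\mathbf k_m$ be an $\mathbb N$-graded commutative ring that is a field (so in fact $\mathbf k=\mathbf k_0$); set $\mathbf k_m=0$ for $m<0$. Fix polynomials $Q_{ij}(u,v)=\sum_{p,q\ge 0}c_{i,j,p,q}u^pv^q\in\mathbf k[u,v]$ with $Q_{ij}(u,v)=Q_{ji}(v,u)$ and $Q_{ii}=0$ such that, for $i\ne j$,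 $c_{i,j,p,q}\in\mathbf k_{-2(\alpha_i,\alpha_j)-(\alpha_i,\alpha_i)p-(\alpha_j,\alpha_j)q}$ and $c_{i,j,-a_{ij},0}\ne 0$. Let $\Lambda\in P$ be a dominant weight ($\langle\alpha_i^\vee,\Lambda\rangle\ge 0$ for all $i$), and for each $i\in I$ let $a_i^\Lambda(u)\in\mathbf k[u]$ be monic of degree $N_i=\langle\alpha_i^\vee,\Lambda\rangle$ with the coefficient of $u^{N_i-m}$ in $\mathbf k_{m(\alpha_i,\alpha_i)}$ for $0\le m\le N_i$. Let $\beta=\alpha_{i_1}+\cdots+\alpha_{i_n}$ with $i_1,\dots,i_n\in I$ pairwise distinct, $n\ge 0$, and let $I^\beta=\{\nu\in I^n:\sum_t\alpha_{\nu_t}=\beta\}$, on which the symmetric group acts by permuting places. The Khovanov–Lauda–Rouquier algebra $R_\beta$ is the $\mathbf k$-algebra generated by $e(\nu)$ $(\nu\in I^\beta)$, $x_1,\dots,x_n$, $\tau_1,\dots,\tau_{n-1}$ with relations $$e(\nu)e(\nu')=\delta_{\nu\nu'}e(\nu),\quad \sum_\nu e(\nu)=1,\quad x_kx_l=x_lx_k,\quad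 x_ke(\nu)=e(\nu)x_k,$$ $$\tau_le(\nu)=e(s_l\nu)\tau_l,\quad \tau_k\tau_l=\tau_l\tau_k\ (|k-l|>1),\quad \tau_k^2e(\nu)=Q_{\nu_k,\nu_{k+1}}(x_k,x_{k+1})e(\nu),$$ $$(\tau_kx_l-x_{s_k(l)}\tau_k)e(\nu)=\begin{cases}-e(\nu)&l=k,\ \nu_k=\nu_{k+1}\\ e(\nu)&l=k+1,\ \nu_k=\nu_{k+1}\\0&\text{otherwise,}\end{cases}$$ $$(\tau_{k+1}\tau_k\tau_{k+1}-\tau_k\tau_{k+1}\tau_k)e(\nu)=\begin{cases}\dfrac{Q_{\nu_k,\nu_{k+1}}(x_k,x_{k+1})-Q_{\nu_{k+2},\nu_{k+1}}(x_{k+2},x_{k+1})}{x_k-x_{k+2}}e(\nu)&\nu_k=\nu_{k+2}\\0&\text{otherwise.}\end{cases}$$ The cyclotomic algebra $R_\beta^\Lambda$ is the quotient of $R_\beta$ by the two-sided ideal generated by $\sum_{\nu\in I^\beta}a_{\nu_1}^\Lambda(x_1)e(\nu)$ (by the zero ideal if $n=0$). Its cocenter is $R_\beta^\Lambda/[R_\beta^\Lambda,R_\beta^\Lambda]$,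 where $[R,R]$ denotes the $\mathbf k$-span of all commutators $rs-sr$. Fix $\gamma\in I^\beta$ and order $\{\gamma_1,\dots,\gamma_n\}=\{i_1,\dots,i_n\}$ by $\gamma_1<\gamma_2<\cdots<\gamma_n$. For $\nu\in I^\beta$ and $1\le t\le n$ let $k_{\nu,t}=\max\{1\le p<t:\nu_p<\nu_t\}$, or $k_{\nu,t}=0$ if this set is empty. Let $T_\gamma^\Lambda$ be the set of all $x_1^{a_1}\cdots x_n^{a_n}e(\nu)$ with $\nu\in I^\beta$, $(a_1,\dots,a_n)\in\mathbb N^n$ and, for every $1\le t\le n$, $$a_t<-\sum_{l=\max\{k_{\nu,t},1\}}^{t-1}a_{\nu_t,\nu_l}+\delta_{k_{\nu,t},0}\,\langle\alpha_{\nu_t}^\vee,\Lambda\rangle .$$ **Theorem.** The canonical images in $R_\beta^\Lambda/[R_\beta^\Lambda,R_\beta^\Lambda]$ of the elements of $T_\gamma^\Lambda$, indexed by the pairs $(\nu,(a_1,\dots,a_n))$, form a $\mathbf k$-basis of $R_\beta^\Lambda/[R_\beta^\Lambda,R_\beta^\Lambda]$. -/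

import Mathlib

open scoped BigOperators

noncomputable section

namespace KLR

/-- A Cartan datum: a symmetrizable generalized Cartan matrix `A` indexed by `I`, together with
a weight lattice `P` (free abelian of finite rank), linearly independent simple roots in `P` and
simple coroots in `Hom(P, ℤ)`, and the entries `d i` of a symmetrizing diagonal matrix. -/
structure CartanDatum (I P : Type*) [AddCommGroup P] [Module.Free ℤ P] [Module.Finite ℤ P] where
  A : I → I → ℤ
  d : I → ℕ
  root : I → P
  coroot : I → Module.Dual ℤ P
  A_diag : ∀ i, A i i = 2
  A_nonpos : ∀ i j, i ≠ j → A i j ≤ 0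
  A_zero_iff : ∀ i j, A i j = 0 ↔ A j i = 0
  d_pos : ∀ i, 0 < d i
  symm : ∀ i j, (d i : ℤ) * A i j = (d j : ℤ) * A j i
  pairing : ∀ i j, coroot i (root j) = A i j
  linearIndependent_root : LinearIndependent ℤ root
  exists_fundamental : ∀ i, ∃ ϖ : P, coroot i ϖ = 1 ∧ ∀ j, j ≠ i → coroot j ϖ = 0

section

variable {I P : Type*} [AddCommGroup P] [Module.Free ℤ P] [Module.Finite ℤ P]

/-- The value `(α_i, α_j) = d_i a_{ij}` of the symmetric bilinear form on simple roots. -/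
def CartanDatum.form (D : CartanDatum I P) (i j : I) : ℤ := (D.d i : ℤ) * D.A i j

/-- Dominant integral weights. -/
def CartanDatum.IsDominant (D : CartanDatum I P) (Λ : P) : Prop := ∀ i, 0 ≤ D.coroot i Λ

/-- The homogeneous component of integral degree `m` of an `ℕ`-graded ring; it is zero for `m < 0`. -/
def gradedPiece {k : Type*} [CommRing k] (𝒜 : ℕ → AddSubgroup k) (m : ℤ) : AddSubgroup k :=
  if 0 ≤ m then 𝒜 m.toNat else ⊥

/-- The coefficient `c_{p,q}` of `u ^ p * v ^ q` in a polynomial in `u = X 0` and `v = X 1`. -/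
def coeff₂ {k : Type*} [CommRing k] (f : MvPolynomial (Fin 2) k) (p q : ℕ) : k :=
  f.coeff (Finsupp.single 0 p + Finsupp.single 1 q)

/-- The conditions on the polynomials `Q_{ij}(u, v)` over the graded ring `k` that enter the
definition of the Khovanov-Lauda-Rouquier algebra. -/
structure IsQMatrix (D : CartanDatum I P) {k : Type*} [CommRing k] (𝒜 : ℕ → AddSubgroup k)
    (Q : I → I → MvPolynomial (Fin 2) k) : Prop where
  symm : ∀ i j, Q i j = MvPolynomial.rename (Equiv.swap (0 : Fin 2) 1) (Q j i)
  diag : ∀ i, Q i i = 0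
  homogeneous : ∀ i j, i ≠ j → ∀ p q : ℕ,
    coeff₂ (Q i j) p q ∈ gradedPiece 𝒜 (-2 * D.form i j - D.form i i * p - D.form j j * q)
  isUnit_coeff : ∀ i j, i ≠ j → IsUnit (coeff₂ (Q i j) (-D.A i j).toNat 0)

/-- The conditions on the polynomials `a_i^Λ(u)`: monic of degree `N = ⟨α_i^∨, Λ⟩`, with the
coefficient of `u ^ (N - m)` homogeneous of degree `m (α_i, α_i)`. -/
structure IsCyclotomicFamily (D : CartanDatum I P) {k : Type*} [CommRing k]
    (𝒜 : ℕ → AddSubgroup k) (Λ : P) (a : I → Polynomial k) : Prop where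
  monic : ∀ i, (a i).Monic
  natDegree_eq : ∀ i, ((a i).natDegree : ℤ) = D.coroot i Λ
  homogeneous : ∀ i, ∀ m ≤ (a i).natDegree,
    (a i).coeff ((a i).natDegree - m) ∈ gradedPiece 𝒜 (m * D.form i i)

end

/-- The set `I^β` for `β = ∑ β_i α_i` in `Q_n^+`: the sequences `ν` in `I^n` with `∑ α_{ν_t} = β`
(it is empty unless `n` is the height of `β`). -/
def Weight {I : Type*} (n : ℕ) (β : I →₀ ℕ) : Type _ :=
  {ν : Fin n → I // ∑ t, Finsupp.single (ν t) 1 = β}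

namespace Weight

variable {I : Type*} {n : ℕ} {β : I →₀ ℕ}

instance : CoeFun (Weight n β) (fun _ => Fin n → I) := ⟨Subtype.val⟩

theorem mem_support (ν : Weight n β) (t : Fin n) : ν t ∈ β.support := by
  classical
  have h : (∑ s, Finsupp.single (ν s) 1 : I →₀ ℕ) (ν t) = β (ν t) := by rw [ν.2]
  rw [Finsupp.finsetSum_apply] at h
  have h1 : (Finsupp.single (ν t) 1 : I →₀ ℕ) (ν t)
      ≤ ∑ s, (Finsupp.single (ν s) 1 : I →₀ ℕ) (ν t) :=
    Finset.single_le_sum (f := fun s => (Finsupp.single (ν s) 1 : I →₀ ℕ) (ν t))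
      (fun _ _ => Nat.zero_le _) (Finset.mem_univ t)
  rw [Finsupp.single_eq_same] at h1
  rw [Finsupp.mem_support_iff]
  omega

instance : Finite (Weight n β) :=
  Finite.of_injective (fun (ν : Weight n β) (t : Fin n) => (⟨ν t, ν.mem_support t⟩ : β.support))
    (fun _ _ h => Subtype.ext (funext fun t => congrArg Subtype.val (congrFun h t)))

instance : Fintype (Weight n β) := Fintype.ofFinite _

/-- The action `(w.ν)_t = ν_{w⁻¹(t)}` of the symmetric group on `I^β`. -/
def act (w : Equiv.Perm (Fin n)) (ν : Weight n β) : Weight n β :=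
  ⟨fun t => ν (w⁻¹ t),
    (Equiv.sum_comp w⁻¹ (fun t => (Finsupp.single (ν t) 1 : I →₀ ℕ))).trans ν.2⟩

end Weight

/-- The generators `e(ν)`, `x_t`, `τ_l`. Positions are numbered from `0`, so `τ_l` with
`0 ≤ l < n - 1` belongs to the transposition of the positions `l` and `l + 1`. -/
inductive Gen {I : Type*} (n : ℕ) (β : I →₀ ℕ) : Type _
  | e (ν : Weight n β)
  | x (t : Fin n)
  | τ (l : Fin (n - 1))

/-- The position `l` in `{0, …, n - 1}`. -/
def lo {n : ℕ} (l : Fin (n - 1)) : Fin n := ⟨l, by omega⟩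

/-- The position `l + 1` in `{0, …, n - 1}`. -/
def hi {n : ℕ} (l : Fin (n - 1)) : Fin n := ⟨l + 1, by omega⟩

/-- The simple transposition `s_l` of the positions `l` and `l + 1`. -/
def simpleRefl {n : ℕ} (l : Fin (n - 1)) : Equiv.Perm (Fin n) := Equiv.swap (lo l) (hi l)

/-- The ordered monomial `x_1 ^ a_1 * ⋯ * x_n ^ a_n`. -/
def monomialAt {R : Type*} [Monoid R] {n : ℕ} (x : Fin n → R) (a : Fin n → ℕ) : R :=
  (List.ofFn fun t => x t ^ a t).prod

section

variable {I : Type*} {k : Type*} [CommRing k]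

/-- The polynomial `f(x_1, …, x_n)`, each monomial being written in the order `x_1, …, x_n`. -/
def polyAt {R : Type*} [Ring R] [Algebra k R] {n : ℕ} (x : Fin n → R)
    (f : MvPolynomial (Fin n) k) : R :=
  ∑ m ∈ f.support, f.coeff m • monomialAt x m

/-- `Q(X_r, X_s)` as a polynomial in `X_1, …, X_n`. -/
def subst₂ {n : ℕ} (f : MvPolynomial (Fin 2) k) (r s : Fin n) : MvPolynomial (Fin n) k :=
  MvPolynomial.aeval ![MvPolynomial.X r, MvPolynomial.X s] f

variable (Q : I → I → MvPolynomial (Fin 2) k) (n : ℕ) (β : I →₀ ℕ)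

/-- The free algebra on the generators `e(ν)`, `x_t`, `τ_l`. -/
abbrev FreeGen (k : Type*) [CommRing k] {I : Type*} (n : ℕ) (β : I →₀ ℕ) : Type _ :=
  FreeAlgebra k (Gen n β)

/-- `e(ν)` in the free algebra. -/
abbrev fe {n : ℕ} {β : I →₀ ℕ} (ν : Weight n β) : FreeGen k n β := FreeAlgebra.ι k (Gen.e ν)

/-- `x_t` in the free algebra. -/
abbrev fx {n : ℕ} {β : I →₀ ℕ} (t : Fin n) : FreeGen k n β := FreeAlgebra.ι k (Gen.x t)

/-- `τ_l` in the free algebra. -/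
abbrev fτ {n : ℕ} {β : I →₀ ℕ} (l : Fin (n - 1)) : FreeGen k n β := FreeAlgebra.ι k (Gen.τ l)

/-- The defining relations of the Khovanov-Lauda-Rouquier algebra. In `braid_eq` the polynomial
`h` is the exact quotient of `Q_{ν_l, ν_{l+1}}(x_l, x_{l+1}) - Q_{ν_{l+2}, ν_{l+1}}(x_{l+2}, x_{l+1})`
by `x_l - x_{l+2}`, where `l = lo r`, `l + 1 = hi r = lo s` and `l + 2 = hi s`. -/
inductive Rel : FreeGen k n β → FreeGen k n β → Prop
  | e_idem (ν : Weight n β) : Rel (fe ν * fe ν) (fe ν)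
  | e_orth (ν ν' : Weight n β) (h : ν ≠ ν') : Rel (fe ν * fe ν') 0
  | e_sum : Rel (∑ ν : Weight n β, fe ν) 1
  | x_comm (s t : Fin n) : Rel (fx s * fx t) (fx t * fx s)
  | x_e (t : Fin n) (ν : Weight n β) : Rel (fx t * fe ν) (fe ν * fx t)
  | τ_e (l : Fin (n - 1)) (ν : Weight n β) :
      Rel (fτ l * fe ν) (fe (Weight.act (simpleRefl l) ν) * fτ l)
  | τ_comm (r s : Fin (n - 1)) (h : (r : ℕ) + 1 < s ∨ (s : ℕ) + 1 < r) :
      Rel (fτ r * fτ s) (fτ s * fτ r)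
  | τ_sq (l : Fin (n - 1)) (ν : Weight n β) :
      Rel (fτ l * fτ l * fe ν)
        (polyAt fx (subst₂ (Q (ν (lo l)) (ν (hi l))) (lo l) (hi l)) * fe ν)
  | τ_x_lo (l : Fin (n - 1)) (ν : Weight n β) (h : ν (lo l) = ν (hi l)) :
      Rel ((fτ l * fx (lo l) - fx (hi l) * fτ l) * fe ν) (-fe ν)
  | τ_x_hi (l : Fin (n - 1)) (ν : Weight n β) (h : ν (lo l) = ν (hi l)) :
      Rel ((fτ l * fx (hi l) - fx (lo l) * fτ l) * fe ν) (fe ν)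
  | τ_x_other (l : Fin (n - 1)) (t : Fin n) (ν : Weight n β)
      (h : ¬ ((t = lo l ∨ t = hi l) ∧ ν (lo l) = ν (hi l))) :
      Rel ((fτ l * fx t - fx (simpleRefl l t) * fτ l) * fe ν) 0
  | braid_eq (r s : Fin (n - 1)) (hrs : (s : ℕ) = r + 1) (ν : Weight n β)
      (h : MvPolynomial (Fin n) k) (hν : ν (lo r) = ν (hi s))
      (hh : (MvPolynomial.X (lo r) - MvPolynomial.X (hi s)) * h =
        subst₂ (Q (ν (lo r)) (ν (hi r))) (lo r) (hi r)
          - subst₂ (Q (ν (hi s)) (ν (hi r))) (hi s) (hi r)) :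
      Rel ((fτ s * fτ r * fτ s - fτ r * fτ s * fτ r) * fe ν) (polyAt fx h * fe ν)
  | braid_ne (r s : Fin (n - 1)) (hrs : (s : ℕ) = r + 1) (ν : Weight n β)
      (hν : ν (lo r) ≠ ν (hi s)) :
      Rel ((fτ s * fτ r * fτ s - fτ r * fτ s * fτ r) * fe ν) 0

/-- The Khovanov-Lauda-Rouquier algebra `R_β`. -/
abbrev Alg : Type _ := RingQuot (Rel Q n β)

namespace Alg

variable {n β}

/-- The idempotent `e(ν)` of `R_β`. -/
def e (ν : Weight n β) : Alg Q n β := RingQuot.mkAlgHom k (Rel Q n β) (fe ν)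

/-- The element `x_t` of `R_β`. -/
def x (t : Fin n) : Alg Q n β := RingQuot.mkAlgHom k (Rel Q n β) (fx t)

/-- The element `τ_l` of `R_β`. -/
def τ (l : Fin (n - 1)) : Alg Q n β := RingQuot.mkAlgHom k (Rel Q n β) (fτ l)

/-- The element `x ^ a * e(ν)` of `R_β`. -/
def xe (m : Fin n → ℕ) (ν : Weight n β) : Alg Q n β := monomialAt (x Q) m * e Q ν

/-- The element `a_β^Λ(x_t) = ∑_ν a_{ν_t}^Λ(x_t) e(ν)` of `R_β`. -/
def cyc (a : I → Polynomial k) (t : Fin n) : Alg Q n β :=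
  ∑ ν : Weight n β, Polynomial.aeval (x Q t) (a (ν t)) * e Q ν

end Alg

/-- The two-sided ideal `I_{Λ,β}` of `R_β` generated by `a_β^Λ(x_1)`; the first position is
`t = 0` here, and for `n = 0` there is no such generator and the ideal is zero. -/
def cycIdeal (a : I → Polynomial k) : TwoSidedIdeal (Alg Q n β) :=
  TwoSidedIdeal.span {z | ∃ t : Fin n, (t : ℕ) = 0 ∧ z = Alg.cyc Q a t}

/-- The cyclotomic Khovanov-Lauda-Rouquier algebra `R_β^Λ = R_β / I_{Λ,β}`. -/
abbrev CycAlg (a : I → Polynomial k) : Type _ := (cycIdeal Q n β a).ringCon.Quotient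

/-- The canonical surjection from `R_β` to `R_β^Λ`. -/
def toCyc (a : I → Polynomial k) : Alg Q n β →+* CycAlg Q n β a := (cycIdeal Q n β a).ringCon.mk'

end

/-- The `k`-submodule `[R, R]` spanned by the commutators of `R`. -/
def commutators (k R : Type*) [CommRing k] [Ring R] [Algebra k R] : Submodule k R :=
  Submodule.span k {z | ∃ r s : R, z = r * s - s * r}

/-- The cocenter `R / [R, R]`. -/
abbrev Cocenter (k R : Type*) [CommRing k] [Ring R] [Algebra k R] : Type _ :=
  R ⧸ commutators k R

section

variable {I P : Type*} [AddCommGroup P] [Module.Free ℤ P] [Module.Finite ℤ P]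
  {n : ℕ} {β : I →₀ ℕ}

/-- The order on the entries of `γ` in which `γ_1 < γ_2 < ⋯ < γ_n`. -/
def ltOf (γ : Weight n β) (i j : I) : Prop := ∃ s t : Fin n, s < t ∧ γ s = i ∧ γ t = j

open Classical in
/-- The index `k_{ν,t}` in `{0, …, n}`, positions being numbered from `1` in its value: the
largest `p < t` with `ν_p < ν_t` in the order given by `γ`, and `0` if there is none. -/
def kIdx (γ ν : Weight n β) (t : Fin n) : ℕ :=
  (Finset.univ.filter fun p : Fin n => p < t ∧ ltOf γ (ν p) (ν t)).sup fun p => (p : ℕ) + 1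

/-- The exponent bound
`-∑_{l = max(k_{ν,t}, 1)}^{t-1} a_{ν_t, ν_l} + δ_{k_{ν,t}, 0} ⟨α_{ν_t}^∨, Λ⟩`; the position
`l : Fin n` has the number `l + 1`. -/
def bound (D : CartanDatum I P) (Λ : P) (γ ν : Weight n β) (t : Fin n) : ℤ :=
  -(∑ l ∈ Finset.univ.filter (fun l : Fin n => max (kIdx γ ν t) 1 ≤ (l : ℕ) + 1 ∧ l < t),
      D.A (ν t) (ν l))
    + if kIdx γ ν t = 0 then D.coroot (ν t) Λ else 0

/-- The index set of `T_γ^Λ`: the pairs `(ν, a)` for which `x ^ a * e(ν)` belongs to `T_γ^Λ`. -/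
def TIndex (D : CartanDatum I P) (Λ : P) (γ : Weight n β) : Type _ :=
  {m : Weight n β × (Fin n → ℕ) // ∀ t, (m.2 t : ℤ) < bound D Λ γ m.1 t}

end

end KLR

end

/-! As no simple root repeats in `β`, a sequence `ν` is an arrangement of `n` distinct colours, and
the sum over `ν` of the `x` attached to a fixed colour (`Alg.xCol`) is central. Each `e(ν) R_β e(ν)`
consists of polynomials in these central elements times `e(ν)` (`Alg.exists_e_mul_mul_e_eq`), so the
cocenter is a quotient of the free module on the sequences over the polynomial ring in the colours.
Two kinds of relations are visible: `Q_{cd} (e(ν) - e(s_l ν)) = 0` for the colours `c`, `d` at the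
places `l`, `l + 1`, because the two terms are products of the same elements in opposite order, and
`a_c(X_c) e(ν) = 0` for the first colour `c`. There are no others: `R_β` acts on this free module,
and the diagonal entries of the action form a trace modulo these relations (`diagonal_mul_sub_mem`),
since an entry that reverses the order of two colours in one of the directions is divisible by their
`Q`.

The explicit quotient is then treated as in Gröbner basis theory. Each word gets an initial letter
`⊥` smaller than all colours; a list that is not of this shape counts as zero, so that the
cyclotomic relation becomes the swap of the first colour with `⊥`. The relations are generated anew
by moves: a letter travels left past the larger letters before it and past the first smaller one,
which multiplies the difference of the two words by the product of the `q` of the pairs that cross.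
A move increases the word lexicographically, and each word has exactly one move for each place `t`.
The leading coefficient of that relation is monic in the colour at place `t`, of degree the bound
defining `T_γ^Λ` (`bnd_eq_bound`), and involves only colours at places up to `t`. Monicity uses that
a graded field sits in degree zero, which forces every other term of `Q_{ij}(u, v)` to have smaller
degree in `u` than `u ^ (-a_{ij})`.

Division by the leading coefficients gives spanning (`IsMonicSystem.span_reduced_sup`). For
independence, the leading coefficients at one word form a regular sequence, so their syzygies are
generated by the Koszul ones, and these reduce to zero through larger words (`move_confluent`).
Hence no nonzero relation has only reduced components (`IsMonicSystem.eq_zero_of_mem_cocenterRel`).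
-/

namespace KLR

/-! ### Products of crossing factors -/

section Fac

variable {ι S : Type*} [CommRing S]

/-- The product of `q c d` over the entries `d` of a list. -/
def fac (q : ι → ι → S) (c : ι) (F : List ι) : S := (F.map (q c)).prod

theorem fac_append (q : ι → ι → S) (c : ι) (F G : List ι) : fac q c (F ++ G) = fac q c F * fac q c G := by
  simp [fac]

theorem fac_cons (q : ι → ι → S) (c d : ι) (F : List ι) : fac q c (d :: F) = q c d * fac q c F := by
  simp [fac]

variable {M : Type*} [AddCommGroup M] [Module S M] {q : ι → ι → S} {e : List ι → M}

/-- Telescoping: `d` passes the letters of `F` one at a time, each swap with `b` costing a factor `q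
d b`. -/
theorem slide_mem {N : Submodule S M} (F X Y : List ι) {d : ι} (hd : d ∉ F)
    (hX : ∀ Z b Y, d ≠ b →
      q d b • (e (X ++ (Z ++ d :: b :: Y)) - e (X ++ (Z ++ b :: d :: Y))) ∈ N) :
    fac q d F • (e (X ++ (F ++ d :: Y)) - e (X ++ d :: (F ++ Y))) ∈ N := by
  induction F generalizing X with
  | nil => simp
  | cons b F ih =>
    rw [List.mem_cons, not_or] at hd
    have h₁ := ih (X ++ [b]) hd.2 (fun Z b' Y h => by simpa using hX (b :: Z) b' Y h)
    have h₂ := hX [] b (F ++ Y) hd.1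
    have : fac q d (b :: F) • (e (X ++ (b :: F ++ d :: Y)) - e (X ++ d :: (b :: F ++ Y)))
        = q d b • (fac q d F • (e (X ++ [b] ++ (F ++ d :: Y)) - e (X ++ [b] ++ d :: (F ++ Y))))
          - fac q d F • (q d b • (e (X ++ ([] ++ d :: b :: (F ++ Y)))
            - e (X ++ ([] ++ b :: d :: (F ++ Y))))) := by
      simp only [fac, List.map_cons, List.prod_cons, List.cons_append, List.append_assoc,
        List.nil_append]
      module
    rw [this]
    exact Submodule.sub_mem _ (Submodule.smul_mem _ _ h₁) (Submodule.smul_mem _ _ h₂)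

/-- Closes a confluence diagram: `u` and `v` both reduce to `w`, at the cost of the factors `f` and
`g`. -/
theorem smul_mul_sub_mem {N : Submodule S M} {f g : S} {u v w : M}
    (h₁ : f • (u - w) ∈ N) (h₂ : g • (v - w) ∈ N) : (f * g) • (u - v) ∈ N := by
  have : (f * g) • (u - v) = g • (f • (u - w)) - f • (g • (v - w)) := by module
  rw [this]
  exact Submodule.sub_mem _ (Submodule.smul_mem _ _ h₁) (Submodule.smul_mem _ _ h₂)

end Fac

/-! ### Moves of letters in words and their confluence -/

section Moves

variable {ι S M : Type*} [LinearOrder ι] [CommRing S] [AddCommGroup M] [Module S M]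

/-- The word `ν'` arises from `ν` by moving the letter `c` to the left, past the larger letters
preceding it and past the first smaller one; the letters passed are those of `F`. -/
inductive Move : List ι → ι → List ι → List ι → Prop
  | mk (L : List ι) (p : ι) (B : List ι) (c : ι) (R : List ι) (hp : p < c) (hB : ∀ b ∈ B, c < b) :
      Move (L ++ p :: (B ++ c :: R)) c (p :: B) (L ++ c :: p :: (B ++ R))

/-- The submodule spanned by the relations attached to the moves starting from words in `U`. -/
def moveRel (q : ι → ι → S) (e : List ι → M) (U : Set (List ι)) : Submodule S M :=
  Submodule.span S {z | ∃ μ ∈ U, ∃ c F μ', Move μ c F μ' ∧ z = fac q c F • (e μ - e μ')}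

theorem append_cons_lt_append_cons (L : List ι) {a b : ι} (h : a < b) (X Y : List ι) :
    L ++ a :: X < L ++ b :: Y := by
  induction L with
  | nil => exact List.Lex.rel h
  | cons x L ih => exact List.Lex.cons ih

theorem Move.lt {ν ν' : List ι} {c : ι} {F : List ι} (h : Move ν c F ν') : ν < ν' := by
  obtain ⟨L, p, B, c, R, hp, hB⟩ := h
  exact append_cons_lt_append_cons _ hp _ _

theorem Move.mem_moveRel {q : ι → ι → S} {e : List ι → M} {U : Set (List ι)} {μ μ' : List ι}
    {c : ι} {F : List ι} (h : Move μ c F μ') (hμ : μ ∈ U) :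
    fac q c F • (e μ - e μ') ∈ moveRel q e U :=
  Submodule.subset_span ⟨μ, hμ, c, F, μ', h, rfl⟩

variable {q : ι → ι → S} {e : List ι → M} {U : Set (List ι)}

/-- A swap of neighbours is, up to sign, the move of the larger letter with no letters in between.
It starts from the smaller of the two words, which may be either one; hence both are required to lie
in `U`. -/
theorem swap_mem_moveRel (hq : ∀ c d, q c d = q d c) (X Y : List ι) {c d : ι} (hcd : c ≠ d)
    (h₁ : X ++ c :: d :: Y ∈ U) (h₂ : X ++ d :: c :: Y ∈ U) :
    q c d • (e (X ++ c :: d :: Y) - e (X ++ d :: c :: Y)) ∈ moveRel q e U := by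
  rcases lt_or_gt_of_ne hcd with h | h
  · have := (Move.mk X c [] d Y h (by simp)).mem_moveRel (q := q) (e := e) h₁
    simpa [fac, hq d c] using this
  · have := (Move.mk X d [] c Y h (by simp)).mem_moveRel (q := q) (e := e) h₂
    rw [← neg_sub, smul_neg]
    exact Submodule.neg_mem _ (by simpa [fac] using this)

/-- Two moves of different letters of a word can be completed to a commutative diagram through
larger words. -/
theorem move_confluent_aux (hq : ∀ c d, q c d = q d c) {L p B c R₁ d R₂ L' p' B'}
    (hp : p < c) (hB : ∀ b ∈ B, c < b) (hp' : p' < d) (hB' : ∀ b ∈ B', d < b)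
    (hL : L' ++ p' :: B' = L ++ p :: (B ++ c :: R₁)) :
    (fac q c (p :: B) * fac q d (p' :: B')) •
      (e (L ++ c :: p :: (B ++ (R₁ ++ d :: R₂))) - e (L' ++ d :: p' :: (B' ++ R₂)))
      ∈ moveRel q e {μ | L ++ p :: (B ++ c :: (R₁ ++ d :: R₂)) < μ} := by
  -- Every intermediate word begins with `L, c` or with `L', d`, which already makes it larger than
  -- the starting word.
  have hlt : ∀ Z, L ++ p :: (B ++ c :: (R₁ ++ d :: R₂)) < L ++ c :: Z :=
    fun Z => append_cons_lt_append_cons _ hp _ _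
  have hlt' : ∀ Z, L ++ p :: (B ++ c :: (R₁ ++ d :: R₂)) < L' ++ d :: Z := fun Z => by
    have := append_cons_lt_append_cons L' hp' (B' ++ d :: R₂) Z
    have h : L' ++ p' :: (B' ++ d :: R₂) = L ++ p :: (B ++ c :: (R₁ ++ d :: R₂)) := by
      have := congrArg (· ++ d :: R₂) hL
      simpa using this
    rwa [h] at this
  set U : Set (List ι) := {μ | L ++ p :: (B ++ c :: (R₁ ++ d :: R₂)) < μ} with hU
  -- positions of `p'`
  have hcases : (∃ W, R₁ = W ++ p' :: B' ∧ L' = L ++ p :: (B ++ c :: W)) ∨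
      (p' = c ∧ B' = R₁ ∧ L' = L ++ p :: B) ∨
      (p' = p ∧ L' = L ∧ B' = B ++ c :: R₁) ∨
      (∃ V, L = L' ++ p' :: V ∧ B' = V ++ p :: (B ++ c :: R₁)) := by
    rcases List.append_eq_append_iff.1 hL with ⟨V, hV₁, hV₂⟩ | ⟨V, hV₁, hV₂⟩
    · rcases V with _ | ⟨v, V⟩
      · simp only [List.nil_append, List.cons.injEq, List.append_nil] at hV₁ hV₂
        exact Or.inr (Or.inr (Or.inl ⟨hV₂.1, hV₁.symm, hV₂.2⟩))
      · simp only [List.cons_append, List.cons.injEq] at hV₂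
        obtain ⟨rfl, hV₂⟩ := hV₂
        exact Or.inr (Or.inr (Or.inr ⟨V, hV₁, hV₂⟩))
    · rcases V with _ | ⟨v, V⟩
      · simp only [List.nil_append, List.cons.injEq, List.append_nil] at hV₁ hV₂
        exact Or.inr (Or.inr (Or.inl ⟨hV₂.1.symm, hV₁, hV₂.2.symm⟩))
      · simp only [List.cons_append, List.cons.injEq] at hV₂
        obtain ⟨rfl, hV₂⟩ := hV₂
        rcases List.append_eq_append_iff.1 hV₂ with ⟨W, hW₁, hW₂⟩ | ⟨W, hW₁, hW₂⟩
        · rcases W with _ | ⟨w, W⟩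
          · simp only [List.nil_append, List.cons.injEq, List.append_nil] at hW₁ hW₂
            exact Or.inr (Or.inl ⟨hW₂.1.symm, hW₂.2.symm, by rw [hV₁, hW₁]⟩)
          · simp only [List.cons_append, List.cons.injEq] at hW₂
            obtain ⟨rfl, hW₂⟩ := hW₂
            exact Or.inl ⟨W, hW₂, by rw [hV₁, hW₁]⟩
        · rcases W with _ | ⟨w, W⟩
          · simp only [List.nil_append, List.cons.injEq, List.append_nil] at hW₁ hW₂
            exact Or.inr (Or.inl ⟨hW₂.1, hW₂.2, by rw [hV₁, hW₁]⟩)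
          · simp only [List.cons_append, List.cons.injEq] at hW₂
            obtain ⟨rfl, hW₂⟩ := hW₂
            -- `p'` lies in `B`, hence is larger than `c`, and `c` lies in `B'`
            have h₁ : c < p' := hB p' (by rw [hW₁]; simp)
            have h₂ : d < c := hB' c (by rw [hW₂]; simp)
            exact absurd (h₁.trans (hp'.trans h₂)) (lt_irrefl _)
  rcases hcases with ⟨W, hR, hL'⟩ | ⟨hpc, hBR, hL'⟩ | ⟨hpp, hL', hBB⟩ | ⟨V, hL', hBV⟩
  -- Here `d` stops to the right of `c`: the two moves do not interact and commute.
  · have h₁ := (Move.mk (L ++ c :: p :: (B ++ W)) p' B' d R₂ hp' hB').mem_moveRel (q := q) (e := e)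
      (U := U) (by simpa [hU] using hlt (p :: (B ++ (W ++ p' :: (B' ++ d :: R₂)))))
    have h₂ := (Move.mk L p B c (W ++ d :: p' :: (B' ++ R₂)) hp hB).mem_moveRel (q := q) (e := e)
      (U := U) (by simpa [hU, hL'] using hlt' (p' :: (B' ++ R₂)))
    rw [mul_comm]
    refine smul_mul_sub_mem
      (w := e (L ++ c :: p :: (B ++ (W ++ d :: p' :: (B' ++ R₂))))) ?_ ?_
    · simpa [hR] using h₁
    · simpa [hL'] using h₂
  -- Here `d` stops just left of `c`. If `c` has moved first, `d` is brought next to `B` by plain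
  -- swaps through `B'`; if `d` has moved first, `c` has to pass `d` as well, which accounts for the
  -- extra factor.
  · subst hpc hBR hL'
    have hX : ∀ Z, L ++ p' :: p :: B ++ Z ∈ U := fun Z => by simpa [hU] using hlt (p :: (B ++ Z))
    have h₁ := slide_mem (e := e) B' (L ++ p' :: p :: B) R₂
      (fun h => lt_irrefl _ (hB' _ h)) (N := moveRel q e U) (fun Z b Y hb => by
        have := swap_mem_moveRel (e := e) hq (L ++ p' :: p :: B ++ Z) Y hb (U := U)
          (by simpa using hX _) (by simpa using hX _)
        simpa using this)
    have h₂ := (Move.mk L p (B ++ [d]) p' (B' ++ R₂) hp (by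
        intro b hb
        rcases List.mem_append.1 hb with hb | hb
        · exact hB b hb
        · rwa [List.mem_singleton.1 hb])).mem_moveRel (q := q) (e := e)
      (U := U) (by simpa [hU] using hlt' (p' :: (B' ++ R₂)))
    have hf : fac q p' (p :: B) * fac q d (p' :: B') = fac q d B' * fac q p' (p :: (B ++ [d])) := by
      simp only [fac_cons, fac_append, hq d p']
      simp only [fac, List.map_nil, List.prod_nil]
      ring
    rw [hf]
    refine smul_mul_sub_mem (w := e (L ++ p' :: p :: (B ++ d :: (B' ++ R₂)))) ?_ ?_
    · simpa using h₁
    · simpa using h₂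
  -- Both letters stop in front of the same `p`. The two orders of moving end in `c, d, p` and `d,
  -- c, p`, and a swap joins them; its factor is available because `d` has passed `c`.
  · subst hpp hL' hBB
    have hdc : d < c := hB' c (by simp)
    have h₁ := (Move.mk (L' ++ [c]) p' (B ++ R₁) d R₂ hp' (fun b hb => hB' b (by
        rcases List.mem_append.1 hb with hb | hb <;> simp [hb]))).mem_moveRel (q := q) (e := e)
      (U := U) (by simpa [hU] using hlt (p' :: (B ++ (R₁ ++ d :: R₂))))
    have h₂ := (Move.mk (L' ++ [d]) p' B c (R₁ ++ R₂) hp hB).mem_moveRel (q := q) (e := e)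
      (U := U) (by simpa [hU] using hlt' (p' :: (B ++ c :: (R₁ ++ R₂))))
    have h₃ := swap_mem_moveRel (e := e) hq L' (p' :: (B ++ (R₁ ++ R₂))) hdc.ne' (U := U)
      (hlt _) (hlt' _)
    have hf : fac q c (p' :: B) * fac q d (p' :: (B ++ c :: R₁))
        = (fac q d (p' :: (B ++ R₁)) * q c d) * fac q c (p' :: B) := by
      simp only [fac_cons, fac_append, hq d c]
      ring
    rw [hf]
    refine smul_mul_sub_mem (w := e (L' ++ d :: c :: p' :: (B ++ (R₁ ++ R₂)))) ?_ ?_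
    · have h₁' : fac q d (p' :: (B ++ R₁)) • (e (L' ++ c :: p' :: (B ++ (R₁ ++ d :: R₂)))
          - e (L' ++ c :: d :: p' :: (B ++ (R₁ ++ R₂)))) ∈ moveRel q e U := by simpa using h₁
      have : (fac q d (p' :: (B ++ R₁)) * q c d) • (e (L' ++ c :: p' :: (B ++ (R₁ ++ d :: R₂)))
          - e (L' ++ d :: c :: p' :: (B ++ (R₁ ++ R₂)))) =
          q c d • (fac q d (p' :: (B ++ R₁)) • (e (L' ++ c :: p' :: (B ++ (R₁ ++ d :: R₂)))
          - e (L' ++ c :: d :: p' :: (B ++ (R₁ ++ R₂))))) + fac q d (p' :: (B ++ R₁)) •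
          (q c d • (e (L' ++ c :: d :: p' :: (B ++ (R₁ ++ R₂)))
            - e (L' ++ d :: c :: p' :: (B ++ (R₁ ++ R₂))))) := by module
      rw [this]
      exact Submodule.add_mem _ (Submodule.smul_mem _ _ h₁') (Submodule.smul_mem _ _ h₃)
    · simpa using h₂
  -- Here `d` passes all letters involved in the move of `c`, including `p`, and the moves commute
  -- again.
  · subst hL' hBV
    have h₁ := (Move.mk L' p' (V ++ c :: p :: (B ++ R₁)) d R₂ hp' (fun b hb => hB' b (by
        simp only [List.mem_append, List.mem_cons] at hb ⊢; tauto))).mem_moveRel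
      (q := q) (e := e) (U := U) (by simpa [hU] using hlt (p :: (B ++ (R₁ ++ d :: R₂))))
    have h₂ := (Move.mk (L' ++ d :: p' :: V) p B c (R₁ ++ R₂) hp hB).mem_moveRel (q := q) (e := e)
      (U := U) (by simpa [hU] using hlt' (p' :: (V ++ p :: (B ++ c :: (R₁ ++ R₂)))))
    have hf : fac q c (p :: B) * fac q d (p' :: (V ++ p :: (B ++ c :: R₁)))
        = fac q d (p' :: (V ++ c :: p :: (B ++ R₁))) * fac q c (p :: B) := by
      simp only [fac_cons, fac_append]
      ring
    rw [hf]
    refine smul_mul_sub_mem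
      (w := e (L' ++ d :: p' :: (V ++ c :: p :: (B ++ (R₁ ++ R₂))))) ?_ ?_
    · simpa using h₁
    · simpa using h₂

/-- The letter `c` has one position only, and `p` has to be the last letter before it that is
smaller. -/
theorem Move.unique {ν ν₁ ν₂ : List ι} (hnd : ν.Nodup) {c : ι} {F₁ F₂ : List ι}
    (h₁ : Move ν c F₁ ν₁) (h₂ : Move ν c F₂ ν₂) : F₁ = F₂ ∧ ν₁ = ν₂ := by
  obtain ⟨L, p, B, c, R, hp, hB⟩ := h₁
  generalize hμ : L ++ p :: (B ++ c :: R) = μ at h₂ hnd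
  obtain ⟨L', p', B', c, R', hp', hB'⟩ := h₂
  have key : L ++ p :: B = L' ++ p' :: B' ∧ R = R' := by
    have hμ' : (L ++ p :: B) ++ c :: R = (L' ++ p' :: B') ++ c :: R' := by simpa using hμ
    have hnd' : ((L' ++ p' :: B') ++ c :: R').Nodup := by simpa using hnd
    have hnd'' : ((L ++ p :: B) ++ c :: R).Nodup := by rw [hμ']; exact hnd'
    have hc' : c ∉ L' ++ p' :: B' := fun h =>
      (List.nodup_append.1 hnd').2.2 _ h c (by simp) rfl
    have hc'' : c ∉ L ++ p :: B := fun h =>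
      (List.nodup_append.1 hnd'').2.2 _ h c (by simp) rfl
    rcases List.append_eq_append_iff.1 hμ' with ⟨V, hV₁, hV₂⟩ | ⟨V, hV₁, hV₂⟩
    · rcases V with _ | ⟨v, V⟩
      · simp only [List.nil_append, List.cons.injEq, List.append_nil] at hV₁ hV₂
        exact ⟨hV₁.symm, hV₂.2⟩
      · simp only [List.cons_append, List.cons.injEq] at hV₂
        exact absurd (by rw [hV₁, hV₂.1]; simp) hc'
    · rcases V with _ | ⟨v, V⟩
      · simp only [List.nil_append, List.cons.injEq, List.append_nil] at hV₁ hV₂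
        exact ⟨hV₁, hV₂.2.symm⟩
      · simp only [List.cons_append, List.cons.injEq] at hV₂
        exact absurd (by rw [hV₁, hV₂.1]; simp) hc''
  obtain ⟨h, rfl⟩ := key
  have key : L = L' ∧ p = p' ∧ B = B' := by
    rcases List.append_eq_append_iff.1 h with ⟨V, hV₁, hV₂⟩ | ⟨V, hV₁, hV₂⟩
    · rcases V with _ | ⟨v, V⟩
      · simp only [List.nil_append, List.cons.injEq, List.append_nil] at hV₁ hV₂
        exact ⟨hV₁.symm, hV₂.1, hV₂.2⟩
      · simp only [List.cons_append, List.cons.injEq] at hV₂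
        exact absurd (hB p' (by rw [hV₂.2]; simp)) hp'.not_gt
    · rcases V with _ | ⟨v, V⟩
      · simp only [List.nil_append, List.cons.injEq, List.append_nil] at hV₁ hV₂
        exact ⟨hV₁, hV₂.1.symm, hV₂.2.symm⟩
      · simp only [List.cons_append, List.cons.injEq] at hV₂
        exact absurd (hB' p (by rw [hV₂.2]; simp)) hp.not_gt
  obtain ⟨rfl, rfl, rfl⟩ := key
  exact ⟨rfl, rfl⟩

/-- The analogue of Buchberger's criterion: the S-pair of two relations with the same leading word
`ν` is a combination of relations with larger leading words. -/
theorem move_confluent (hq : ∀ c d, q c d = q d c) {ν ν₁ ν₂ : List ι} (hnd : ν.Nodup) {c d : ι}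
    {F₁ F₂ : List ι} (h₁ : Move ν c F₁ ν₁) (h₂ : Move ν d F₂ ν₂) :
    (fac q c F₁ * fac q d F₂) • (e ν₁ - e ν₂) ∈ moveRel q e {μ | ν < μ} := by
  have h₁' := h₁
  have h₂' := h₂
  obtain ⟨L, p, B, c, R, hp, hB⟩ := h₁
  generalize hμ : L ++ p :: (B ++ c :: R) = μ at h₂ hnd
  obtain ⟨L', p', B', d, R', hp', hB'⟩ := h₂
  have hμ' : (L ++ p :: B) ++ c :: R = (L' ++ p' :: B') ++ d :: R' := by simpa using hμ
  rcases List.append_eq_append_iff.1 hμ' with ⟨V, hV₁, hV₂⟩ | ⟨V, hV₁, hV₂⟩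
  · rcases V with _ | ⟨v, V⟩
    · simp only [List.nil_append, List.cons.injEq, List.append_nil] at hV₁ hV₂
      obtain ⟨rfl, rfl⟩ := hV₂
      rw [hμ] at h₁'
      obtain ⟨-, h⟩ := h₁'.unique hnd (hμ ▸ h₂')
      rw [h, sub_self, smul_zero]
      exact Submodule.zero_mem _
    · simp only [List.cons_append, List.cons.injEq] at hV₂
      obtain ⟨rfl, rfl⟩ := hV₂
      rw [← hμ]
      exact move_confluent_aux hq hp hB hp' hB' (by simpa using hV₁)
  · rcases V with _ | ⟨v, V⟩
    · simp only [List.nil_append, List.cons.injEq, List.append_nil] at hV₁ hV₂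
      obtain ⟨rfl, rfl⟩ := hV₂
      rw [hμ] at h₁'
      obtain ⟨-, h⟩ := h₁'.unique hnd (hμ ▸ h₂')
      rw [h, sub_self, smul_zero]
      exact Submodule.zero_mem _
    · simp only [List.cons_append, List.cons.injEq] at hV₂
      obtain ⟨rfl, rfl⟩ := hV₂
      rw [mul_comm, ← neg_sub, smul_neg]
      exact Submodule.neg_mem _ (move_confluent_aux hq hp' hB' hp hB (by simpa using hV₁))

theorem exists_move (X : List ι) (c : ι) (R : List ι) (hX : c ∉ X) (h : ∃ p ∈ X, p < c) :
    ∃ F ν', Move (X ++ c :: R) c F ν' ∧ F <:+ X := by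
  suffices H : ∃ L p B, X = L ++ p :: B ∧ p < c ∧ ∀ b ∈ B, c < b by
    obtain ⟨L, p, B, rfl, hp, hB⟩ := H
    exact ⟨p :: B, L ++ c :: p :: (B ++ R), by simpa using Move.mk L p B c R hp hB, L, rfl⟩
  induction X using List.reverseRecOn with
  | nil => simp at h
  | append_singleton X x ih =>
    simp only [List.mem_append, List.mem_singleton, not_or] at hX h
    rcases lt_or_gt_of_ne hX.2 with hx | hx
    · obtain ⟨p, hpX | rfl, hp⟩ := h
      · obtain ⟨L, p, B, rfl, hp, hB⟩ := ih hX.1 ⟨p, hpX, hp⟩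
        refine ⟨L, p, B ++ [x], by simp, hp, fun b hb => ?_⟩
        rcases List.mem_append.1 hb with hb | hb
        · exact hB b hb
        · rwa [List.mem_singleton.1 hb]
      · exact absurd hp hx.not_gt
    · exact ⟨X, x, [], rfl, hx, by simp⟩

theorem Move.perm {ν ν' : List ι} {c : ι} {F : List ι} (h : Move ν c F ν') : ν'.Perm ν := by
  obtain ⟨L, p, B, c, R, hp, hB⟩ := h
  refine List.Perm.append_left L ?_
  rw [← List.cons_append, ← List.cons_append]
  exact List.perm_middle.symm

end Moves

end KLR

namespace KLR

/-! ### Polynomials monic in one variable -/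

section MonicIn

open MvPolynomial

variable {σ k : Type*} [CommRing k]

/-- The polynomial `f` has degree `b` in the variable `i`, with `X i ^ b` times a unit as the only
term of this degree. -/
def MonicIn (i : σ) (b : ℕ) (f : MvPolynomial σ k) : Prop :=
  ∃ (u : kˣ) (r : MvPolynomial σ k), (∀ m ∈ r.support, m i < b) ∧ f = C (u : k) * X i ^ b + r

theorem support_mul_lt {i : σ} {a b : ℕ} {f g : MvPolynomial σ k} (hf : ∀ m ∈ f.support, m i < a)
    (hg : ∀ m ∈ g.support, m i ≤ b) : ∀ m ∈ (f * g).support, m i < a + b := by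
  classical
  intro m hm
  obtain ⟨m₁, h₁, m₂, h₂, rfl⟩ := Finset.mem_add.1 (support_mul f g hm)
  have := hf _ h₁
  have := hg _ h₂
  rw [Finsupp.add_apply]
  omega

theorem support_add_lt {i : σ} {a : ℕ} {f g : MvPolynomial σ k} (hf : ∀ m ∈ f.support, m i < a)
    (hg : ∀ m ∈ g.support, m i < a) : ∀ m ∈ (f + g).support, m i < a := by
  classical
  intro m hm
  rcases Finset.mem_union.1 (support_add hm) with h | h
  exacts [hf m h, hg m h]

theorem support_C_mul_X_pow_le (i : σ) (u : k) (b : ℕ) :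
    ∀ m ∈ (C u * X i ^ b : MvPolynomial σ k).support, m i ≤ b := by
  classical
  intro m hm
  rw [X_pow_eq_monomial, C_mul_monomial] at hm
  rw [Finset.mem_singleton.1 (support_monomial_subset hm), Finsupp.single_eq_same]

theorem MonicIn.one (i : σ) : MonicIn i 0 (1 : MvPolynomial σ k) :=
  ⟨1, 0, by simp, by simp⟩

theorem MonicIn.mul {i : σ} {a b : ℕ} {f g : MvPolynomial σ k} (hf : MonicIn i a f)
    (hg : MonicIn i b g) : MonicIn i (a + b) (f * g) := by
  obtain ⟨u, r, hr, rfl⟩ := hf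
  obtain ⟨v, s, hs, rfl⟩ := hg
  refine ⟨u * v, r * (C (v : k) * X i ^ b) + (s * (C (u : k) * X i ^ a) + r * s), ?_, ?_⟩
  · refine support_add_lt (support_mul_lt hr (support_C_mul_X_pow_le _ _ _))
      (support_add_lt ?_ (support_mul_lt hr fun m hm => (hs m hm).le))
    rw [add_comm a b]
    exact support_mul_lt hs (support_C_mul_X_pow_le _ _ _)
  · simp only [Units.val_mul, C_mul, pow_add]
    ring

open Classical in
/-- A polynomial viewed as a polynomial in the variable `i`. -/
noncomputable def toPoly (i : σ) : MvPolynomial σ k →ₐ[k] Polynomial (MvPolynomial σ k) :=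
  aeval fun j => if j = i then Polynomial.X else Polynomial.C (X j)

/-- The coefficients of `toPoly i f` lie in the full polynomial ring, so `X i` can be substituted
back. This allows membership in an ideal to be deduced from that of the coefficients. -/
theorem eval_toPoly (i : σ) (f : MvPolynomial σ k) : (toPoly i f).eval (X i) = f := by
  have : ((Polynomial.aeval (X i : MvPolynomial σ k)).restrictScalars k).comp (toPoly i)
      = AlgHom.id k (MvPolynomial σ k) := by
    ext j
    by_cases h : j = i <;> simp [toPoly, h]
  have := DFunLike.congr_fun this f
  simpa using this

theorem toPoly_of_mem_supported {i : σ} {Z : Set σ} (hi : i ∉ Z) {f : MvPolynomial σ k}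
    (hf : f ∈ supported k Z) : toPoly i f = Polynomial.C f := by
  unfold supported at hf
  induction hf using Algebra.adjoin_induction with
  | mem x hx =>
    obtain ⟨j, hj, rfl⟩ := hx
    have : j ≠ i := fun h => hi (h ▸ hj)
    simp [toPoly, this]
  | algebraMap r => simp [toPoly]
  | add x y _ _ hx hy => rw [map_add, map_add, hx, hy]
  | mul x y _ _ hx hy => rw [map_mul, map_mul, hx, hy]

theorem degree_toPoly_lt {i : σ} {b : ℕ} {r : MvPolynomial σ k} (hr : ∀ m ∈ r.support, m i < b) :
    (toPoly i r).degree < b := by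
  rw [← Polynomial.mem_degreeLT, r.as_sum, map_sum]
  refine Submodule.sum_mem _ fun m hm => ?_
  rw [Polynomial.mem_degreeLT]
  have h : ∃ g, toPoly i (monomial m (coeff m r)) = Polynomial.C g * Polynomial.X ^ (m i) := by
    classical
    rw [toPoly, aeval_monomial, Finsupp.prod]
    have h2 : ∀ s : Finset σ, ∃ g : MvPolynomial σ k, ∏ j ∈ s, (if j = i then Polynomial.X else
        Polynomial.C (X j : MvPolynomial σ k)) ^ m j
          = Polynomial.C g * Polynomial.X ^ (if i ∈ s then m i else 0) := by
      intro s
      induction s using Finset.induction_on with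
      | empty => exact ⟨1, by simp⟩
      | insert j s hj ih =>
        obtain ⟨g, hg⟩ := ih
        rw [Finset.prod_insert hj, hg]
        by_cases hji : j = i
        · subst hji
          exact ⟨g, by rw [if_pos rfl, if_neg hj, if_pos (Finset.mem_insert_self _ _), pow_zero, mul_one,
            mul_comm]⟩
        · exact ⟨X j ^ m j * g, by simp [hji, Ne.symm hji, mul_assoc]⟩
    obtain ⟨g, hg⟩ := h2 m.support
    rw [hg]
    have : (if i ∈ m.support then m i else 0) = m i := by
      split_ifs with h
      · rfl
      · exact (Finsupp.notMem_support_iff.1 h).symm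
    rw [this]
    exact ⟨C (coeff m r) * g, by
      rw [Polynomial.C_mul, mul_assoc]; rfl⟩
  obtain ⟨g, hg⟩ := h
  rw [hg]
  exact (Polynomial.degree_C_mul_X_pow_le _ _).trans_lt (by exact_mod_cast hr m hm)

theorem MonicIn.toPoly {i : σ} {b : ℕ} {f : MvPolynomial σ k} (hf : MonicIn i b f) :
    ∃ u : kˣ, ∃ r : Polynomial (MvPolynomial σ k), r.degree < b ∧
      toPoly i (C (u : k) * f) = Polynomial.X ^ b + r := by
  obtain ⟨u, r, hr, rfl⟩ := hf
  refine ⟨u⁻¹, KLR.toPoly i (C ((u⁻¹ : kˣ) : k) * r), degree_toPoly_lt ?_, ?_⟩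
  · intro m hm
    refine hr m ?_
    rw [mem_support_iff, coeff_C_mul] at hm
    exact mem_support_iff.2 (right_ne_zero_of_mul hm)
  · rw [mul_add, ← mul_assoc, ← C_mul, Units.inv_mul, C_1, one_mul, map_add, map_pow]
    simp [KLR.toPoly]

/-- Let `J` be generated by polynomials not involving the variable `i`. A polynomial which is monic
in `i` is regular modulo `J`, and no polynomial of smaller degree is a multiple of it. -/
theorem MonicIn.mem_of_add_mul_mem {i : σ} {b : ℕ} {f : MvPolynomial σ k} (hf : MonicIn i b f)
    {Z : Set σ} (hi : i ∉ Z) {A : Set (MvPolynomial σ k)} (hA : ∀ a ∈ A, a ∈ supported k Z)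
    {g h : MvPolynomial σ k} (hh : ∀ m ∈ h.support, m i < b) (hmem : h + f * g ∈ Ideal.span A) :
    h ∈ Ideal.span A ∧ g ∈ Ideal.span A := by
  set J := Ideal.span A with hJ
  -- The generators of `J` become constant polynomials, so all coefficients of an element of `J` are
  -- again in `J`.
  have hmap : ∀ x ∈ J, (KLR.toPoly i x).map (Ideal.Quotient.mk J) = 0 := by
    intro x hx
    have : KLR.toPoly i x ∈ J.map Polynomial.C := by
      have h1 : J ≤ (J.map Polynomial.C).comap (KLR.toPoly (k := k) i) := by
        rw [hJ, Ideal.span_le]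
        intro a ha
        rw [SetLike.mem_coe, Ideal.mem_comap, toPoly_of_mem_supported hi (hA a ha)]
        exact Ideal.mem_map_of_mem _ (Ideal.subset_span ha)
      exact h1 hx
    rw [Ideal.mem_map_C_iff] at this
    ext n
    rw [Polynomial.coeff_map, Polynomial.coeff_zero]
    exact Ideal.Quotient.eq_zero_iff_mem.2 (this n)
  have hback : ∀ x, (KLR.toPoly i x).map (Ideal.Quotient.mk J) = 0 → x ∈ J := by
    intro x hx
    rw [← eval_toPoly i x, Polynomial.eval_eq_sum_range]
    refine Ideal.sum_mem _ fun n _ => Ideal.mul_mem_right _ _ ?_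
    rw [← Ideal.Quotient.eq_zero_iff_mem, ← Polynomial.coeff_map, hx, Polynomial.coeff_zero]
  obtain ⟨u, r, hr, hu⟩ := hf.toPoly
  have hG : (KLR.toPoly i g).map (Ideal.Quotient.mk J) = 0 := by
    by_contra hne
    have hnt : Nontrivial (MvPolynomial σ k ⧸ J) := by
      by_contra hnt
      rw [not_nontrivial_iff_subsingleton] at hnt
      exact hne (Subsingleton.elim _ _)
    have hmon : (Polynomial.X ^ b + r.map (Ideal.Quotient.mk J)).Monic :=
      Polynomial.monic_X_pow_add (Polynomial.degree_map_le.trans_lt hr)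
    have hdeg : (Polynomial.X ^ b + r.map (Ideal.Quotient.mk J)).degree = (b : WithBot ℕ) := by
      rw [Polynomial.degree_add_eq_left_of_degree_lt, Polynomial.degree_X_pow]
      rw [Polynomial.degree_X_pow]
      exact Polynomial.degree_map_le.trans_lt hr
    have h0 := hmap _ (J.mul_mem_left (C (u : k)) hmem)
    rw [mul_add, ← mul_assoc, map_add, map_mul _ (C (u : k) * f), hu, Polynomial.map_add,
      Polynomial.map_mul, Polynomial.map_add, Polynomial.map_pow, Polynomial.map_X] at h0
    -- Modulo `J` the scaled `f` is monic of degree `b`, so its product with a nonzero `g` has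
    -- degree at least `b`, whereas `h` has smaller degree.
    have h1 := congrArg Polynomial.degree (eq_neg_of_add_eq_zero_left h0)
    rw [Polynomial.degree_neg, hmon.degree_mul_comm, hmon.degree_mul,
      hdeg] at h1
    have h2 : ((KLR.toPoly i (C (u : k) * h)).map (Ideal.Quotient.mk J)).degree < b := by
      refine Polynomial.degree_map_le.trans_lt (degree_toPoly_lt fun m hm => hh m ?_)
      rw [mem_support_iff, coeff_C_mul] at hm
      exact mem_support_iff.2 (right_ne_zero_of_mul hm)
    rw [h1, Polynomial.degree_eq_natDegree hne] at h2
    exact absurd h2 (by norm_cast; omega)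
  have hg := hback _ hG
  exact ⟨(J.add_mem_iff_left (J.mul_mem_left f hg)).1 hmem, hg⟩

end MonicIn

/-! ### Triangular regular sequences -/

section RegularSequence

open MvPolynomial

variable {S W : Type*} [CommRing S] [AddCommGroup W] [Module S W]

/-- The syzygies of a regular sequence are generated by the Koszul relations. -/
theorem sum_smul_eq_zero_of_koszul {n : ℕ} (f : Fin n → S) (w : Fin n → W)
    (hreg : ∀ t g, f t * g ∈ Ideal.span (f '' {s | s < t}) → g ∈ Ideal.span (f '' {s | s < t}))
    (hw : ∀ s t, f s • w t = f t • w s) (h : Fin n → S) (h0 : ∑ t, h t * f t = 0) :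
    ∑ t, h t • w t = 0 := by
  induction n with
  | zero => simp
  | succ n ih =>
    have himg : f '' {s | s < Fin.last n} = Set.range (fun t : Fin n => f t.castSucc) := by
      ext x
      constructor
      · rintro ⟨s, hs, rfl⟩
        exact ⟨s.castPred (ne_of_lt hs), by simp⟩
      · rintro ⟨s, rfl⟩
        exact ⟨_, Fin.castSucc_lt_last s, rfl⟩
    rw [Fin.sum_univ_castSucc] at h0 ⊢
    -- By regularity the last coefficient is `∑ r t * f t` over the earlier `t`. The symmetry `hw`
    -- turns `f t • w last` into `f last • w t`, so it is absorbed into the earlier coefficients as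
    -- `r t * f last`.
    have hlast : h (Fin.last n) ∈ Ideal.span (f '' {s | s < Fin.last n}) := by
      refine hreg _ _ ?_
      rw [mul_comm, eq_neg_of_add_eq_zero_right h0, himg]
      refine neg_mem (Ideal.sum_mem _ fun t _ => Ideal.mul_mem_left _ _ (Ideal.subset_span ⟨t, rfl⟩))
    rw [himg, Ideal.mem_span_range_iff_exists_fun] at hlast
    obtain ⟨r, hr⟩ := hlast
    have := ih (fun t => f t.castSucc) (fun t => w t.castSucc) (fun t g hg => by
      have himg : (fun t : Fin n => f t.castSucc) '' {s | s < t} = f '' {s | s < t.castSucc} := by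
        ext x
        constructor
        · rintro ⟨s, hs, rfl⟩
          exact ⟨s.castSucc, hs, rfl⟩
        · rintro ⟨s, hs, rfl⟩
          have hs' : s < t.castSucc := hs
          exact ⟨s.castPred (ne_of_lt (lt_of_lt_of_le hs' (Fin.le_last _))), hs', rfl⟩
      rw [himg] at hg ⊢
      exact hreg _ _ hg) (fun s t => hw _ _)
      (fun t => h t.castSucc + r t * f (Fin.last n)) (by
        rw [← h0, ← hr, Finset.sum_mul, ← Finset.sum_add_distrib]
        exact Finset.sum_congr rfl fun t _ => by ring)
    rw [← this, ← hr, Finset.sum_smul, ← Finset.sum_add_distrib]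
    refine Finset.sum_congr rfl fun t _ => ?_
    rw [add_smul, mul_smul, mul_smul, hw]

variable {σ k : Type*} [CommRing k] {n : ℕ} {c : Fin n → σ} {b : Fin n → ℕ}
  {f : Fin n → MvPolynomial σ k}

/-- The variable `c t`, in which `f t` is monic, does not occur in the earlier members of the
sequence. -/
theorem regular_of_monicIn (hc : Function.Injective c) (hf : ∀ t, MonicIn (c t) (b t) (f t))
    (hs : ∀ t, f t ∈ supported k (c '' {s | s ≤ t})) (t : Fin n) (g : MvPolynomial σ k)
    (hg : f t * g ∈ Ideal.span (f '' {s | s < t})) : g ∈ Ideal.span (f '' {s | s < t}) := by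
  refine ((hf t).mem_of_add_mul_mem (Z := c '' {s | s < t}) ?_ ?_ (h := 0) (by simp)
    (by rwa [zero_add])).2
  · rintro ⟨s, hst, h⟩
    exact absurd (hc h) (ne_of_lt hst)
  · rintro _ ⟨s, hst, rfl⟩
    refine supported_mono (Set.image_mono ?_) (hs s)
    intro r hr
    exact lt_of_le_of_lt (show r ≤ s from hr) (show s < t from hst)

/-- The generators are discarded one by one from the last: modulo the earlier ones `f t` is monic in
`X (c t)`, where `h` has smaller degree, so `f t` cannot contribute. -/
theorem eq_zero_of_reduced (hc : Function.Injective c) (hf : ∀ t, MonicIn (c t) (b t) (f t))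
    (hs : ∀ t, f t ∈ supported k (c '' {s | s ≤ t})) {h : MvPolynomial σ k}
    (hred : ∀ m ∈ h.support, ∀ t, m (c t) < b t) (hmem : h ∈ Ideal.span (Set.range f)) :
    h = 0 := by
  have key : ∀ j ≤ n, h ∈ Ideal.span (f '' {s | (s : ℕ) < n - j}) := by
    intro j
    induction j with
    | zero =>
      intro _
      have : {s : Fin n | (s : ℕ) < n - 0} = Set.univ := by ext s; simp
      rwa [this, Set.image_univ]
    | succ j ih =>
      intro hj
      have h1 := ih (by omega)
      set t : Fin n := ⟨n - (j + 1), by omega⟩ with ht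
      have hset : {s : Fin n | (s : ℕ) < n - j} = insert t {s | s < t} := by
        ext s
        simp only [Set.mem_ofPred_eq, Set.mem_insert_iff, Fin.ext_iff, Fin.lt_def, ht]
        omega
      rw [hset, Set.image_insert_eq, Ideal.mem_span_insert] at h1
      obtain ⟨a, z, hz, rfl⟩ := h1
      refine ((hf t).mem_of_add_mul_mem (Z := c '' {s | s < t}) ?_ ?_ (fun m hm => hred m hm t)
        (g := -a) ?_).1
      · rintro ⟨s, hst, h⟩
        exact absurd (hc h) (ne_of_lt hst)
      · rintro _ ⟨s, hst, rfl⟩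
        refine supported_mono (Set.image_mono ?_) (hs s)
        intro r hr
        exact lt_of_le_of_lt (show r ≤ s from hr) (show s < t from hst)
      · have : a * f t + z + f t * -a = z := by ring
        rwa [this]
  have := key n le_rfl
  simpa using this

end RegularSequence

end KLR

namespace KLR

/-! ### Words with an initial bottom letter -/

section Words

open MvPolynomial Equiv

variable {n : ℕ}

/-- The word `⊥, σ 0, …, σ (n - 1)`. -/
def word (σ : Perm (Fin n)) : List (WithBot (Fin n)) := ⊥ :: List.ofFn fun t => (σ t : WithBot (Fin n))

theorem word_injective : Function.Injective (word (n := n)) := by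
  intro σ τ h
  have := List.ofFn_injective (List.cons_injective h)
  exact Equiv.ext fun t => WithBot.coe_injective (congrFun this t)

theorem word_nodup (σ : Perm (Fin n)) : (word σ).Nodup := by
  rw [word, List.nodup_cons, List.nodup_ofFn]
  refine ⟨?_, WithBot.coe_injective.comp σ.injective⟩
  rw [List.mem_ofFn]
  rintro ⟨t, ht⟩
  exact WithBot.coe_ne_bot ht

theorem mem_word {σ : Perm (Fin n)} {c : WithBot (Fin n)} (hc : c ≠ ⊥) :
    ∃ t, c = (σ t : WithBot (Fin n)) := by
  lift c to Fin n using hc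
  exact ⟨σ.symm c, by simp⟩

theorem exists_word_eq {σ : Perm (Fin n)} {l : List (WithBot (Fin n))}
    (h : (⊥ :: l).Perm (word σ)) : ∃ τ : Perm (Fin n), word τ = ⊥ :: l := by
  have hl : l.Perm (List.ofFn fun t => (σ t : WithBot (Fin n))) := (List.perm_cons _).1 h
  have hlen : l.length = n := by rw [hl.length_eq, List.length_ofFn]
  have hnd : l.Nodup := hl.nodup_iff.2 (List.nodup_cons.1 (word_nodup σ)).2
  have hne : ∀ x ∈ l, x ≠ ⊥ := fun x hx h => by
    have := hl.subset hx
    rw [List.mem_ofFn] at this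
    obtain ⟨t, ht⟩ := this
    exact WithBot.coe_ne_bot (ht.trans h)
  have hget : ∀ t : Fin n, ∃ c : Fin n, (c : WithBot (Fin n)) = l[(t : ℕ)]'(by omega) := fun t =>
    WithBot.ne_bot_iff_exists.1 (hne _ (List.getElem_mem _))
  choose g hg using hget
  have hginj : Function.Injective g := fun s t hst => by
    have : l[(s : ℕ)]'(by omega) = l[(t : ℕ)]'(by omega) := by rw [← hg, ← hg, hst]
    exact Fin.ext ((hnd.getElem_inj_iff).1 this)
  refine ⟨Equiv.ofBijective g (Finite.injective_iff_bijective.1 hginj), ?_⟩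
  rw [word]
  congr 1
  refine List.ext_getElem (by simp [hlen]) fun i h₁ h₂ => ?_
  rw [List.getElem_ofFn]
  exact hg _

theorem exists_append_eq_word (σ : Perm (Fin n)) (t : Fin n) :
    ∃ X R, word σ = (⊥ :: X) ++ (σ t : WithBot (Fin n)) :: R ∧ X.length = t ∧
      ∀ x ∈ X, ∃ s < t, x = (σ s : WithBot (Fin n)) := by
  refine ⟨(List.ofFn fun t => (σ t : WithBot (Fin n))).take t,
    (List.ofFn fun t => (σ t : WithBot (Fin n))).drop (t + 1), ?_, by simp, ?_⟩
  · rw [word, List.cons_append]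
    congr 1
    have := List.drop_eq_getElem_cons (l := List.ofFn fun t => (σ t : WithBot (Fin n))) (i := t)
      (by simp)
    rw [List.getElem_ofFn] at this
    rw [← this, List.take_append_drop]
  · intro x hx
    rw [List.mem_take_iff_getElem] at hx
    obtain ⟨i, hi, rfl⟩ := hx
    simp only [List.length_ofFn, lt_min_iff] at hi
    exact ⟨⟨i, hi.2⟩, hi.1, by rw [List.getElem_ofFn]⟩

theorem exists_move_word (σ : Perm (Fin n)) (t : Fin n) :
    ∃ F ν', Move (word σ) (σ t) F ν' ∧ ∀ x ∈ F, x = ⊥ ∨ ∃ s < t, x = (σ s : WithBot (Fin n)) := by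
  obtain ⟨X, R, hX, -, hmem⟩ := exists_append_eq_word σ t
  have hnd := word_nodup σ
  rw [hX] at hnd
  obtain ⟨F, ν', hF, hsub⟩ := exists_move (⊥ :: X) (σ t : WithBot (Fin n)) R
    (fun h => (List.nodup_append.1 hnd).2.2 _ h _ (by simp) rfl)
    ⟨⊥, by simp, WithBot.bot_lt_coe _⟩
  refine ⟨F, ν', by rwa [hX], fun x hx => ?_⟩
  rcases List.mem_cons.1 (hsub.subset hx) with h | h
  exacts [Or.inl h, Or.inr (hmem x h)]

/-- The letters passed by `σ t` in the move of `word σ` which displaces this letter. -/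
noncomputable def passed (σ : Perm (Fin n)) (t : Fin n) : List (WithBot (Fin n)) :=
  (exists_move_word σ t).choose

/-- The result of the move of `word σ` which displaces the letter `σ t`. -/
noncomputable def moved (σ : Perm (Fin n)) (t : Fin n) : List (WithBot (Fin n)) :=
  (exists_move_word σ t).choose_spec.choose

theorem move_word (σ : Perm (Fin n)) (t : Fin n) : Move (word σ) (σ t) (passed σ t) (moved σ t) :=
  (exists_move_word σ t).choose_spec.choose_spec.1

theorem mem_passed {σ : Perm (Fin n)} {t : Fin n} {x : WithBot (Fin n)} (hx : x ∈ passed σ t) :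
    x = ⊥ ∨ ∃ s < t, x = (σ s : WithBot (Fin n)) :=
  (exists_move_word σ t).choose_spec.choose_spec.2 x hx

theorem Move.exists_eq {σ : Perm (Fin n)} {c : WithBot (Fin n)} {F ν' : List (WithBot (Fin n))}
    (h : Move (word σ) c F ν') : ∃ t, c = σ t ∧ F = passed σ t ∧ ν' = moved σ t := by
  have hc : c ≠ ⊥ := by
    generalize word σ = w at h
    obtain ⟨L, p, B, c, R, hp, hB⟩ := h
    exact ne_bot_of_gt hp
  obtain ⟨t, rfl⟩ := mem_word (σ := σ) hc
  exact ⟨t, rfl, h.unique (word_nodup σ) (move_word σ t)⟩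

/-- The displaced letter exceeds another one and so is not `⊥`. Hence a move whose result starts
with `⊥` leaves that letter in place, and the source is a rearrangement with the same first letter.
-/
theorem Move.word_of_word {ν ν' : List (WithBot (Fin n))} {c : WithBot (Fin n)}
    {F : List (WithBot (Fin n))} (h : Move ν c F ν') {σ : Perm (Fin n)} (hσ : word σ = ν') :
    ∃ τ : Perm (Fin n), word τ = ν := by
  have hperm := h.perm
  obtain ⟨L, p, B, c, R, hp, hB⟩ := h
  rcases L with _ | ⟨x, L⟩
  · simp only [word, List.nil_append, List.cons.injEq] at hσ
    exact absurd hσ.1.symm (ne_bot_of_gt hp)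
  · have hx : x = ⊥ := by
      simp only [word, List.cons_append, List.cons.injEq] at hσ
      exact hσ.1.symm
    subst hx
    rw [← hσ] at hperm
    exact exists_word_eq hperm.symm

section WordVec

variable {S : Type*} [CommRing S]

open Classical in
/-- The basis vector attached to a word, which is zero for a list which is not a word. -/
def wordVec (S : Type*) [CommRing S] (l : List (WithBot (Fin n))) : Perm (Fin n) → S :=
  fun σ => if word σ = l then 1 else 0

theorem wordVec_word (σ : Perm (Fin n)) : wordVec S (word σ) = Pi.single σ 1 := by
  classical
  ext τ
  rw [wordVec, Pi.single_apply]
  simp only [word_injective.eq_iff]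

theorem wordVec_of_not {l : List (WithBot (Fin n))} (h : ¬ ∃ σ, word σ = l) : wordVec S l = 0 := by
  ext τ
  rw [wordVec, if_neg (fun h' => h ⟨τ, h'⟩), Pi.zero_apply]

theorem wordVec_apply_of_ne {l : List (WithBot (Fin n))} {σ : Perm (Fin n)} (h : word σ ≠ l) :
    wordVec S l σ = 0 := if_neg h

variable (q : WithBot (Fin n) → WithBot (Fin n) → S)

/-- A move from a list that is not a word does not lead to a word, and both vectors are zero. Only
finitely many leading words matter therefore. -/
theorem moveRel_eq_inter_range (U : Set (List (WithBot (Fin n)))) :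
    moveRel q (wordVec S) U = moveRel q (wordVec S) (U ∩ Set.range word) := by
  refine le_antisymm (Submodule.span_le.2 ?_) (Submodule.span_mono ?_)
  · rintro _ ⟨μ, hμ, c, F, μ', h, rfl⟩
    by_cases hw : ∃ σ, word σ = μ
    · exact h.mem_moveRel ⟨hμ, hw⟩
    · rw [wordVec_of_not hw, wordVec_of_not fun ⟨σ, hσ⟩ => hw (h.word_of_word hσ), sub_self,
        smul_zero]
      exact Submodule.zero_mem _
  · rintro _ ⟨μ, hμ, h⟩
    exact ⟨μ, hμ.1, h⟩

theorem moveRel_mono {U V : Set (List (WithBot (Fin n)))} (h : U ⊆ V) :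
    moveRel q (wordVec S) U ≤ moveRel q (wordVec S) V :=
  Submodule.span_mono fun _ ⟨μ, hμ, H⟩ => ⟨μ, h hμ, H⟩

variable {q}

/-- Moves increase words, so relations starting above `word σ` never return to it. -/
theorem apply_eq_zero_of_mem_moveRel {σ : Perm (Fin n)} {z : Perm (Fin n) → S}
    (hz : z ∈ moveRel q (wordVec S) {μ | word σ < μ}) : z σ = 0 := by
  induction hz using Submodule.span_induction with
  | mem x hx =>
    obtain ⟨μ, hμ, c, F, μ', h, rfl⟩ := hx
    have hμ' : word σ < μ := hμ
    rw [Pi.smul_apply, Pi.sub_apply, wordVec_apply_of_ne hμ'.ne,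
      wordVec_apply_of_ne (hμ'.trans h.lt).ne, sub_self, smul_zero]
  | zero => rfl
  | add x y _ _ hx hy => rw [Pi.add_apply, hx, hy, add_zero]
  | smul a x _ hx => rw [Pi.smul_apply, hx, smul_zero]

/-- Modulo relations with larger leading words only the moves of `word σ` itself are left, and by
uniqueness there is one for each place `t`. -/
theorem exists_sub_mem_moveRel {σ : Perm (Fin n)} {z : Perm (Fin n) → S}
    (hz : z ∈ moveRel q (wordVec S) {μ | word σ ≤ μ}) :
    ∃ h : Fin n → S, z - ∑ t, h t • fac q (σ t) (passed σ t) •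
      (wordVec S (word σ) - wordVec S (moved σ t)) ∈ moveRel q (wordVec S) {μ | word σ < μ} := by
  induction hz using Submodule.span_induction with
  | mem x hx =>
    obtain ⟨μ, hμ, c, F, μ', h, rfl⟩ := hx
    rcases eq_or_lt_of_le (show word σ ≤ μ from hμ) with rfl | hlt
    · obtain ⟨t, rfl, rfl, rfl⟩ := h.exists_eq
      refine ⟨Pi.single t 1, ?_⟩
      rw [Finset.sum_eq_single t, Pi.single_eq_same, one_smul, sub_self]
      · exact Submodule.zero_mem _
      · intro s _ hs
        rw [Pi.single_eq_of_ne hs, zero_smul]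
      · simp
    · refine ⟨0, ?_⟩
      simpa using h.mem_moveRel (q := q) (e := wordVec S) (U := {μ | word σ < μ}) hlt
  | zero => exact ⟨0, by simp⟩
  | add x y _ _ hx hy =>
    obtain ⟨h, hh⟩ := hx
    obtain ⟨g, hg⟩ := hy
    refine ⟨h + g, ?_⟩
    have := Submodule.add_mem _ hh hg
    simp only [Pi.add_apply, add_smul, Finset.sum_add_distrib]
    rwa [add_sub_add_comm]
  | smul a x _ hx =>
    obtain ⟨h, hh⟩ := hx
    refine ⟨a • h, ?_⟩
    have := Submodule.smul_mem _ a hh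
    simp only [Pi.smul_apply, smul_assoc, ← Finset.smul_sum]
    rwa [← smul_sub]

end WordVec

end Words

/-! ### Normal forms modulo the relations -/

section Core

open MvPolynomial Equiv

variable {n : ℕ} {k : Type*} [CommRing k]

/-- A symmetric family of polynomials `q c d` in the variables `X c` and `X d` (or in `X c` only if
`d` is `⊥`), each of which has leading term a unit times `X c ^ b c d` with respect to `X c`. -/
structure IsMonicSystem (q : WithBot (Fin n) → WithBot (Fin n) → MvPolynomial (Fin n) k)
    (b : Fin n → WithBot (Fin n) → ℕ) : Prop where
  symm : ∀ c d, q c d = q d c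
  monic : ∀ (c : Fin n) (d : WithBot (Fin n)), d ≠ c → MonicIn c (b c d) (q c d)
  mem_supported : ∀ c d : WithBot (Fin n),
    q c d ∈ supported k {x : Fin n | (x : WithBot (Fin n)) = c ∨ (x : WithBot (Fin n)) = d}

variable {q : WithBot (Fin n) → WithBot (Fin n) → MvPolynomial (Fin n) k}
  {b : Fin n → WithBot (Fin n) → ℕ}

/-- The exponent bound for `X (σ t)` at the colouring `σ`. -/
noncomputable def bnd (b : Fin n → WithBot (Fin n) → ℕ) (σ : Perm (Fin n)) (t : Fin n) : ℕ :=
  ((passed σ t).map (b (σ t))).sum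

theorem IsMonicSystem.monicIn_fac (hq : IsMonicSystem q b) (σ : Perm (Fin n)) (t : Fin n) :
    MonicIn (σ t) (bnd b σ t) (fac q (σ t) (passed σ t)) := by
  have h : ∀ x ∈ passed σ t, x ≠ (σ t : WithBot (Fin n)) := by
    intro x hx
    rcases mem_passed hx with rfl | ⟨s, hs, rfl⟩
    · exact WithBot.bot_ne_coe
    · intro h
      exact hs.ne (σ.injective (WithBot.coe_injective h))
  rw [bnd]
  generalize passed σ t = F at h
  induction F with
  | nil => exact MonicIn.one _
  | cons x F ih =>
    rw [fac_cons, List.map_cons, List.sum_cons]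
    exact (hq.monic _ _ (h x (by simp))).mul (ih fun y hy => h y (by simp [hy]))

/-- A moved letter passes only `⊥` and colours to its left. With `IsMonicSystem.monicIn_fac` this
makes the leading coefficients at `σ` a triangular regular sequence. -/
theorem IsMonicSystem.fac_mem_supported (hq : IsMonicSystem q b) (σ : Perm (Fin n)) (t : Fin n) :
    fac q (σ t) (passed σ t) ∈ supported k (σ '' {s | s ≤ t}) := by
  refine Subalgebra.list_prod_mem _ fun y hy => ?_
  obtain ⟨x, hx, rfl⟩ := List.mem_map.1 hy
  refine supported_mono ?_ (hq.mem_supported _ _)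
  rintro z (hz | hz)
  · rw [WithBot.coe_inj] at hz
    exact ⟨t, le_refl t, hz.symm⟩
  · rcases mem_passed hx with rfl | ⟨s, hs, rfl⟩
    · exact absurd hz WithBot.coe_ne_bot
    · exact ⟨s, hs.le, (WithBot.coe_inj.1 hz).symm⟩

/-- The relations of the cocenter, spanned by those attached to the moves. -/
noncomputable def cocenterRel (q : WithBot (Fin n) → WithBot (Fin n) → MvPolynomial (Fin n) k) :
    Submodule (MvPolynomial (Fin n) k) (Perm (Fin n) → MvPolynomial (Fin n) k) :=
  moveRel q (wordVec _) Set.univ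

/-- The component of `z` at `σ` is reduced and lies in the ideal of the leading coefficients, hence
vanishes. The multipliers of the moves of `word σ` thus form a syzygy, and confluence pushes Koszul
syzygies to larger words. -/
theorem IsMonicSystem.mem_moveRel_lt (hq : IsMonicSystem q b) {σ : Perm (Fin n)}
    {z : Perm (Fin n) → MvPolynomial (Fin n) k} (hz : z ∈ moveRel q (wordVec _) {μ | word σ ≤ μ})
    (hred : ∀ m ∈ (z σ).support, ∀ t, m (σ t) < bnd b σ t) :
    z ∈ moveRel q (wordVec _) {μ | word σ < μ} := by
  obtain ⟨h, hh⟩ := exists_sub_mem_moveRel hz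
  set N := moveRel q (wordVec (MvPolynomial (Fin n) k)) {μ | word σ < μ}
  set f : Fin n → MvPolynomial (Fin n) k := fun t => fac q (σ t) (passed σ t) with hf
  have hzσ : z σ = ∑ t, h t * f t := by
    have := apply_eq_zero_of_mem_moveRel hh
    rw [Pi.sub_apply, sub_eq_zero] at this
    rw [this, Finset.sum_apply]
    refine Finset.sum_congr rfl fun t _ => ?_
    rw [Pi.smul_apply, Pi.smul_apply, Pi.sub_apply, wordVec_apply_of_ne (move_word σ t).lt.ne,
      wordVec_word, Pi.single_eq_same, sub_zero, smul_eq_mul, smul_eq_mul, mul_one]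
  have hz0 : ∑ t, h t * f t = 0 := by
    rw [← hzσ]
    refine eq_zero_of_reduced σ.injective (hq.monicIn_fac σ) (hq.fac_mem_supported σ) hred ?_
    rw [hzσ]
    exact Ideal.sum_mem _ fun t _ => Ideal.mul_mem_left _ _ (Ideal.subset_span ⟨t, rfl⟩)
  -- The symmetry required of these classes is exactly the confluence of the moves at `s` and `t`.
  have hk := sum_smul_eq_zero_of_koszul f (fun t => N.mkQ (f t • wordVec _ (moved σ t)))
    (regular_of_monicIn σ.injective (hq.monicIn_fac σ) (hq.fac_mem_supported σ)) (fun s t => by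
      rw [← map_smul, ← map_smul, ← sub_eq_zero, ← map_sub, Submodule.mkQ_apply,
        Submodule.Quotient.mk_eq_zero]
      have := move_confluent (e := wordVec (MvPolynomial (Fin n) k)) hq.symm (word_nodup σ)
        (move_word σ t) (move_word σ s)
      rw [smul_smul, smul_smul, mul_comm (f s), ← smul_sub]
      exact this) h hz0
  simp only [← map_smul, ← map_sum] at hk
  rw [Submodule.mkQ_apply, Submodule.Quotient.mk_eq_zero] at hk
  have hsum : ∑ t, h t • fac q (σ t) (passed σ t) • (wordVec _ (word σ) - wordVec _ (moved σ t))
      = (∑ t, h t * f t) • wordVec (MvPolynomial (Fin n) k) (word σ)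
        - ∑ t, h t • f t • wordVec (MvPolynomial (Fin n) k) (moved σ t) := by
    rw [Finset.sum_smul, ← Finset.sum_sub_distrib]
    refine Finset.sum_congr rfl fun t _ => ?_
    rw [smul_sub, smul_sub, mul_smul]
  rw [hsum, hz0, zero_smul, zero_sub, sub_neg_eq_add] at hh
  exact (Submodule.add_mem_iff_left _ hk).1 hh

theorem wordGT_wellFounded :
    WellFounded fun σ τ : Perm (Fin n) => word τ < word σ :=
  @Finite.wellFounded_of_trans_of_irrefl _ _ _ ⟨fun _ _ _ h₁ h₂ => h₂.trans h₁⟩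
    ⟨fun _ => lt_irrefl _⟩

/-- A reduced element of the module of relations is zero. -/
theorem IsMonicSystem.eq_zero_of_mem_cocenterRel (hq : IsMonicSystem q b)
    {z : Perm (Fin n) → MvPolynomial (Fin n) k} (hz : z ∈ cocenterRel q)
    (hred : ∀ σ, ∀ m ∈ (z σ).support, ∀ t, m (σ t) < bnd b σ t) : z = 0 := by
  have key : ∀ σ : Perm (Fin n), z ∈ moveRel q (wordVec _) {μ | word σ ≤ μ} → z = 0 := by
    intro σ
    induction σ using wordGT_wellFounded.induction with
    | h σ ih =>
      intro hσ
      have h := hq.mem_moveRel_lt hσ (hred σ)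
      classical
      rcases (Finset.univ.filter fun τ => word σ < word τ).eq_empty_or_nonempty with he | hne
      · rw [moveRel_eq_inter_range] at h
        have : {μ | word σ < μ} ∩ Set.range word = ∅ := by
          rw [Set.eq_empty_iff_forall_notMem]
          rintro _ ⟨hμ, τ, rfl⟩
          have : τ ∈ Finset.univ.filter fun τ => word σ < word τ := by
            rw [Finset.mem_filter]
            exact ⟨Finset.mem_univ _, hμ⟩
          rw [he] at this
          simp at this
        rw [this] at h
        simpa [moveRel] using h
      -- `word τ` is the successor of `word σ`, so the relations above `σ` are those from `τ` on.
      · obtain ⟨τ, hτ, hmin⟩ := Finset.exists_min_image _ word hne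
        rw [Finset.mem_filter] at hτ
        refine ih τ hτ.2 ?_
        rw [moveRel_eq_inter_range] at h
        refine moveRel_mono q ?_ h
        rintro _ ⟨hμ, ρ, rfl⟩
        exact hmin ρ (Finset.mem_filter.2 ⟨Finset.mem_univ _, hμ⟩)
  classical
  obtain ⟨τ, -, hmin⟩ := Finset.exists_min_image Finset.univ (word (n := n)) Finset.univ_nonempty
  refine key τ ?_
  rw [cocenterRel, moveRel_eq_inter_range] at hz
  refine moveRel_mono q ?_ hz
  rintro _ ⟨-, ρ, rfl⟩
  exact hmin ρ (Finset.mem_univ _)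

/-- The reduced monomials span the free module modulo the relations. -/
theorem IsMonicSystem.span_reduced_sup (hq : IsMonicSystem q b) (σ : Perm (Fin n))
    (p : MvPolynomial (Fin n) k) :
    (Pi.single σ p : Perm (Fin n) → MvPolynomial (Fin n) k) ∈ Submodule.span k {z : Perm (Fin n) → MvPolynomial (Fin n) k |
        ∃ σ m, (∀ t, m (σ t) < bnd b σ t) ∧ z = Pi.single σ (monomial m 1)}
      ⊔ (cocenterRel q).restrictScalars k := by
  set K := Submodule.span k {z : Perm (Fin n) → MvPolynomial (Fin n) k |
        ∃ σ m, (∀ t, m (σ t) < bnd b σ t) ∧ z = Pi.single σ (monomial m 1)}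
      ⊔ (cocenterRel q).restrictScalars k with hK
  have hpoly : ∀ (σ : Perm (Fin n)) (p : MvPolynomial (Fin n) k),
      (∀ m ∈ p.support, (Pi.single σ (monomial m 1) : Perm (Fin n) → MvPolynomial (Fin n) k) ∈ K) →
        (Pi.single σ p : Perm (Fin n) → MvPolynomial (Fin n) k) ∈ K := by
    intro σ p hp
    have : (Pi.single σ p : Perm (Fin n) → MvPolynomial (Fin n) k)
        = ∑ m ∈ p.support, coeff m p • Pi.single σ (monomial m (1 : k)) := by
      conv_lhs => rw [p.as_sum]
      rw [← LinearMap.single_apply (R := k), map_sum]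
      refine Finset.sum_congr rfl fun m _ => ?_
      rw [LinearMap.single_apply, ← Pi.single_smul, smul_monomial, smul_eq_mul, mul_one]
    rw [this]
    exact Submodule.sum_mem _ fun m hm => Submodule.smul_mem _ _ (hp m hm)
  induction σ using wordGT_wellFounded.induction generalizing p with
  | h σ ih =>
    refine hpoly σ p fun m hm => ?_
    clear hm p
    -- Exponents are compared from the last place on: replacing the leading power at place `t` by
    -- the remainder of `f` lowers the exponent at `t` and changes nothing at later places. Larger
    -- words are covered by the outer induction.
    have hwf : WellFounded fun x y : Fin n →₀ ℕ =>
        toColex (fun t => x (σ t)) < toColex (fun t => y (σ t)) :=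
      InvImage.wf (fun x : Fin n →₀ ℕ => toColex (fun t => x (σ t))) wellFounded_lt
    induction m using hwf.induction with
    | h m ihm =>
      by_cases hm : ∀ t, m (σ t) < bnd b σ t
      · exact Submodule.mem_sup_left (Submodule.subset_span ⟨σ, m, hm, rfl⟩)
      · push Not at hm
        obtain ⟨t, ht⟩ := hm
        set f := fac q (σ t) (passed σ t) with hf
        set m₀ : Fin n →₀ ℕ := m - Finsupp.single (σ t) (bnd b σ t) with hm₀
        set g : MvPolynomial (Fin n) k := monomial m₀ 1 with hg
        have hgX : g * X (σ t) ^ bnd b σ t = monomial m 1 := by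
          rw [hg, X_pow_eq_monomial, monomial_mul, one_mul, hm₀, tsub_add_cancel_of_le]
          rwa [Finsupp.single_le_iff]
        -- the multiple of `f`
        have h₁ : (Pi.single σ (g * f) : Perm (Fin n) → MvPolynomial (Fin n) k) ∈ K := by
          have hrel : (g * f) • (wordVec (MvPolynomial (Fin n) k) (word σ)
              - wordVec _ (moved σ t)) ∈ K := by
            refine Submodule.mem_sup_right ?_
            rw [mul_smul]
            exact Submodule.smul_mem (cocenterRel q) _
              ((move_word σ t).mem_moveRel (Set.mem_univ _))
          have hmv : (g * f) • wordVec (MvPolynomial (Fin n) k) (moved σ t) ∈ K := by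
            by_cases hw : ∃ τ, word τ = moved σ t
            · obtain ⟨τ, hτ⟩ := hw
              rw [← hτ, wordVec_word, ← Pi.single_smul, smul_eq_mul, mul_one]
              refine ih τ ?_ _
              rw [hτ]
              exact (move_word σ t).lt
            · rw [wordVec_of_not hw, smul_zero]
              exact Submodule.zero_mem _
          have := Submodule.add_mem _ hrel hmv
          rwa [smul_sub, sub_add_cancel, wordVec_word, ← Pi.single_smul, smul_eq_mul,
            mul_one] at this
        obtain ⟨u, r, hr, hfr⟩ := hq.monicIn_fac σ t
        have hrs : r ∈ supported k (σ '' {s | s ≤ t}) := by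
          have : r = fac q (σ t) (passed σ t) - C (u : k) * X (σ t) ^ bnd b σ t := by
            rw [hfr]; ring
          rw [this]
          refine Subalgebra.sub_mem _ (hq.fac_mem_supported σ t) (Subalgebra.mul_mem _
            (Subalgebra.algebraMap_mem _ _) (Subalgebra.pow_mem _ ?_ _))
          exact Algebra.subset_adjoin ⟨_, ⟨t, le_refl t, rfl⟩, rfl⟩
        have h₂ : (Pi.single σ (g * r) : Perm (Fin n) → MvPolynomial (Fin n) k) ∈ K := by
          refine hpoly σ _ fun m' hm' => ihm m' ?_
          classical
          obtain ⟨m₁, h₁, m₂, h₂, rfl⟩ := Finset.mem_add.1 (support_mul g r hm')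
          rw [Finset.mem_singleton.1 (support_monomial_subset h₁)]
          have h₃ := hr m₂ h₂
          refine ⟨t, fun s hs => ?_, ?_⟩
          · have h₄ : m₂ (σ s) = 0 := by
              by_contra hne
              have := MvPolynomial.mem_supported.1 hrs ((mem_vars_iff_mem_support _).2 ⟨m₂, h₂, Finsupp.mem_support_iff.2 hne⟩)
              obtain ⟨s', hs', he⟩ := this
              rw [σ.injective he] at hs'
              exact absurd hs' (not_le_of_gt hs)
            have : σ t ≠ σ s := fun h => hs.ne (σ.injective h)
            simp [hm₀, h₄, this]
          · simp [hm₀]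
            omega
        have h₃ : (Pi.single σ (monomial m 1) : Perm (Fin n) → MvPolynomial (Fin n) k)
            = ((u⁻¹ : kˣ) : k) • (Pi.single σ (g * f) - Pi.single σ (g * r)
              : Perm (Fin n) → MvPolynomial (Fin n) k) := by
          rw [← Pi.single_sub, ← Pi.single_smul, ← mul_sub, hf, hfr, add_sub_cancel_right, ← hgX,
            mul_left_comm, ← smul_eq_C_mul, smul_smul, Units.inv_mul, one_smul]
        rw [h₃]
        exact Submodule.smul_mem _ _ (Submodule.sub_mem _ h₁ h₂)

end Core

end KLR

namespace KLR

/-! ### Sequences as permutations of the colours -/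

section Colourings

open Equiv

variable {I : Type*} {n : ℕ} {β : I →₀ ℕ}

/-- No simple root occurs twice in `β`. -/
class IsMultiplicityFree (β : I →₀ ℕ) : Prop where
  le_one : ∀ i, β i ≤ 1

theorem Weight.sum_apply (ν : Weight n β) (i : I) :
    ∑ t, (Finsupp.single (ν t) 1 : I →₀ ℕ) i = β i := by
  rw [← Finsupp.finsetSum_apply, ν.2]

theorem Weight.injective [IsMultiplicityFree β] (ν : Weight n β) : Function.Injective ν := by
  intro s t hst
  by_contra hne
  have h := ν.sum_apply (ν t)
  have h₁ : ∑ r ∈ {s, t}, (Finsupp.single (ν r) 1 : I →₀ ℕ) (ν t) ≤ β (ν t) := by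
    rw [← h]
    exact Finset.sum_le_sum_of_subset (Finset.subset_univ _)
  rw [Finset.sum_pair hne, hst, Finsupp.single_eq_same] at h₁
  have := IsMultiplicityFree.le_one (β := β) (ν t)
  omega

theorem Weight.exists_apply_eq (γ ν : Weight n β) (t : Fin n) : ∃ c, γ c = ν t := by
  by_contra! h
  have h₁ := ν.mem_support t
  rw [Finsupp.mem_support_iff, ← γ.sum_apply] at h₁
  refine h₁ (Finset.sum_eq_zero fun c _ => ?_)
  classical
  rw [Finsupp.single_apply, if_neg (h c)]

theorem isMultiplicityFree_of_exists
    (hβ : ∃ i : Fin n → I, Function.Injective i ∧ β = ∑ j, Finsupp.single (i j) 1) :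
    IsMultiplicityFree β := by
  classical
  obtain ⟨i, hi, rfl⟩ := hβ
  refine ⟨fun x => ?_⟩
  rw [Finsupp.finsetSum_apply]
  simp only [Finsupp.single_apply]
  rw [Finset.sum_boole, Nat.cast_id, Finset.card_le_one]
  intro a ha b hb
  rw [Finset.mem_filter] at ha hb
  exact hi (ha.2.trans hb.2.symm)

theorem simpleRefl_mul_self (l : Fin (n - 1)) : simpleRefl l * simpleRefl l = 1 :=
  Equiv.swap_mul_self _ _

variable [IsMultiplicityFree β] (γ : Weight n β)

/-- The permutation `σ` with `ν t = γ (σ t)`. -/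
noncomputable def col (ν : Weight n β) : Perm (Fin n) :=
  Equiv.ofBijective (fun t => (γ.exists_apply_eq ν t).choose)
    (Finite.injective_iff_bijective.1 fun s t h => ν.injective (by
      rw [← (γ.exists_apply_eq ν s).choose_spec, ← (γ.exists_apply_eq ν t).choose_spec]
      exact congrArg _ h))

theorem apply_col (ν : Weight n β) (t : Fin n) : γ (col γ ν t) = ν t :=
  (γ.exists_apply_eq ν t).choose_spec

theorem col_eq_iff {ν : Weight n β} {t c : Fin n} : col γ ν t = c ↔ ν t = γ c := by
  rw [← apply_col γ ν t, γ.injective.eq_iff]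

theorem col_injective : Function.Injective (col γ) := fun μ ν h =>
  Subtype.ext (funext fun t => by rw [← apply_col γ μ, h, apply_col γ ν])

theorem col_act (w : Perm (Fin n)) (ν : Weight n β) : col γ (Weight.act w ν) = col γ ν * w⁻¹ := by
  ext1 t
  rw [col_eq_iff, Perm.mul_apply, apply_col]
  rfl

theorem col_surjective : Function.Surjective (col γ) := fun σ => ⟨Weight.act σ⁻¹ γ, by
  rw [col_act, inv_inv]
  have : col γ γ = 1 := by
    ext1 t
    rw [col_eq_iff]
    rfl
  rw [this, one_mul]⟩

/-- The bijection between `I^β` and the symmetric group. -/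
noncomputable def colEquiv : Weight n β ≃ Perm (Fin n) :=
  Equiv.ofBijective (col γ) ⟨col_injective γ, col_surjective γ⟩

theorem col_act_simpleRefl (l : Fin (n - 1)) (ν : Weight n β) :
    col γ (Weight.act (simpleRefl l) ν) = col γ ν * simpleRefl l := by
  rw [col_act, simpleRefl, Equiv.swap_inv]

end Colourings

/-! ### The defining relations without repeated colours -/

section Relations

open Equiv

variable {I k : Type*} [CommRing k] {Q : I → I → MvPolynomial (Fin 2) k} {n : ℕ} {β : I →₀ ℕ}

theorem lo_ne_hi (l : Fin (n - 1)) : lo l ≠ hi l := by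
  simp [lo, hi, Fin.ext_iff]

theorem act_simpleRefl_hi (l : Fin (n - 1)) (ν : Weight n β) :
    Weight.act (simpleRefl l) ν (hi l) = ν (lo l) := by
  change ν ((simpleRefl l)⁻¹ (hi l)) = _
  rw [simpleRefl, swap_inv, swap_apply_right]

theorem act_simpleRefl_of_ne (l : Fin (n - 1)) (ν : Weight n β) {t : Fin n} (h₁ : t ≠ lo l)
    (h₂ : t ≠ hi l) : Weight.act (simpleRefl l) ν t = ν t := by
  change ν ((simpleRefl l)⁻¹ t) = _
  rw [simpleRefl, swap_inv, swap_apply_of_ne_of_ne h₁ h₂]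

theorem act_act_simpleRefl (l : Fin (n - 1)) (ν : Weight n β) :
    Weight.act (simpleRefl l) (Weight.act (simpleRefl l) ν) = ν := by
  refine Subtype.ext (funext fun t => ?_)
  change ν ((simpleRefl l)⁻¹ ((simpleRefl l)⁻¹ t)) = ν t
  rw [← Perm.mul_apply, ← mul_inv_rev, simpleRefl_mul_self, inv_one, Perm.one_apply]

theorem map_monomialAt {R T F : Type*} [Monoid R] [Monoid T] [FunLike F R T] [MonoidHomClass F R T]
    (φ : F) (x : Fin n → R) (a : Fin n → ℕ) :
    φ (monomialAt x a) = monomialAt (fun t => φ (x t)) a := by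
  rw [monomialAt, monomialAt, map_list_prod, List.map_ofFn]
  congr 2
  ext t
  simp

theorem map_polyAt {R T : Type*} [Ring R] [Ring T] [Algebra k R] [Algebra k T] (φ : R →ₐ[k] T)
    (x : Fin n → R) (f : MvPolynomial (Fin n) k) :
    φ (polyAt x f) = polyAt (fun t => φ (x t)) f := by
  simp only [polyAt, map_sum, map_smul, map_monomialAt]

namespace Alg

theorem adjoin_eq_top :
    Algebra.adjoin k (Set.range (e Q) ∪ Set.range (x Q) ∪ Set.range (τ Q (n := n) (β := β))) = ⊤ := by
  have h := congrArg (Subalgebra.map (RingQuot.mkAlgHom k (Rel Q n β)))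
    (FreeAlgebra.adjoin_range_ι k (Gen n β))
  rw [AlgHom.map_adjoin, Algebra.map_top,
    (AlgHom.range_eq_top _).2 (RingQuot.mkAlgHom_surjective k (Rel Q n β))] at h
  rw [eq_top_iff, ← h]
  refine Algebra.adjoin_mono ?_
  rintro _ ⟨_, ⟨g, rfl⟩, rfl⟩
  cases g with
  | e ν => exact Or.inl (Or.inl ⟨ν, rfl⟩)
  | x t => exact Or.inl (Or.inr ⟨t, rfl⟩)
  | τ l => exact Or.inr ⟨l, rfl⟩

/-- An induction principle for the algebra `R_β`. -/
theorem induction_on {p : Alg Q n β → Prop} (r : Alg Q n β) (he : ∀ ν, p (e Q ν))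
    (hx : ∀ t, p (x Q t)) (hτ : ∀ l, p (τ Q l)) (hc : ∀ c : k, p (algebraMap k _ c))
    (hadd : ∀ r s, p r → p s → p (r + s)) (hmul : ∀ r s, p r → p s → p (r * s)) : p r := by
  have hr : r ∈ Algebra.adjoin k
      (Set.range (e Q) ∪ Set.range (x Q) ∪ Set.range (τ Q (n := n) (β := β))) := by
    rw [adjoin_eq_top]
    exact Algebra.mem_top
  induction hr using Algebra.adjoin_induction with
  | mem y hy =>
    rcases hy with (⟨ν, rfl⟩ | ⟨t, rfl⟩) | ⟨l, rfl⟩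
    exacts [he ν, hx t, hτ l]
  | algebraMap c => exact hc c
  | add r s _ _ hr hs => exact hadd r s hr hs
  | mul r s _ _ hr hs => exact hmul r s hr hs

theorem e_mul_self (ν : Weight n β) : e Q ν * e Q ν = e Q ν := by
  have := RingQuot.mkAlgHom_rel k (Rel.e_idem (Q := Q) ν)
  rwa [map_mul] at this

theorem e_mul_of_ne {μ ν : Weight n β} (h : μ ≠ ν) : e Q μ * e Q ν = 0 := by
  have := RingQuot.mkAlgHom_rel k (Rel.e_orth (Q := Q) μ ν h)
  rwa [map_mul, map_zero] at this

theorem sum_e : ∑ ν : Weight n β, e Q ν = 1 := by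
  have := RingQuot.mkAlgHom_rel k (Rel.e_sum (Q := Q) (n := n) (β := β))
  rwa [map_sum, map_one] at this

theorem x_mul_x (s t : Fin n) : x Q s * x Q t = x Q (β := β) t * x Q s := by
  have := RingQuot.mkAlgHom_rel k (Rel.x_comm (Q := Q) (β := β) s t)
  rwa [map_mul, map_mul] at this

theorem x_mul_e (t : Fin n) (ν : Weight n β) : x Q t * e Q ν = e Q ν * x Q t := by
  have := RingQuot.mkAlgHom_rel k (Rel.x_e (Q := Q) t ν)
  rwa [map_mul, map_mul] at this

theorem τ_mul_e (l : Fin (n - 1)) (ν : Weight n β) :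
    τ Q l * e Q ν = e Q (Weight.act (simpleRefl l) ν) * τ Q l := by
  have := RingQuot.mkAlgHom_rel k (Rel.τ_e (Q := Q) l ν)
  rwa [map_mul, map_mul] at this

theorem e_mul_τ (l : Fin (n - 1)) (ν : Weight n β) :
    e Q ν * τ Q l = τ Q l * e Q (Weight.act (simpleRefl l) ν) := by
  rw [τ_mul_e, act_act_simpleRefl]

theorem τ_mul_τ (r s : Fin (n - 1)) (h : (r : ℕ) + 1 < s ∨ (s : ℕ) + 1 < r) :
    τ Q r * τ Q s = τ Q (β := β) s * τ Q r := by
  have := RingQuot.mkAlgHom_rel k (Rel.τ_comm (Q := Q) (β := β) r s h)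
  rwa [map_mul, map_mul] at this

theorem τ_sq_mul_e (l : Fin (n - 1)) (ν : Weight n β) : τ Q l * τ Q l * e Q ν =
    polyAt (x Q) (subst₂ (Q (ν (lo l)) (ν (hi l))) (lo l) (hi l)) * e Q ν := by
  have := RingQuot.mkAlgHom_rel k (Rel.τ_sq (Q := Q) l ν)
  rwa [map_mul, map_mul, map_mul, map_polyAt] at this

theorem mul_eq_mul_of_mul_e {r s : Alg Q n β} (h : ∀ ν, r * e Q ν = s * e Q ν) : r = s := by
  rw [← mul_one r, ← mul_one s, ← sum_e, Finset.mul_sum, Finset.mul_sum]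
  exact Finset.sum_congr rfl fun ν _ => h ν

section

variable [IsMultiplicityFree β]

/-- Without repeated colours the exceptional case of the relation never occurs, so there is no error
term; the same applies to `braid`. -/
theorem τ_mul_x (l : Fin (n - 1)) (t : Fin n) :
    τ Q l * x Q t = x Q (β := β) (simpleRefl l t) * τ Q l := by
  refine mul_eq_mul_of_mul_e fun ν => ?_
  have := RingQuot.mkAlgHom_rel k (Rel.τ_x_other (Q := Q) l t ν
    fun h => lo_ne_hi l (ν.injective h.2))
  rw [map_mul, map_sub, map_mul, map_mul, map_zero, sub_mul, sub_eq_zero] at this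
  exact this

theorem braid (r s : Fin (n - 1)) (hrs : (s : ℕ) = r + 1) :
    τ Q s * τ Q r * τ Q s = τ Q (β := β) r * τ Q s * τ Q r := by
  refine mul_eq_mul_of_mul_e fun ν => ?_
  have hne : lo r ≠ hi s := by
    rw [Ne, Fin.ext_iff]
    simp only [lo, hi]
    omega
  have := RingQuot.mkAlgHom_rel k (Rel.braid_ne (Q := Q) r s hrs ν
    fun h => hne (ν.injective h))
  rw [map_mul, map_sub, map_mul, map_mul, map_mul, map_mul, map_zero, sub_mul, sub_eq_zero] at this
  exact this

end

end Alg

end Relations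

/-! ### Central polynomials in the colours -/

section CentralAction

open Equiv

variable {I k : Type*} [CommRing k] {Q : I → I → MvPolynomial (Fin 2) k} {n : ℕ} {β : I →₀ ℕ}
  (γ : Weight n β)

namespace Alg

variable (Q) in
/-- The polynomial `Q_{ij}(X_c, X_d)` for the colours `i = γ c` and `j = γ d`. -/
noncomputable def qCol (c d : Fin n) : MvPolynomial (Fin n) k := subst₂ (Q (γ c) (γ d)) c d

variable [IsMultiplicityFree β]

variable (Q) in
/-- The element `∑_ν x_t e(ν)`, where `t` is the position of the colour `c` in `ν`. -/
noncomputable def xCol (c : Fin n) : Alg Q n β := ∑ ν : Weight n β, x Q ((col γ ν).symm c) * e Q ν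

theorem xCol_mul_e (c : Fin n) (ν : Weight n β) :
    xCol Q γ c * e Q ν = x Q ((col γ ν).symm c) * e Q ν := by
  rw [xCol, Finset.sum_mul, Finset.sum_eq_single ν, mul_assoc, e_mul_self]
  · intro μ _ h
    rw [mul_assoc, e_mul_of_ne h, mul_zero]
  · simp

theorem e_mul_xCol (c : Fin n) (ν : Weight n β) :
    e Q ν * xCol Q γ c = x Q ((col γ ν).symm c) * e Q ν := by
  rw [xCol, Finset.mul_sum, Finset.sum_eq_single ν, ← mul_assoc, ← x_mul_e, mul_assoc, e_mul_self]
  · intro μ _ h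
    rw [← mul_assoc, ← x_mul_e, mul_assoc, e_mul_of_ne h.symm, mul_zero]
  · simp

/-- When `τ_l` moves the colour `c` to another place, the `x` attached to `c` moves along with it.
-/
theorem xCol_comm (c : Fin n) (r : Alg Q n β) : xCol Q γ c * r = r * xCol Q γ c := by
  induction r using induction_on with
  | he ν => rw [xCol_mul_e, e_mul_xCol]
  | hx t =>
    refine mul_eq_mul_of_mul_e fun ν => ?_
    rw [mul_assoc, x_mul_e, ← mul_assoc, xCol_mul_e, mul_assoc, ← x_mul_e, mul_assoc, xCol_mul_e,
      ← mul_assoc, x_mul_x, mul_assoc]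
  | hτ l =>
    refine mul_eq_mul_of_mul_e fun ν => ?_
    rw [mul_assoc, τ_mul_e, ← mul_assoc, xCol_mul_e, mul_assoc, ← τ_mul_e, mul_assoc, xCol_mul_e,
      ← mul_assoc, ← mul_assoc, τ_mul_x, col_act_simpleRefl]
    congr 3
  | hc a => exact (Algebra.commutes a _).symm
  | hadd r s hr hs => rw [mul_add, add_mul, hr, hs]
  | hmul r s hr hs => rw [← mul_assoc, hr, mul_assoc, hs, mul_assoc]

variable (Q) in
/-- The homomorphism from the polynomials in the colours to the centre of `R_β`. -/
noncomputable def ρ : MvPolynomial (Fin n) k →ₐ[k] Alg Q n β :=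
  (Subalgebra.center k (Alg Q n β)).val.comp (MvPolynomial.aeval fun c =>
    (⟨xCol Q γ c, Subalgebra.mem_center_iff.2 fun r => (xCol_comm γ c r).symm⟩ :
      Subalgebra.center k (Alg Q n β)))

theorem ρ_comm (f : MvPolynomial (Fin n) k) (r : Alg Q n β) : ρ Q γ f * r = r * ρ Q γ f :=
  (Subalgebra.mem_center_iff.1 (Subtype.property _) r).symm

theorem ρ_X (c : Fin n) : ρ Q γ (MvPolynomial.X c) = xCol Q γ c := by
  simp [ρ]

theorem x_mul_e_eq (t : Fin n) (ν : Weight n β) :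
    x Q t * e Q ν = ρ Q γ (MvPolynomial.X (col γ ν t)) * e Q ν := by
  rw [ρ_X, xCol_mul_e, Equiv.symm_apply_apply]

theorem mul_mul_e {r s : Alg Q n β} {f g : MvPolynomial (Fin n) k} {ν : Weight n β}
    (hr : r * e Q ν = ρ Q γ f * e Q ν) (hs : s * e Q ν = ρ Q γ g * e Q ν) :
    (r * s) * e Q ν = ρ Q γ (f * g) * e Q ν := by
  rw [mul_assoc, hs, ρ_comm, ← mul_assoc, hr, mul_assoc, ← ρ_comm, ← mul_assoc, map_mul]

theorem pow_mul_e {r : Alg Q n β} {f : MvPolynomial (Fin n) k} {ν : Weight n β}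
    (hr : r * e Q ν = ρ Q γ f * e Q ν) (j : ℕ) : r ^ j * e Q ν = ρ Q γ (f ^ j) * e Q ν := by
  induction j with
  | zero => simp
  | succ j ih =>
    rw [pow_succ, pow_succ]
    exact mul_mul_e γ ih hr

theorem monomialAt_mul_e (a : Fin n → ℕ) (ν : Weight n β) :
    monomialAt (x Q) a * e Q ν =
      ρ Q γ (∏ t, MvPolynomial.X (col γ ν t) ^ a t) * e Q ν := by
  have key : ∀ L : List (Fin n), (L.map fun t => x Q t ^ a t).prod * e Q ν
      = ρ Q γ (L.map fun t => MvPolynomial.X (col γ ν t) ^ a t).prod * e Q ν := by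
    intro L
    induction L with
    | nil => simp
    | cons t L ih =>
      rw [List.map_cons, List.map_cons, List.prod_cons, List.prod_cons]
      exact mul_mul_e γ (pow_mul_e γ (x_mul_e_eq γ t ν) _) ih
  have := key (List.finRange n)
  rwa [← List.ofFn_eq_map, ← List.ofFn_eq_map, List.prod_ofFn] at this

theorem polyAt_mul_e (f : MvPolynomial (Fin n) k) (ν : Weight n β) :
    polyAt (x Q) f * e Q ν = ρ Q γ (MvPolynomial.rename (col γ ν) f) * e Q ν := by
  conv_rhs => rw [f.as_sum]
  rw [polyAt, map_sum, map_sum, Finset.sum_mul, Finset.sum_mul]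
  refine Finset.sum_congr rfl fun m _ => ?_
  rw [smul_mul_assoc, monomialAt_mul_e γ, MvPolynomial.monomial_eq, map_mul, map_mul,
    MvPolynomial.rename_C, ← MvPolynomial.algebraMap_eq, AlgHom.commutes, ← Algebra.smul_def,
    smul_mul_assoc, Finsupp.prod_fintype _ _ (fun _ => pow_zero _),
    map_prod (MvPolynomial.rename (R := k) (col γ ν))]
  simp only [map_pow, MvPolynomial.rename_X]

theorem aeval_mul_e (p : Polynomial k) (t : Fin n) (ν : Weight n β) :
    Polynomial.aeval (x Q t) p * e Q ν =
      ρ Q γ (Polynomial.aeval (MvPolynomial.X (col γ ν t)) p) * e Q ν := by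
  rw [Polynomial.aeval_eq_sum_range, Polynomial.aeval_eq_sum_range, map_sum, Finset.sum_mul,
    Finset.sum_mul]
  refine Finset.sum_congr rfl fun j _ => ?_
  rw [smul_mul_assoc, pow_mul_e γ (x_mul_e_eq γ t ν), map_smul, smul_mul_assoc]

theorem rename_subst₂ (ν : Weight n β) (s t : Fin n) :
    MvPolynomial.rename (col γ ν) (subst₂ (Q (ν s) (ν t)) s t)
      = qCol Q γ (col γ ν s) (col γ ν t) := by
  rw [qCol, apply_col, apply_col, subst₂, subst₂, ← AlgHom.comp_apply]
  congr 1
  ext j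
  fin_cases j <;> simp

theorem τ_mul_τ_mul_e (l : Fin (n - 1)) (ν : Weight n β) :
    τ Q l * (τ Q l * e Q ν) = ρ Q γ (qCol Q γ (col γ ν (lo l)) (col γ ν (hi l))) * e Q ν := by
  rw [← mul_assoc, τ_sq_mul_e, polyAt_mul_e γ, rename_subst₂]

end Alg

end CentralAction

end KLR

namespace KLR

/-! ### Diagonal parts of the algebra -/

section Diagonal

open Equiv

variable {I k : Type*} [CommRing k] {Q : I → I → MvPolynomial (Fin 2) k} {n : ℕ} {β : I →₀ ℕ}

namespace Alg

variable (Q n β) in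
/-- The subalgebra generated by the idempotents, the `x_t` and the `τ_l` with `l < j`. -/
def sub (j : ℕ) : Subalgebra k (Alg Q n β) :=
  Algebra.adjoin k (Set.range (e Q) ∪ Set.range (x Q) ∪ τ Q (n := n) (β := β) '' {l | (l : ℕ) < j})

variable (Q n β) in
/-- The generator `τ_j`, with the value zero if `j` is out of range. -/
noncomputable def tau (j : ℕ) : Alg Q n β := if h : j < n - 1 then τ Q ⟨j, h⟩ else 0

theorem e_mem_sub (j : ℕ) (ν : Weight n β) : e Q ν ∈ sub Q n β j :=
  Algebra.subset_adjoin (Or.inl (Or.inl ⟨ν, rfl⟩))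

theorem x_mem_sub (j : ℕ) (t : Fin n) : x Q t ∈ sub Q n β j :=
  Algebra.subset_adjoin (Or.inl (Or.inr ⟨t, rfl⟩))

theorem tau_mem_sub {i j : ℕ} (h : i < j) : tau Q n β i ∈ sub Q n β j := by
  rw [tau]
  split_ifs with hi
  · exact Algebra.subset_adjoin (Or.inr ⟨_, h, rfl⟩)
  · exact Subalgebra.zero_mem _

theorem sub_mono {i j : ℕ} (h : i ≤ j) : sub Q n β i ≤ sub Q n β j := by
  refine Algebra.adjoin_mono (Set.union_subset_union_right _ (Set.image_mono ?_))
  intro l hl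
  exact lt_of_lt_of_le (show (l : ℕ) < i from hl) h

theorem sub_top : sub Q n β n = ⊤ := by
  rw [eq_top_iff, ← adjoin_eq_top]
  refine Algebra.adjoin_mono (Set.union_subset_union_right _ ?_)
  rintro _ ⟨l, rfl⟩
  exact ⟨l, show (l : ℕ) < n by omega, rfl⟩

theorem τ_mem_sub {j : ℕ} {l : Fin (n - 1)} (hl : (l : ℕ) < j) : τ Q l ∈ sub Q n β j :=
  Algebra.subset_adjoin (Or.inr ⟨l, hl, rfl⟩)

theorem sub_induction {j : ℕ} {p : (b : Alg Q n β) → b ∈ sub Q n β j → Prop}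
    (he : ∀ ν, p (e Q ν) (e_mem_sub j ν)) (hx : ∀ t, p (x Q t) (x_mem_sub j t))
    (hτ : ∀ (l : Fin (n - 1)) (hl : (l : ℕ) < j), p (τ Q l) (τ_mem_sub hl))
    (hc : ∀ c : k, p (algebraMap k _ c) (Subalgebra.algebraMap_mem _ c))
    (hadd : ∀ r s hr hs, p r hr → p s hs → p (r + s) (Subalgebra.add_mem _ hr hs))
    (hmul : ∀ r s hr hs, p r hr → p s hs → p (r * s) (Subalgebra.mul_mem _ hr hs))
    {b : Alg Q n β} (hb : b ∈ sub Q n β j) : p b hb := by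
  refine Algebra.adjoin_induction (p := p) ?_ hc hadd hmul hb
  rintro y ((⟨ν, rfl⟩ | ⟨t, rfl⟩) | ⟨l, hl, rfl⟩)
  exacts [he ν, hx t, hτ l hl]

theorem sum_e_mul_mul (r s : Alg Q n β) : ∑ μ : Weight n β, r * e Q μ * (e Q μ * s) = r * s := by
  have : ∀ μ : Weight n β, r * e Q μ * (e Q μ * s) = r * e Q μ * s := fun μ => by
    rw [mul_assoc, ← mul_assoc (e Q μ), e_mul_self, mul_assoc]
  simp only [this]
  rw [← Finset.sum_mul, ← Finset.mul_sum, sum_e, mul_one]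

/-- The elements of `sub j` do not move the positions beyond `j`. -/
theorem e_mul_mul_e_eq_zero {j : ℕ} {b : Alg Q n β} (hb : b ∈ sub Q n β j) (μ ν : Weight n β)
    (p : Fin n) (hp : j < p) (h : μ p ≠ ν p) : e Q μ * b * e Q ν = 0 := by
  have hμν : μ ≠ ν := fun h' => h (by rw [h'])
  induction hb using sub_induction generalizing μ ν with
  | he κ =>
    by_cases hκ : μ = κ
    · rw [mul_assoc, e_mul_of_ne (hκ ▸ hμν), mul_zero]
    · rw [e_mul_of_ne hκ, zero_mul]
  | hx t => rw [← x_mul_e, mul_assoc, e_mul_of_ne hμν, mul_zero]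
  | hτ l hl =>
    rw [mul_assoc, τ_mul_e, ← mul_assoc, e_mul_of_ne, zero_mul]
    rintro rfl
    refine h (act_simpleRefl_of_ne l ν ?_ ?_) <;>
    · rw [Ne, Fin.ext_iff]
      simp only [lo, hi]
      omega
  | hc c => rw [← Algebra.commutes, mul_assoc, e_mul_of_ne hμν, mul_zero]
  | hadd r s _ _ hr hs => rw [mul_add, add_mul, hr μ ν h hμν, hs μ ν h hμν, add_zero]
  | hmul r s _ _ hr hs =>
    -- With `∑ e κ` inserted between `r` and `s`, one of the two factors has to change the letter at
    -- `p`.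
    rw [← mul_assoc, mul_assoc, ← sum_e_mul_mul]
    refine Finset.sum_eq_zero fun κ _ => ?_
    by_cases hκ : μ p = κ p
    · rw [← mul_assoc (e Q κ), hs κ ν (hκ ▸ h) (fun h' => h (hκ.trans (by rw [h']))), mul_zero]
    · rw [hr μ κ hκ (fun h' => hκ (by rw [h'])), zero_mul]

theorem polyAt_mem_sub (f : MvPolynomial (Fin n) k) : polyAt (x Q) f ∈ sub Q n β 0 := by
  refine Subalgebra.sum_mem _ fun m _ => Subalgebra.smul_mem _ (Subalgebra.list_prod_mem _ ?_) _
  intro y hy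
  rw [List.mem_ofFn] at hy
  obtain ⟨t, rfl⟩ := hy
  exact Subalgebra.pow_mem _ (x_mem_sub _ _) _

theorem tau_sq_mem_sub (j : ℕ) : tau Q n β j * tau Q n β j ∈ sub Q n β 0 := by
  rw [tau]
  split_ifs with hj
  · rw [← mul_one (_ * _), ← sum_e, Finset.mul_sum]
    refine Subalgebra.sum_mem _ fun ν _ => ?_
    rw [τ_sq_mul_e]
    exact Subalgebra.mul_mem _ (polyAt_mem_sub _) (e_mem_sub _ _)
  · rw [mul_zero]
    exact Subalgebra.zero_mem _

theorem sandwich_induction {B : Subalgebra k (Alg Q n β)} {t : Alg Q n β} {p : Alg Q n β → Prop}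
    {z : Alg Q n β} (hz : z ∈ B.toSubmodule * Submodule.span k {t} * B.toSubmodule)
    (hmul : ∀ b ∈ B, ∀ b' ∈ B, p (b * t * b')) (hadd : ∀ r s, p r → p s → p (r + s)) : p z := by
  refine Submodule.mul_induction_on hz (fun y hy b' hb' => ?_) hadd
  have h : ∀ c ∈ B.toSubmodule * Submodule.span k {t}, ∀ b' ∈ B, p (c * b') := fun c hc =>
    Submodule.mul_induction_on hc (fun b hb u hu b' hb' => by
      obtain ⟨a, rfl⟩ := Submodule.mem_span_singleton.1 hu
      have := hmul (a • b) (Subalgebra.smul_mem _ hb a) b' hb'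
      rwa [smul_mul_assoc a b t, ← mul_smul_comm] at this) (fun r s hr hs b' hb' => by
      rw [add_mul]
      exact hadd _ _ (hr b' hb') (hs b' hb'))
  exact h y hy b' hb'

theorem mul_mul_mem_sandwich {B : Subalgebra k (Alg Q n β)} (t : Alg Q n β) {b b' : Alg Q n β}
    (hb : b ∈ B) (hb' : b' ∈ B) :
    b * t * b' ∈ B.toSubmodule * Submodule.span k {t} * B.toSubmodule :=
  Submodule.mul_mem_mul (Submodule.mul_mem_mul hb (Submodule.mem_span_singleton_self t)) hb'

open Subalgebra in
-- With `B` the smaller subalgebra and `T` the span of `τ_j`, the inclusion `T B T ≤ B + B T B`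
-- suffices: it makes `B + B T B` closed under multiplication, and this space contains all
-- generators.
theorem sub_succ_le_of_forall {j : ℕ} (H : ∀ b ∈ sub Q n β j, tau Q n β j * b * tau Q n β j ∈
      toSubmodule (sub Q n β j) ⊔
        toSubmodule (sub Q n β j) * Submodule.span k {tau Q n β j} * toSubmodule (sub Q n β j)) :
    toSubmodule (sub Q n β (j + 1)) ≤ toSubmodule (sub Q n β j) ⊔
      toSubmodule (sub Q n β j) * Submodule.span k {tau Q n β j} * toSubmodule (sub Q n β j) := by
  set B := toSubmodule (sub Q n β j) with hB
  set T := Submodule.span k {tau Q n β j} with hT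
  have hBB : B * B = B := (Subalgebra.isIdempotentElem_toSubmodule _).eq
  have hTBT : T * B * T ≤ B ⊔ B * T * B := by
    rw [Submodule.mul_le]
    intro y hy u hu
    obtain ⟨a, rfl⟩ := Submodule.mem_span_singleton.1 hu
    rw [mul_smul_comm]
    refine Submodule.smul_mem _ _ ?_
    refine Submodule.mul_induction_on hy (fun v hv b hb => ?_) fun r s hr hs => ?_
    · obtain ⟨a', rfl⟩ := Submodule.mem_span_singleton.1 hv
      rw [smul_mul_assoc, smul_mul_assoc]
      exact Submodule.smul_mem _ _ (H b hb)
    · rw [add_mul]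
      exact Submodule.add_mem _ hr hs
  have hE : (B ⊔ B * T * B) * (B ⊔ B * T * B) ≤ B ⊔ B * T * B := by
    rw [Submodule.sup_mul, Submodule.mul_sup, Submodule.mul_sup]
    have h₁ : B * (B * T * B) = B * T * B := by rw [← mul_assoc, ← mul_assoc, hBB]
    have h₂ : B * T * B * B = B * T * B := by rw [mul_assoc, hBB]
    have h₃ : B * T * B * (B * T * B) ≤ B ⊔ B * T * B := by
      calc B * T * B * (B * T * B) = B * (T * (B * B) * T) * B := by simp only [mul_assoc]
        _ = B * (T * B * T) * B := by rw [hBB]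
        _ ≤ B * (B ⊔ B * T * B) * B :=
          mul_le_mul' (mul_le_mul' le_rfl hTBT) le_rfl
        _ = B ⊔ B * T * B := by
          rw [Submodule.mul_sup, Submodule.sup_mul, hBB, hBB, h₁, h₂]
    rw [hBB, h₁, h₂]
    exact sup_le le_rfl (sup_le le_sup_right h₃)
  intro z hz
  have hle : sub Q n β j ≤ sub Q n β (j + 1) := sub_mono (Nat.le_succ j)
  refine sub_induction (p := fun z _ => z ∈ B ⊔ B * T * B) ?_ ?_ ?_ ?_ ?_ ?_ hz
  · exact fun ν => Submodule.mem_sup_left (e_mem_sub j ν)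
  · exact fun t => Submodule.mem_sup_left (x_mem_sub j t)
  · intro l hl
    rcases Nat.lt_succ_iff_lt_or_eq.1 hl with hl | hl
    · exact Submodule.mem_sup_left (τ_mem_sub hl)
    · refine Submodule.mem_sup_right ?_
      have h : τ Q l = 1 * tau Q n β j * 1 := by
        subst hl
        rw [tau, dif_pos l.2, one_mul, mul_one]
      rw [h]
      exact mul_mul_mem_sandwich _ (Subalgebra.one_mem _) (Subalgebra.one_mem _)
  · exact fun c => Submodule.mem_sup_left (Subalgebra.algebraMap_mem (sub Q n β j) c)
  · exact fun r s _ _ hr hs => Submodule.add_mem _ hr hs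
  · exact fun r s _ _ hr hs => hE (Submodule.mul_mem_mul hr hs)

section

variable [IsMultiplicityFree β]

/-- `τ_j` commutes with the distant `τ_l` and permutes the `e(ν)` and the `x_t`, so it can be
carried through `sub i` to either side. -/
theorem tau_mul_comm_sub {i j : ℕ} (hij : ∀ l < i, l + 1 < j) {b : Alg Q n β}
    (hb : b ∈ sub Q n β i) : (∃ b' ∈ sub Q n β i, tau Q n β j * b = b' * tau Q n β j) ∧
      ∃ b' ∈ sub Q n β i, b * tau Q n β j = tau Q n β j * b' := by
  by_cases hj : j < n - 1
  · simp only [tau, dif_pos hj]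
    induction hb using sub_induction with
    | he ν => exact ⟨⟨_, e_mem_sub _ _, τ_mul_e _ _⟩, _, e_mem_sub _ _, e_mul_τ _ _⟩
    | hx t =>
      refine ⟨⟨_, x_mem_sub _ _, τ_mul_x _ _⟩, x Q (simpleRefl ⟨j, hj⟩ t), x_mem_sub _ _, ?_⟩
      rw [τ_mul_x, ← Perm.mul_apply, simpleRefl_mul_self, Perm.one_apply]
    | hτ l hl =>
      have hmem : τ Q l ∈ sub Q n β i := τ_mem_sub hl
      have hcomm := τ_mul_τ (Q := Q) (β := β) ⟨j, hj⟩ l (Or.inr (hij l hl))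
      exact ⟨⟨_, hmem, hcomm⟩, _, hmem, hcomm.symm⟩
    | hc c =>
      exact ⟨⟨_, Subalgebra.algebraMap_mem _ c, (Algebra.commutes _ _).symm⟩, _,
        Subalgebra.algebraMap_mem _ c, Algebra.commutes _ _⟩
    | hadd r s _ _ hr hs =>
      obtain ⟨⟨r', hr', hr₁⟩, r'', hr'', hr₂⟩ := hr
      obtain ⟨⟨s', hs', hs₁⟩, s'', hs'', hs₂⟩ := hs
      exact ⟨⟨_, Subalgebra.add_mem _ hr' hs', by rw [mul_add, hr₁, hs₁, add_mul]⟩, _,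
        Subalgebra.add_mem _ hr'' hs'', by rw [mul_add, add_mul, hr₂, hs₂]⟩
    | hmul r s _ _ hr hs =>
      obtain ⟨⟨r', hr', hr₁⟩, r'', hr'', hr₂⟩ := hr
      obtain ⟨⟨s', hs', hs₁⟩, s'', hs'', hs₂⟩ := hs
      exact ⟨⟨_, Subalgebra.mul_mem _ hr' hs', by
          rw [← mul_assoc, hr₁, mul_assoc, hs₁, mul_assoc]⟩, _,
        Subalgebra.mul_mem _ hr'' hs'', by rw [mul_assoc, hs₂, ← mul_assoc, hr₂, mul_assoc]⟩
  · simp only [tau, dif_neg hj, zero_mul, mul_zero]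
    exact ⟨⟨_, hb, trivial⟩, _, hb, trivial⟩

theorem tau_braid (j : ℕ) : tau Q n β (j + 1) * tau Q n β j * tau Q n β (j + 1)
    = tau Q n β j * tau Q n β (j + 1) * tau Q n β j := by
  by_cases hj : j + 1 < n - 1
  · have hj' : j < n - 1 := by omega
    rw [tau, tau, dif_pos hj, dif_pos hj']
    exact braid ⟨j, hj'⟩ ⟨j + 1, hj⟩ rfl
  · have : tau Q n β (j + 1) = 0 := dif_neg hj
    rw [this]
    simp

open Subalgebra in
/-- Every element of `sub (j + 1)` is a combination of products of generators in which `τ_j` occurs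
at most once. -/
theorem sub_succ_le (j : ℕ) : toSubmodule (sub Q n β (j + 1)) ≤ toSubmodule (sub Q n β j) ⊔
    toSubmodule (sub Q n β j) * Submodule.span k {tau Q n β j} * toSubmodule (sub Q n β j) := by
  induction j with
  | zero =>
    refine sub_succ_le_of_forall fun b hb => Submodule.mem_sup_left ?_
    obtain ⟨⟨b', hb', h⟩, -⟩ := tau_mul_comm_sub (j := 0) (by omega) hb
    rw [h, mul_assoc]
    exact Subalgebra.mul_mem _ hb' (tau_sq_mem_sub 0)
  | succ i ih =>
    have hle : sub Q n β i ≤ sub Q n β (i + 1) := sub_mono (Nat.le_succ i)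
    refine sub_succ_le_of_forall fun b hb => ?_
    obtain ⟨b₁, hb₁, b₂, hb₂, rfl⟩ := Submodule.mem_sup.1 (ih hb)
    rw [mul_add, add_mul]
    refine Submodule.add_mem _ (Submodule.mem_sup_left ?_) (Submodule.mem_sup_right ?_)
    · obtain ⟨⟨b', hb', h⟩, -⟩ := tau_mul_comm_sub (j := i + 1) (by omega) hb₁
      rw [h, mul_assoc]
      exact Subalgebra.mul_mem _ (hle hb') (sub_mono (Nat.zero_le _) (tau_sq_mem_sub (i + 1)))
    · refine sandwich_induction (p := fun z => tau Q n β (i + 1) * z * tau Q n β (i + 1) ∈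
        toSubmodule (sub Q n β (i + 1)) * Submodule.span k {tau Q n β (i + 1)} *
          toSubmodule (sub Q n β (i + 1))) hb₂ ?_ ?_
      · intro c hc d hd
        obtain ⟨⟨c', hc', h₁⟩, -⟩ := tau_mul_comm_sub (j := i + 1) (by omega) hc
        obtain ⟨-, d', hd', h₂⟩ := tau_mul_comm_sub (j := i + 1) (by omega) hd
        have ht : tau Q n β i ∈ sub Q n β (i + 1) := tau_mem_sub (Nat.lt_succ_self i)
        -- Once `c` and `d` are carried outside, the braid relation leaves a single `τ_{i+1}`.
        have : tau Q n β (i + 1) * (c * tau Q n β i * d) * tau Q n β (i + 1)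
            = c' * tau Q n β i * tau Q n β (i + 1) * (tau Q n β i * d') := by
          calc _ = tau Q n β (i + 1) * c * tau Q n β i * (d * tau Q n β (i + 1)) := by
                simp only [mul_assoc]
            _ = c' * (tau Q n β (i + 1) * tau Q n β i * tau Q n β (i + 1)) * d' := by
                rw [h₁, h₂]; simp only [mul_assoc]
            _ = _ := by rw [tau_braid]; simp only [mul_assoc]
        rw [this]
        exact mul_mul_mem_sandwich _ (Subalgebra.mul_mem _ (hle hc') ht)
          (Subalgebra.mul_mem _ ht (hle hd'))
      · intro r s hr hs
        rw [mul_add, add_mul]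
        exact Submodule.add_mem _ hr hs

theorem exists_mul_e_eq (γ : Weight n β) {b : Alg Q n β} (hb : b ∈ sub Q n β 0) (ν : Weight n β) :
    ∃ f, b * e Q ν = ρ Q γ f * e Q ν := by
  induction hb using sub_induction generalizing ν with
  | he κ =>
    by_cases hκ : κ = ν
    · exact ⟨1, by rw [hκ, map_one, one_mul, e_mul_self]⟩
    · exact ⟨0, by rw [e_mul_of_ne hκ, map_zero, zero_mul]⟩
  | hx t => exact ⟨_, x_mul_e_eq γ t ν⟩
  | hτ l hl => omega
  | hc c => exact ⟨algebraMap k _ c, by rw [AlgHom.commutes]⟩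
  | hadd r s _ _ hr hs =>
    obtain ⟨f, hf⟩ := hr ν
    obtain ⟨g, hg⟩ := hs ν
    exact ⟨f + g, by rw [map_add, add_mul, add_mul, hf, hg]⟩
  | hmul r s _ _ hr hs =>
    obtain ⟨f, hf⟩ := hr ν
    obtain ⟨g, hg⟩ := hs ν
    exact ⟨f * g, mul_mul_e γ hf hg⟩

/-- The diagonal parts of `R_β` consist of polynomials. -/
theorem exists_e_mul_mul_e_eq (γ : Weight n β) (r : Alg Q n β) (ν : Weight n β) :
    ∃ f, e Q ν * r * e Q ν = ρ Q γ f * e Q ν := by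
  have key : ∀ j, ∀ b ∈ sub Q n β j, ∃ f, e Q ν * b * e Q ν = ρ Q γ f * e Q ν := by
    intro j
    induction j with
    | zero =>
      intro b hb
      exact exists_mul_e_eq γ (Subalgebra.mul_mem _ (e_mem_sub 0 ν) hb) ν
    | succ j ih =>
      intro b hb
      obtain ⟨b₁, hb₁, b₂, hb₂, rfl⟩ := Submodule.mem_sup.1 (sub_succ_le j hb)
      obtain ⟨f, hf⟩ := ih b₁ hb₁
      refine ⟨f, ?_⟩
      rw [mul_add, add_mul, hf, add_eq_left]
      refine sandwich_induction (p := fun z => e Q ν * z * e Q ν = 0) hb₂ ?_ ?_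
      · intro c hc d hd
        rw [tau]
        split_ifs with hj
        · have : e Q ν * (c * τ Q ⟨j, hj⟩ * d) * e Q ν
              = e Q ν * c * τ Q ⟨j, hj⟩ * (d * e Q ν) := by simp only [mul_assoc]
          rw [this, ← sum_e_mul_mul]
          refine Finset.sum_eq_zero fun μ _ => ?_
          -- Only `τ_j` can change the letter at the place `hi`. It occurs once and puts a different
          -- letter there, which neither `c` nor `d` can undo.
          by_cases hμ : μ (hi ⟨j, hj⟩) = ν (hi ⟨j, hj⟩)
          · have h0 : e Q ν * c * e Q (Weight.act (simpleRefl ⟨j, hj⟩) μ) = 0 := by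
              refine e_mul_mul_e_eq_zero hc _ _ (hi ⟨j, hj⟩) (Nat.lt_succ_self j) ?_
              rw [act_simpleRefl_hi, ← hμ]
              exact fun h => lo_ne_hi _ (μ.injective h.symm)
            rw [mul_assoc (e Q ν * c), τ_mul_e, ← mul_assoc (e Q ν * c), h0, zero_mul, zero_mul]
          · rw [← mul_assoc (e Q μ),
              e_mul_mul_e_eq_zero hd _ _ (hi ⟨j, hj⟩) (Nat.lt_succ_self j) hμ, mul_zero]
        · simp
      · intro r s hr hs
        rw [mul_add, add_mul, hr, hs, add_zero]
  exact key n r (by rw [sub_top]; exact Algebra.mem_top)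

end

end Alg

end Diagonal

end KLR

namespace KLR

/-! ### Moves versus simple transpositions -/

section AdjacentWords

open Equiv

variable {n : ℕ}

theorem take_append_drop_ofFn {α : Type*} (f g : Fin n → α) (l : Fin (n - 1))
    (h : ∀ t, t ≠ lo l → t ≠ hi l → g t = f t) :
    List.ofFn g = (List.ofFn f).take l ++ g (lo l) :: g (hi l) :: (List.ofFn f).drop (l + 2) := by
  have hl := l.2
  refine List.ext_getElem (by simp; omega) fun i h₁ h₂ => ?_
  rw [List.length_ofFn] at h₁
  rw [List.getElem_ofFn, List.getElem_append]
  have hlen : ((List.ofFn f).take l).length = l := by simp; omega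
  split_ifs with hi₁
  · rw [hlen] at hi₁
    rw [List.getElem_take, List.getElem_ofFn]
    apply h <;>
    · rw [Ne, Fin.ext_iff]
      simp only [lo, hi]
      omega
  · rw [hlen] at hi₁
    obtain ⟨j, rfl⟩ : ∃ j, i = l + j := ⟨i - l, by omega⟩
    simp only [hlen, Nat.add_sub_cancel_left]
    rcases j with _ | _ | j
    · rfl
    · rfl
    · simp only [List.getElem_cons_succ, List.getElem_drop, List.getElem_ofFn]
      rw [h]
      · congr 2
        omega
      all_goals
        rw [Ne, Fin.ext_iff]
        simp only [lo, hi]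
        omega

/-- Adjacent words. -/
theorem exists_word_mul_simpleRefl (σ : Perm (Fin n)) (l : Fin (n - 1)) :
    ∃ X Y : List (WithBot (Fin n)), X.length = l ∧
      word σ = (⊥ :: X) ++ (σ (lo l) : WithBot (Fin n)) :: (σ (hi l) : WithBot (Fin n)) :: Y ∧
      word (σ * simpleRefl l) =
        (⊥ :: X) ++ (σ (hi l) : WithBot (Fin n)) :: (σ (lo l) : WithBot (Fin n)) :: Y := by
  have hl := l.2
  refine ⟨(List.ofFn fun t => (σ t : WithBot (Fin n))).take l,
    (List.ofFn fun t => (σ t : WithBot (Fin n))).drop (l + 2), by simp; omega, ?_, ?_⟩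
  · rw [word, List.cons_append]
    congr 1
    exact take_append_drop_ofFn _ _ l fun _ _ _ => rfl
  · rw [word, List.cons_append]
    congr 1
    have := take_append_drop_ofFn (fun t => (σ t : WithBot (Fin n)))
      (fun t => ((σ * simpleRefl l) t : WithBot (Fin n))) l fun t h₁ h₂ => by
        rw [Perm.mul_apply, simpleRefl, swap_apply_of_ne_of_ne h₁ h₂]
    rw [this]
    simp only [Perm.mul_apply, simpleRefl, swap_apply_left, swap_apply_right]

theorem exists_simpleRefl_of_word_eq {σ : Perm (Fin n)} {X Y : List (WithBot (Fin n))}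
    (hX : X ≠ []) {c d : WithBot (Fin n)} (h : word σ = X ++ c :: d :: Y) :
    ∃ l : Fin (n - 1), c = σ (lo l) ∧ d = σ (hi l) ∧
      word (σ * simpleRefl l) = X ++ d :: c :: Y := by
  obtain ⟨x, X, rfl⟩ := List.exists_cons_of_ne_nil hX
  have hlen := congrArg List.length h
  simp only [word, List.length_cons, List.length_ofFn, List.length_append] at hlen
  obtain ⟨X', Y', hX', h₁, h₂⟩ := exists_word_mul_simpleRefl σ ⟨X.length, by omega⟩
  have h₃ := h.symm.trans h₁
  obtain ⟨h₄, h₅⟩ := List.append_inj h₃ (by simpa using hX'.symm)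
  simp only [List.cons.injEq] at h₅
  obtain ⟨h₅, h₆, rfl⟩ := h₅
  exact ⟨_, h₅, h₆, by rw [h₂, h₄, h₅, h₆]⟩

section Criterion

variable {S : Type*} [CommRing S] {q : WithBot (Fin n) → WithBot (Fin n) → S}

/-- The module spanned by the relations of all moves contains those attached to simple
transpositions. -/
theorem single_sub_single_mem_moveRel (hq : ∀ c d, q c d = q d c) (σ : Perm (Fin n))
    (l : Fin (n - 1)) (f : S) (hf : q (σ (lo l)) (σ (hi l)) ∣ f) :
    (Pi.single σ f - Pi.single (σ * simpleRefl l) f : Perm (Fin n) → S)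
      ∈ moveRel q (wordVec S) Set.univ := by
  obtain ⟨X, Y, -, h₁, h₂⟩ := exists_word_mul_simpleRefl σ l
  have hne : (σ (lo l) : WithBot (Fin n)) ≠ σ (hi l) := fun h =>
    lo_ne_hi l (σ.injective (WithBot.coe_injective h))
  have := swap_mem_moveRel (e := wordVec S) hq (⊥ :: X) Y hne (Set.mem_univ _) (Set.mem_univ _)
  rw [← h₁, ← h₂, wordVec_word, wordVec_word] at this
  obtain ⟨g, rfl⟩ := hf
  have := Submodule.smul_mem _ g this
  rwa [smul_smul, smul_sub, ← Pi.single_smul, ← Pi.single_smul, smul_eq_mul, mul_one,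
    mul_comm g] at this

/-- Moving the first colour in front of `⊥` yields a list that is not a word, so the difference in
the relation reduces to the vector of `σ`. -/
theorem single_mem_moveRel (σ : Perm (Fin n)) (t : Fin n) (ht : (t : ℕ) = 0) (f : S)
    (hf : q (σ t) ⊥ ∣ f) :
    (Pi.single σ f : Perm (Fin n) → S) ∈ moveRel q (wordVec S) Set.univ := by
  obtain ⟨X, R, h, hX, -⟩ := exists_append_eq_word σ t
  rw [ht, List.length_eq_zero_iff] at hX
  subst hX
  have hm := Move.mk [] ⊥ [] (σ t : WithBot (Fin n)) R (WithBot.bot_lt_coe _) (by simp)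
  have := hm.mem_moveRel (q := q) (e := wordVec S) (Set.mem_univ _)
  have h₁ : [] ++ ⊥ :: ([] ++ (σ t : WithBot (Fin n)) :: R) = word σ := by rw [h]; rfl
  have h₂ : wordVec S ([] ++ (σ t : WithBot (Fin n)) :: ⊥ :: ([] ++ R)) = 0 := by
    refine wordVec_of_not ?_
    rintro ⟨τ, hτ⟩
    simp only [word, List.nil_append, List.cons.injEq] at hτ
    exact WithBot.bot_ne_coe hτ.1
  rw [h₁, h₂, sub_zero, wordVec_word] at this
  obtain ⟨g, rfl⟩ := hf
  have := Submodule.smul_mem _ g this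
  rwa [fac, List.map_singleton, List.prod_singleton, smul_smul, ← Pi.single_smul, smul_eq_mul,
    mul_one, mul_comm g] at this

/-- Conversely, the relations attached to simple transpositions imply those of all moves. -/
theorem moveRel_le_of_forall {N : Submodule S (Perm (Fin n) → S)}
    (h₁ : ∀ (σ : Perm (Fin n)) (l : Fin (n - 1)), q (σ (lo l)) (σ (hi l)) •
      (Pi.single σ 1 - Pi.single (σ * simpleRefl l) 1 : Perm (Fin n) → S) ∈ N)
    (h₂ : ∀ (σ : Perm (Fin n)) (t : Fin n), (t : ℕ) = 0 →
      q (σ t) ⊥ • (Pi.single σ 1 : Perm (Fin n) → S) ∈ N) :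
    moveRel q (wordVec S) Set.univ ≤ N := by
  have hswap : ∀ X : List (WithBot (Fin n)), X ≠ [] → ∀ c d Y,
      q c d • (wordVec S (X ++ c :: d :: Y) - wordVec S (X ++ d :: c :: Y)) ∈ N := by
    intro X hX c d Y
    by_cases hw : ∃ σ, word σ = X ++ c :: d :: Y
    · obtain ⟨σ, hσ⟩ := hw
      obtain ⟨l, rfl, rfl, h⟩ := exists_simpleRefl_of_word_eq hX hσ
      rw [← hσ, ← h, wordVec_word, wordVec_word]
      exact h₁ σ l
    · have hw' : ¬ ∃ σ, word σ = X ++ d :: c :: Y := by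
        rintro ⟨σ, hσ⟩
        obtain ⟨l, -, -, h⟩ := exists_simpleRefl_of_word_eq hX hσ
        exact hw ⟨_, h⟩
      rw [wordVec_of_not hw, wordVec_of_not hw', sub_self, smul_zero]
      exact Submodule.zero_mem _
  rw [moveRel_eq_inter_range, moveRel, Submodule.span_le]
  rintro _ ⟨μ, ⟨-, σ, rfl⟩, c, F, μ', h, rfl⟩
  have hnd := word_nodup σ
  generalize hw : word σ = w at h hnd
  have h' := h
  obtain ⟨L, p, B, c, R, hp, hB⟩ := h
  -- If `L` is empty then `p = ⊥`: the letter `c` is carried by swaps to the first place, where `h₂`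
  -- applies. Otherwise the whole move is a chain of swaps.
  rcases L with _ | ⟨x, L⟩
  · simp only [word, List.nil_append, List.cons.injEq] at hw
    obtain ⟨rfl, hw⟩ := hw
    have hc : c ∉ B := fun h => lt_irrefl _ (hB c h)
    have hs := slide_mem (q := q) (e := wordVec S) B [⊥] R hc (N := N) fun Z b Y _ => by
      have := hswap ([⊥] ++ Z) (by simp) c b Y
      simpa using this
    have h₃ : wordVec S (c :: ⊥ :: (B ++ R)) = 0 := by
      refine wordVec_of_not ?_
      rintro ⟨τ, hτ⟩
      simp only [word, List.cons.injEq] at hτ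
      exact hp.ne hτ.1
    have h₄ : q c ⊥ • wordVec S ([⊥] ++ c :: (B ++ R)) ∈ N := by
      by_cases hw : ∃ τ, word τ = [⊥] ++ c :: (B ++ R)
      · obtain ⟨τ, hτ⟩ := hw
        rw [← hτ, wordVec_word]
        have hn : 0 < n := by
          have := congrArg List.length hτ
          simp [word] at this
          omega
        have hc : c = (τ ⟨0, hn⟩ : WithBot (Fin n)) := by
          have h0 : (word τ)[1]? = some c := by rw [hτ]; rfl
          rw [word, List.getElem?_cons_succ, List.getElem?_ofFn, dif_pos hn, Option.some_inj] at h0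
          exact h0.symm
        rw [hc]
        exact h₂ τ _ rfl
      · rw [wordVec_of_not hw, smul_zero]
        exact Submodule.zero_mem _
    have : fac q c (⊥ :: B) • (wordVec S ([] ++ ⊥ :: (B ++ c :: R))
        - wordVec S ([] ++ c :: ⊥ :: (B ++ R)))
        = q c ⊥ • (fac q c B • (wordVec S ([⊥] ++ (B ++ c :: R))
          - wordVec S ([⊥] ++ c :: (B ++ R))))
          + fac q c B • (q c ⊥ • wordVec S ([⊥] ++ c :: (B ++ R))) := by
      rw [fac_cons, List.nil_append, List.nil_append, h₃]
      simp only [List.cons_append, List.nil_append]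
      module
    rw [this]
    exact Submodule.add_mem _ (Submodule.smul_mem _ _ hs) (Submodule.smul_mem _ _ h₄)
  · have hc : c ∉ p :: B := by
      rw [List.mem_cons, not_or]
      exact ⟨hp.ne', fun h => lt_irrefl _ (hB c h)⟩
    have hs := slide_mem (q := q) (e := wordVec S) (p :: B) (x :: L) R hc (N := N)
      fun Z b Y _ => by
        have := hswap (x :: L ++ Z) (by simp) c b Y
        simpa using this
    simpa using hs

end Criterion

end AdjacentWords

/-! ### The cocenter as a quotient of a free module -/

section Cocenter

open Equiv

variable {I k : Type*} [CommRing k] {Q : I → I → MvPolynomial (Fin 2) k} {n : ℕ} {β : I →₀ ℕ}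
  {a : I → Polynomial k}

variable (Q n β a) in
/-- The canonical map from `R_β` to the cocenter of `R_β^Λ`. -/
def toCocenter : Alg Q n β →ₗ[k] Cocenter k (CycAlg Q n β a) :=
  (commutators k (CycAlg Q n β a)).mkQ.comp
    ({ toFun := toCyc Q n β a
       map_add' := map_add _
       map_smul' := fun _ _ => rfl } : Alg Q n β →ₗ[k] CycAlg Q n β a)

theorem toCocenter_apply (r : Alg Q n β) :
    toCocenter Q n β a r = Submodule.Quotient.mk (toCyc Q n β a r) := rfl

theorem toCyc_surjective : Function.Surjective (toCyc Q n β a) := RingCon.mk'_surjective _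

theorem toCyc_eq_zero_iff {r : Alg Q n β} : toCyc Q n β a r = 0 ↔ r ∈ cycIdeal Q n β a := by
  rw [TwoSidedIdeal.mem_iff, ← RingCon.eq]
  rfl

theorem toCocenter_surjective : Function.Surjective (toCocenter Q n β a) :=
  (Submodule.mkQ_surjective _).comp toCyc_surjective

theorem toCocenter_mul_comm (r s : Alg Q n β) :
    toCocenter Q n β a (r * s) = toCocenter Q n β a (s * r) := by
  rw [← sub_eq_zero, ← map_sub, toCocenter_apply, Submodule.Quotient.mk_eq_zero, map_sub, map_mul,
    map_mul]
  exact Submodule.subset_span ⟨_, _, rfl⟩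

theorem toCocenter_eq_zero_of_mem {r : Alg Q n β} (hr : r ∈ cycIdeal Q n β a) :
    toCocenter Q n β a r = 0 := by
  rw [toCocenter_apply, toCyc_eq_zero_iff.2 hr, Submodule.Quotient.mk_zero]

theorem exists_of_toCocenter_eq_zero {r : Alg Q n β} (hr : toCocenter Q n β a r = 0) :
    ∃ s ∈ commutators k (Alg Q n β), r - s ∈ cycIdeal Q n β a := by
  rw [toCocenter_apply, Submodule.Quotient.mk_eq_zero] at hr
  have key : ∀ z ∈ commutators k (CycAlg Q n β a), ∃ s ∈ commutators k (Alg Q n β),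
      toCyc Q n β a s = z := by
    intro z hz
    induction hz using Submodule.span_induction with
    | mem x hx =>
      obtain ⟨u, v, rfl⟩ := hx
      obtain ⟨u, rfl⟩ := toCyc_surjective u
      obtain ⟨v, rfl⟩ := toCyc_surjective v
      exact ⟨u * v - v * u, Submodule.subset_span ⟨u, v, rfl⟩, by simp⟩
    | zero => exact ⟨0, Submodule.zero_mem _, map_zero _⟩
    | add x y _ _ hx hy =>
      obtain ⟨s, hs, rfl⟩ := hx
      obtain ⟨t, ht, rfl⟩ := hy
      exact ⟨s + t, Submodule.add_mem _ hs ht, map_add _ _ _⟩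
    | smul c x _ hx =>
      obtain ⟨s, hs, rfl⟩ := hx
      exact ⟨c • s, Submodule.smul_mem _ _ hs, rfl⟩
  obtain ⟨s, hs, h⟩ := key _ hr
  refine ⟨s, hs, ?_⟩
  rw [← toCyc_eq_zero_iff, map_sub, h, sub_self]

variable (γ : Weight n β)

variable (Q a) in
/-- The polynomials attached to pairs of letters: `Q_{ij}` for two colours, and `a_i^Λ` for a
colour and `⊥`. -/
noncomputable def qWord : WithBot (Fin n) → WithBot (Fin n) → MvPolynomial (Fin n) k :=
  fun c d => c.recBotCoe
    (d.recBotCoe 0 fun d => Polynomial.aeval (MvPolynomial.X d) (a (γ d)))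
    fun c => d.recBotCoe (Polynomial.aeval (MvPolynomial.X c) (a (γ c))) fun d => Alg.qCol Q γ c d

@[simp] theorem qWord_coe_coe (c d : Fin n) : qWord Q a γ c d = Alg.qCol Q γ c d := rfl

@[simp] theorem qWord_coe_bot (c : Fin n) :
    qWord Q a γ c ⊥ = Polynomial.aeval (MvPolynomial.X c) (a (γ c)) := rfl

theorem qWord_symm (hQ : ∀ c d, Alg.qCol Q γ c d = Alg.qCol Q γ d c) (c d : WithBot (Fin n)) :
    qWord Q a γ c d = qWord Q a γ d c := by
  induction c using WithBot.recBotCoe <;> induction d using WithBot.recBotCoe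
  exacts [rfl, rfl, rfl, hQ _ _]

variable [IsMultiplicityFree β]

variable (Q a) in
/-- The map sending the vector with entries `f_σ` to the class of `∑_ν f_ν e(ν)`. -/
noncomputable def ofVec :
    (Perm (Fin n) → MvPolynomial (Fin n) k) →ₗ[k] Cocenter k (CycAlg Q n β a) :=
  (toCocenter Q n β a).comp
    ({ toFun := fun v => ∑ ν : Weight n β, Alg.ρ Q γ (v (col γ ν)) * Alg.e Q ν
       map_add' := fun v w => by
        simp only [Pi.add_apply, map_add, add_mul, Finset.sum_add_distrib]
       map_smul' := fun c v => by
        simp only [Pi.smul_apply, map_smul, smul_mul_assoc, Finset.smul_sum, RingHom.id_apply] } :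
      (Perm (Fin n) → MvPolynomial (Fin n) k) →ₗ[k] Alg Q n β)

theorem ofVec_apply (v : Perm (Fin n) → MvPolynomial (Fin n) k) :
    ofVec Q a γ v = toCocenter Q n β a (∑ ν : Weight n β, Alg.ρ Q γ (v (col γ ν)) * Alg.e Q ν) :=
  rfl

theorem ofVec_single (ν : Weight n β) (f : MvPolynomial (Fin n) k) :
    ofVec Q a γ (Pi.single (col γ ν) f) = toCocenter Q n β a (Alg.ρ Q γ f * Alg.e Q ν) := by
  rw [ofVec_apply, Finset.sum_eq_single ν, Pi.single_eq_same]
  · intro μ _ h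
    rw [Pi.single_eq_of_ne fun h' => h (col_injective γ h'), map_zero, zero_mul]
  · simp

/-- In the cocenter `r e(ν)` agrees with `e(ν) r e(ν)`, so an element is represented by its diagonal
parts, which are polynomials. -/
theorem ofVec_surjective : Function.Surjective (ofVec Q a γ) := by
  intro z
  obtain ⟨r, rfl⟩ := toCocenter_surjective z
  choose f hf using fun ν => Alg.exists_e_mul_mul_e_eq γ r ν
  refine ⟨fun σ => f ((colEquiv γ).symm σ), ?_⟩
  rw [ofVec_apply]
  have h₁ : ∀ ν, (colEquiv γ).symm (col γ ν) = ν := fun ν => (colEquiv γ).symm_apply_apply ν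
  simp only [h₁, ← hf, map_sum]
  have h₂ : ∀ ν : Weight n β, toCocenter Q n β a (Alg.e Q ν * r * Alg.e Q ν)
      = toCocenter Q n β a (r * Alg.e Q ν) := fun ν => by
    rw [toCocenter_mul_comm, ← mul_assoc, Alg.e_mul_self, toCocenter_mul_comm]
  simp only [h₂]
  rw [← map_sum, ← Finset.mul_sum, Alg.sum_e, mul_one]

theorem cyc_mul_e (t : Fin n) (ν : Weight n β) : Alg.cyc Q a t * Alg.e Q ν
    = Alg.ρ Q γ (qWord Q a γ (col γ ν t) ⊥) * Alg.e Q ν := by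
  rw [Alg.cyc, Finset.sum_mul, Finset.sum_eq_single ν, mul_assoc, Alg.e_mul_self,
    Alg.aeval_mul_e γ, qWord_coe_bot, apply_col]
  · intro μ _ h
    rw [mul_assoc, Alg.e_mul_of_ne h, mul_zero]
  · simp

theorem ofVec_eq_zero_of_mem (hQ : ∀ c d, Alg.qCol Q γ c d = Alg.qCol Q γ d c)
    {v : Perm (Fin n) → MvPolynomial (Fin n) k} (hv : v ∈ cocenterRel (qWord Q a γ)) :
    ofVec Q a γ v = 0 := by
  -- `ofVec` is linear over `k` only; `N` is the largest submodule over the polynomial ring inside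
  -- its kernel.
  let N : Submodule (MvPolynomial (Fin n) k) (Perm (Fin n) → MvPolynomial (Fin n) k) :=
    { carrier := {v | ∀ f : MvPolynomial (Fin n) k, ofVec Q a γ (f • v) = 0}
      add_mem' := fun {v w} hv hw f => by rw [smul_add, map_add, hv f, hw f, add_zero]
      zero_mem' := fun f => by rw [smul_zero, map_zero]
      smul_mem' := fun g v hv f => by rw [smul_smul]; exact hv _ }
  have hN : cocenterRel (qWord Q a γ) ≤ N := by
    refine moveRel_le_of_forall ?_ ?_
    · intro σ l f
      obtain ⟨ν, rfl⟩ := col_surjective γ σ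
      rw [qWord_coe_coe, smul_smul, smul_sub, ← Pi.single_smul, ← Pi.single_smul, smul_eq_mul,
        mul_one, map_sub, ← col_act_simpleRefl, ofVec_single, ofVec_single, sub_eq_zero]
      set μ := Weight.act (simpleRefl l) ν with hμ
      -- The two elements are `u v` and `v u` for `u = ρ(f) τ_l e(μ)` and `v = τ_l e(ν)`.
      have h₁ : Alg.ρ Q γ (f * Alg.qCol Q γ (col γ ν (lo l)) (col γ ν (hi l))) * Alg.e Q ν
          = (Alg.ρ Q γ f * (Alg.τ Q l * Alg.e Q μ)) * (Alg.τ Q l * Alg.e Q ν) := by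
        rw [map_mul, mul_assoc, ← Alg.τ_mul_τ_mul_e, mul_assoc, mul_assoc (Alg.τ Q l),
          Alg.τ_mul_e l ν, ← mul_assoc (Alg.e Q μ), Alg.e_mul_self]
      have h₂ : Alg.ρ Q γ (f * Alg.qCol Q γ (col γ ν (lo l)) (col γ ν (hi l))) * Alg.e Q μ
          = (Alg.τ Q l * Alg.e Q ν) * (Alg.ρ Q γ f * (Alg.τ Q l * Alg.e Q μ)) := by
        have h := Alg.τ_mul_τ_mul_e (Q := Q) γ l μ
        have h₃ : Alg.τ Q l * Alg.e Q μ = Alg.e Q ν * Alg.τ Q l := by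
          rw [Alg.τ_mul_e, hμ, act_act_simpleRefl]
        rw [hμ, col_act_simpleRefl] at h
        simp only [Perm.mul_apply, simpleRefl, swap_apply_left, swap_apply_right] at h
        rw [map_mul, mul_assoc, hQ, hμ, simpleRefl, ← h, ← simpleRefl, ← hμ, ← mul_assoc _ (Alg.ρ Q γ f),
          ← Alg.ρ_comm, mul_assoc, mul_assoc, h₃, ← mul_assoc (Alg.e Q ν), Alg.e_mul_self]
      rw [h₁, h₂, toCocenter_mul_comm]
    · intro σ t ht f
      obtain ⟨ν, rfl⟩ := col_surjective γ σ
      rw [smul_smul, ← Pi.single_smul, smul_eq_mul, mul_one, ofVec_single,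
        map_mul (Alg.ρ Q γ), mul_assoc, ← cyc_mul_e]
      refine toCocenter_eq_zero_of_mem (TwoSidedIdeal.mul_mem_left _ _ _
        (TwoSidedIdeal.mul_mem_right _ _ _ (TwoSidedIdeal.subset_span ⟨t, ht, rfl⟩)))
  have := hN hv 1
  rwa [one_smul] at this

end Cocenter

end KLR

namespace KLR

/-! ### A representation on the free module -/

section Representation

open Equiv

variable {I k : Type*} [CommRing k] {Q : I → I → MvPolynomial (Fin 2) k} {n : ℕ} {β : I →₀ ℕ}
  (γ : Weight n β)

variable (Q) in
/-- The coefficient by which `τ` acts on a pair of adjacent colours. -/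
noncomputable def crossing (c d : Fin n) : MvPolynomial (Fin n) k :=
  if c < d then Alg.qCol Q γ c d else 1

/-- All of `Q` is charged to one direction of the crossing and nothing to the other. The product is
what `τ_l ^ 2` demands, and the asymmetry lets the entries record the direction. -/
theorem crossing_mul_crossing (hQ : ∀ c d, Alg.qCol Q γ c d = Alg.qCol Q γ d c) {c d : Fin n}
    (h : c ≠ d) : crossing Q γ c d * crossing Q γ d c = Alg.qCol Q γ c d := by
  rcases lt_or_gt_of_ne h with h | h
  · rw [crossing, crossing, if_pos h, if_neg h.not_gt, mul_one]
  · rw [crossing, crossing, if_pos h, if_neg h.not_gt, one_mul, hQ]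

variable [IsMultiplicityFree β]

open Classical in
variable (Q) in
/-- The action of the generators on the free module with basis the colourings. -/
noncomputable def repGen :
    Gen n β → Module.End (MvPolynomial (Fin n) k) (Perm (Fin n) → MvPolynomial (Fin n) k)
  | .e ν =>
    { toFun := fun v σ => if σ = col γ ν then v σ else 0
      map_add' := fun v w => by ext1 σ; simp only [Pi.add_apply]; split_ifs <;> simp
      map_smul' := fun f v => by ext1 σ; simp }
  | .x t =>
    { toFun := fun v σ => MvPolynomial.X (σ t) * v σ
      map_add' := fun v w => by ext1 σ; simp only [Pi.add_apply, mul_add]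
      map_smul' := fun f v => by ext1 σ; simp [mul_left_comm] }
  | .τ l =>
    { toFun := fun v σ => crossing Q γ (σ (hi l)) (σ (lo l)) * v (σ * simpleRefl l)
      map_add' := fun v w => by ext1 σ; simp only [Pi.add_apply, mul_add]
      map_smul' := fun f v => by ext1 σ; simp [mul_left_comm] }

open Classical in
theorem repGen_e (ν : Weight n β) (v : Perm (Fin n) → MvPolynomial (Fin n) k) (σ : Perm (Fin n)) :
    repGen Q γ (.e ν) v σ = if σ = col γ ν then v σ else 0 := rfl

theorem repGen_x (t : Fin n) (v : Perm (Fin n) → MvPolynomial (Fin n) k) (σ : Perm (Fin n)) :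
    repGen Q γ (.x t) v σ = MvPolynomial.X (σ t) * v σ := rfl

theorem repGen_τ (l : Fin (n - 1)) (v : Perm (Fin n) → MvPolynomial (Fin n) k)
    (σ : Perm (Fin n)) : repGen Q γ (.τ l) v σ =
      crossing Q γ (σ (hi l)) (σ (lo l)) * v (σ * simpleRefl l) := rfl

theorem monomialAt_repGen (m : Fin n → ℕ) (v : Perm (Fin n) → MvPolynomial (Fin n) k)
    (σ : Perm (Fin n)) : monomialAt (fun t => repGen Q γ (.x t)) m v σ
      = (∏ t, MvPolynomial.X (σ t) ^ m t) * v σ := by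
  have hpow : ∀ (t : Fin n) (j : ℕ) (v : Perm (Fin n) → MvPolynomial (Fin n) k),
      (repGen Q γ (.x t) ^ j) v σ = MvPolynomial.X (σ t) ^ j * v σ := by
    intro t j v
    induction j generalizing v with
    | zero => simp
    | succ j ih => rw [pow_succ, Module.End.mul_apply, ih, repGen_x, pow_succ, mul_assoc]
  have key : ∀ L : List (Fin n), (L.map fun t => repGen Q γ (.x t) ^ m t).prod v σ
      = (L.map fun t => MvPolynomial.X (σ t) ^ m t).prod * v σ := by
    intro L
    induction L with
    | nil => simp
    | cons t L ih =>
      rw [List.map_cons, List.prod_cons, Module.End.mul_apply, hpow, ih, List.map_cons,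
        List.prod_cons, mul_assoc]
  have := key (List.finRange n)
  rwa [← List.ofFn_eq_map, ← List.ofFn_eq_map, List.prod_ofFn] at this

theorem polyAt_repGen (f : MvPolynomial (Fin n) k) (v : Perm (Fin n) → MvPolynomial (Fin n) k)
    (σ : Perm (Fin n)) : polyAt (fun t => repGen Q γ (.x t)) f v σ
      = MvPolynomial.rename σ f * v σ := by
  conv_rhs => rw [f.as_sum]
  rw [polyAt, LinearMap.sum_apply, Finset.sum_apply, map_sum, Finset.sum_mul]
  refine Finset.sum_congr rfl fun m _ => ?_
  rw [LinearMap.smul_apply, Pi.smul_apply, monomialAt_repGen, MvPolynomial.monomial_eq, map_mul,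
    MvPolynomial.rename_C, Finsupp.prod_fintype _ _ (fun _ => pow_zero _),
    map_prod (MvPolynomial.rename (R := k) σ), MvPolynomial.smul_eq_C_mul, mul_assoc]
  simp only [map_pow, MvPolynomial.rename_X]

theorem simpleRefl_lo (l : Fin (n - 1)) : simpleRefl l (lo l) = hi l := swap_apply_left _ _

theorem simpleRefl_hi (l : Fin (n - 1)) : simpleRefl l (hi l) = lo l := swap_apply_right _ _

theorem mul_simpleRefl_mul_simpleRefl (σ : Perm (Fin n)) (l : Fin (n - 1)) :
    σ * simpleRefl l * simpleRefl l = σ := by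
  rw [mul_assoc, simpleRefl_mul_self, mul_one]

theorem mul_simpleRefl_eq_iff {σ : Perm (Fin n)} {ν : Weight n β} {l : Fin (n - 1)} :
    σ * simpleRefl l = col γ ν ↔ σ = col γ (Weight.act (simpleRefl l) ν) := by
  rw [col_act_simpleRefl]
  constructor
  · rintro h
    rw [← h, mul_simpleRefl_mul_simpleRefl]
  · rintro rfl
    rw [mul_simpleRefl_mul_simpleRefl]

/-- In the braid relation both sides cross the same three pairs of colours in the same directions,
so the factors agree. The relations that assume equal colours are vacuous. -/
theorem repGen_rel (hQ : ∀ c d, Alg.qCol Q γ c d = Alg.qCol Q γ d c) {r s : FreeGen k n β}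
    (h : Rel Q n β r s) : FreeAlgebra.lift k (repGen Q γ) r = FreeAlgebra.lift k (repGen Q γ) s := by
  classical
  induction h with
  | e_idem ν =>
    refine LinearMap.ext fun v => funext fun σ => ?_
    simp only [map_mul, FreeAlgebra.lift_ι_apply, Module.End.mul_apply, repGen_e]
    split_ifs <;> rfl
  | e_orth μ ν h =>
    refine LinearMap.ext fun v => funext fun σ => ?_
    simp only [map_mul, FreeAlgebra.lift_ι_apply, Module.End.mul_apply, repGen_e, map_zero]
    split_ifs with h₁ h₂
    · exact absurd (col_injective γ (h₁.symm.trans h₂)) h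
    all_goals rfl
  | e_sum =>
    refine LinearMap.ext fun v => funext fun σ => ?_
    obtain ⟨ν, rfl⟩ := col_surjective γ σ
    simp only [map_sum, FreeAlgebra.lift_ι_apply, LinearMap.sum_apply, Finset.sum_apply, repGen_e,
      map_one, Module.End.one_apply, (col_injective γ).eq_iff]
    simp
  | x_comm s t =>
    refine LinearMap.ext fun v => funext fun σ => ?_
    simp only [map_mul, FreeAlgebra.lift_ι_apply, Module.End.mul_apply, repGen_x]
    ring
  | x_e t ν =>
    refine LinearMap.ext fun v => funext fun σ => ?_
    simp only [map_mul, FreeAlgebra.lift_ι_apply, Module.End.mul_apply, repGen_x, repGen_e]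
    split_ifs <;> simp
  | τ_e l ν =>
    refine LinearMap.ext fun v => funext fun σ => ?_
    simp only [map_mul, FreeAlgebra.lift_ι_apply, Module.End.mul_apply, repGen_τ, repGen_e,
      mul_simpleRefl_eq_iff]
    split_ifs <;> simp
  | τ_comm r s h =>
    refine LinearMap.ext fun v => funext fun σ => ?_
    have h₁ : lo s ≠ lo r := by rw [Ne, Fin.ext_iff]; simp only [lo]; omega
    have h₂ : lo s ≠ hi r := by rw [Ne, Fin.ext_iff]; simp only [lo, hi]; omega
    have h₃ : hi s ≠ lo r := by rw [Ne, Fin.ext_iff]; simp only [lo, hi]; omega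
    have h₄ : hi s ≠ hi r := by rw [Ne, Fin.ext_iff]; simp only [hi]; omega
    have h₅ : simpleRefl r * simpleRefl s = simpleRefl s * simpleRefl r :=
      (Perm.disjoint_iff_disjoint_support.2 (by
        rw [simpleRefl, simpleRefl, Perm.support_swap (lo_ne_hi _), Perm.support_swap (lo_ne_hi _)]
        simp [h₁, h₂, h₃, h₄])).commute
    simp only [map_mul, FreeAlgebra.lift_ι_apply, Module.End.mul_apply, repGen_τ, Perm.mul_apply,
      mul_assoc, h₅]
    simp only [simpleRefl, swap_apply_of_ne_of_ne h₁ h₂, swap_apply_of_ne_of_ne h₃ h₄,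
      swap_apply_of_ne_of_ne h₁.symm h₃.symm, swap_apply_of_ne_of_ne h₂.symm h₄.symm]
    ring
  | τ_sq l ν =>
    refine LinearMap.ext fun v => funext fun σ => ?_
    simp only [map_mul, map_polyAt, FreeAlgebra.lift_ι_apply, Module.End.mul_apply, repGen_τ,
      repGen_e, polyAt_repGen, mul_simpleRefl_mul_simpleRefl, Perm.mul_apply, simpleRefl_lo,
      simpleRefl_hi]
    split_ifs with hσ
    · subst hσ
      rw [Alg.rename_subst₂, ← mul_assoc, mul_comm (crossing Q γ _ _), crossing_mul_crossing γ hQ]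
      exact fun h => lo_ne_hi l ((col γ ν).injective h)
    · simp
  | τ_x_lo l ν h => exact absurd (ν.injective h) (lo_ne_hi l)
  | τ_x_hi l ν h => exact absurd (ν.injective h) (lo_ne_hi l)
  | τ_x_other l t ν h =>
    refine LinearMap.ext fun v => funext fun σ => ?_
    simp only [map_mul, map_sub, map_zero, FreeAlgebra.lift_ι_apply, Module.End.mul_apply, repGen_τ,
      repGen_e, repGen_x, LinearMap.sub_apply, Pi.sub_apply, Perm.mul_apply, LinearMap.zero_apply,
      Pi.zero_apply]
    ring
  | braid_eq r s hrs ν h hν hh =>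
    refine absurd (ν.injective hν) ?_
    rw [Fin.ext_iff]
    simp only [lo, hi]
    omega
  | braid_ne r s hrs ν hν =>
    refine LinearMap.ext fun v => funext fun σ => ?_
    have h₁ : lo s = hi r := Fin.ext hrs
    have h₂ : lo r ≠ hi s := by rw [Ne, Fin.ext_iff]; simp only [lo, hi]; omega
    have h₃ : lo r ≠ hi r := lo_ne_hi r
    have h₄ : hi r ≠ hi s := h₁ ▸ lo_ne_hi s
    have h₅ : simpleRefl s * (simpleRefl r * simpleRefl s)
        = simpleRefl r * (simpleRefl s * simpleRefl r) := by
      rw [← mul_assoc, ← mul_assoc, simpleRefl, simpleRefl, h₁,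
        swap_mul_swap_mul_swap h₃ h₂, swap_comm (lo r), swap_comm (hi r) (hi s),
        swap_mul_swap_mul_swap h₄.symm h₂.symm, swap_comm]
    simp only [map_mul, map_sub, map_zero, FreeAlgebra.lift_ι_apply, Module.End.mul_apply, repGen_τ,
      LinearMap.sub_apply, Pi.sub_apply, Perm.mul_apply, LinearMap.zero_apply, Pi.zero_apply,
      mul_assoc, h₅]
    simp only [simpleRefl, h₁, swap_apply_left, swap_apply_right,
      swap_apply_of_ne_of_ne h₃ h₂, swap_apply_of_ne_of_ne h₂.symm h₄.symm]
    ring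

end Representation

end KLR

namespace KLR

/-! ### Diagonal entries as a trace modulo the relations -/

section Trace

open Equiv

variable {I k : Type*} [CommRing k] {Q : I → I → MvPolynomial (Fin 2) k} {n : ℕ} {β : I →₀ ℕ}
  {a : I → Polynomial k} [IsMultiplicityFree β] {γ : Weight n β}
  (hQ : ∀ c d, Alg.qCol Q γ c d = Alg.qCol Q γ d c)

/-- The representation of `R_β` on the free module with basis the colourings. -/
noncomputable def rep :
    Alg Q n β →ₐ[k] Module.End (MvPolynomial (Fin n) k) (Perm (Fin n) → MvPolynomial (Fin n) k) :=
  RingQuot.liftAlgHom k ⟨FreeAlgebra.lift k (repGen Q γ), fun _ _ h => repGen_rel γ hQ h⟩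

theorem rep_e (ν : Weight n β) : rep hQ (Alg.e Q ν) = repGen Q γ (.e ν) := by
  rw [rep, Alg.e, RingQuot.liftAlgHom_mkAlgHom_apply, FreeAlgebra.lift_ι_apply]

theorem rep_x (t : Fin n) : rep hQ (Alg.x Q t) = repGen Q γ (.x t) := by
  rw [rep, Alg.x, RingQuot.liftAlgHom_mkAlgHom_apply, FreeAlgebra.lift_ι_apply]

theorem rep_τ (l : Fin (n - 1)) : rep hQ (Alg.τ Q l) = repGen Q γ (.τ l) := by
  rw [rep, Alg.τ, RingQuot.liftAlgHom_mkAlgHom_apply, FreeAlgebra.lift_ι_apply]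

theorem rep_ρ (f : MvPolynomial (Fin n) k) (v : Perm (Fin n) → MvPolynomial (Fin n) k) :
    rep hQ (Alg.ρ Q γ f) v = f • v := by
  classical
  induction f using MvPolynomial.induction_on generalizing v with
  | C c =>
    rw [← MvPolynomial.algebraMap_eq, AlgHom.commutes, AlgHom.commutes, algebraMap_smul]
    rfl
  | add f g hf hg => rw [map_add, map_add, LinearMap.add_apply, hf, hg, add_smul]
  | mul_X f c hf =>
    rw [map_mul, map_mul, Module.End.mul_apply, hf, mul_smul, Alg.ρ_X]
    congr 1
    ext1 σ
    obtain ⟨ν, rfl⟩ := col_surjective γ σ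
    rw [Alg.xCol, map_sum, LinearMap.sum_apply, Finset.sum_apply, Finset.sum_eq_single ν]
    · rw [map_mul, Module.End.mul_apply, rep_x, rep_e, repGen_x, repGen_e, if_pos rfl,
        Equiv.apply_symm_apply, Pi.smul_apply, smul_eq_mul]
    · intro μ _ h
      rw [map_mul, Module.End.mul_apply, rep_x, rep_e, repGen_x, repGen_e,
        if_neg fun h' => h (col_injective γ h'.symm), mul_zero]
    · simp

/-- The entries of the matrices of the representation `rep`. -/
noncomputable def entry (r : Alg Q n β) (σ τ : Perm (Fin n)) : MvPolynomial (Fin n) k :=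
  rep hQ r (Pi.single τ 1) σ

open Classical in
theorem entry_e_mul (ν : Weight n β) (r : Alg Q n β) (σ τ : Perm (Fin n)) :
    entry hQ (Alg.e Q ν * r) σ τ = if σ = col γ ν then entry hQ r σ τ else 0 := by
  rw [entry, map_mul, Module.End.mul_apply, rep_e, repGen_e]
  rfl

theorem entry_x_mul (t : Fin n) (r : Alg Q n β) (σ τ : Perm (Fin n)) :
    entry hQ (Alg.x Q t * r) σ τ = MvPolynomial.X (σ t) * entry hQ r σ τ := by
  rw [entry, map_mul, Module.End.mul_apply, rep_x, repGen_x]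
  rfl

theorem entry_τ_mul (l : Fin (n - 1)) (r : Alg Q n β) (σ τ : Perm (Fin n)) :
    entry hQ (Alg.τ Q l * r) σ τ =
      crossing Q γ (σ (hi l)) (σ (lo l)) * entry hQ r (σ * simpleRefl l) τ := by
  rw [entry, map_mul, Module.End.mul_apply, rep_τ, repGen_τ]
  rfl

theorem entry_mul_of_eq {r s : Alg Q n β} {σ τ τ' : Perm (Fin n)} {f : MvPolynomial (Fin n) k}
    (h : rep hQ s (Pi.single τ 1) = Pi.single τ' f) :
    entry hQ (r * s) σ τ = f * entry hQ r σ τ' := by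
  have : (Pi.single τ' f : Perm (Fin n) → MvPolynomial (Fin n) k) = f • Pi.single τ' 1 := by
    rw [← Pi.single_smul, smul_eq_mul, mul_one]
  rw [entry, map_mul, Module.End.mul_apply, h, this, map_smul, Pi.smul_apply, smul_eq_mul]
  rfl

theorem rep_x_single (t : Fin n) (σ : Perm (Fin n)) :
    rep hQ (Alg.x Q t) (Pi.single σ 1) = Pi.single σ (MvPolynomial.X (σ t)) := by
  ext1 τ
  rw [rep_x, repGen_x]
  by_cases h : τ = σ
  · subst h; simp
  · simp [h]

open Classical in
theorem rep_e_single (ν : Weight n β) (σ : Perm (Fin n)) :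
    rep hQ (Alg.e Q ν) (Pi.single σ 1) = Pi.single σ (if σ = col γ ν then 1 else 0) := by
  ext1 τ
  rw [rep_e, repGen_e]
  by_cases h : τ = σ
  · subst h; simp
  · simp [h]

theorem rep_τ_single (l : Fin (n - 1)) (σ : Perm (Fin n)) :
    rep hQ (Alg.τ Q l) (Pi.single σ 1)
      = Pi.single (σ * simpleRefl l) (crossing Q γ (σ (lo l)) (σ (hi l))) := by
  ext1 τ
  rw [rep_τ, repGen_τ]
  by_cases h : τ = σ * simpleRefl l
  · subst h
    rw [mul_simpleRefl_mul_simpleRefl, Pi.single_eq_same, Pi.single_eq_same, mul_one,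
      Perm.mul_apply, Perm.mul_apply, simpleRefl_lo, simpleRefl_hi]
  · have h' : τ * simpleRefl l ≠ σ := by
      rintro rfl
      exact h (mul_simpleRefl_mul_simpleRefl _ _).symm
    rw [Pi.single_eq_of_ne h, Pi.single_eq_of_ne h', mul_zero]

theorem simpleRefl_lt_simpleRefl {l : Fin (n - 1)} {s t : Fin n} (hst : s < t)
    (h : ¬ (s = lo l ∧ t = hi l)) : simpleRefl l s < simpleRefl l t := by
  rw [simpleRefl, swap_apply_def, swap_apply_def]
  simp only [Fin.ext_iff, Fin.lt_def, lo, hi] at *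
  split_ifs <;> (try simp only) <;> omega

theorem mul_simpleRefl_symm_apply (σ : Perm (Fin n)) (l : Fin (n - 1)) (c : Fin n) :
    (σ * simpleRefl l).symm c = simpleRefl l (σ.symm c) := by
  rw [symm_apply_eq, Perm.mul_apply, ← Perm.mul_apply (simpleRefl l), simpleRefl_mul_self,
    Perm.one_apply, apply_symm_apply]

/-- The entry at `(σ, τ)` is divisible by `Q_{cd}` if `τ` and `σ` order the colours `c < d`
increasingly and decreasingly, respectively. -/
theorem qCol_dvd_entry (r : Alg Q n β) {c d : Fin n} (hcd : c < d) {σ τ : Perm (Fin n)}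
    (hτ : τ.symm c < τ.symm d) (hσ : σ.symm d < σ.symm c) :
    Alg.qCol Q γ c d ∣ entry hQ r σ τ := by
  -- Left multiplication by `r` is shown to preserve divisibility at all `σ` with `d` before `c`.
  -- For a generator `τ_l` this order persists unless `l` exchanges exactly these two colours, and
  -- then the crossing factor itself is the `Q` in question.
  have key : ∀ r s : Alg Q n β, (∀ σ : Perm (Fin n), σ.symm d < σ.symm c →
      Alg.qCol Q γ c d ∣ entry hQ s σ τ) → ∀ σ : Perm (Fin n), σ.symm d < σ.symm c →
      Alg.qCol Q γ c d ∣ entry hQ (r * s) σ τ := by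
    classical
    intro r
    induction r using Alg.induction_on with
    | he ν =>
      intro s hs σ hσ
      rw [entry_e_mul]
      split_ifs
      exacts [hs σ hσ, dvd_zero _]
    | hx t =>
      intro s hs σ hσ
      rw [entry_x_mul]
      exact (hs σ hσ).mul_left _
    | hτ l =>
      intro s hs σ hσ
      rw [entry_τ_mul]
      by_cases h : σ.symm d = lo l ∧ σ.symm c = hi l
      · rw [← h.1, ← h.2, apply_symm_apply, apply_symm_apply, crossing, if_pos hcd]
        exact dvd_mul_right _ _
      · refine (hs _ ?_).mul_left _
        rw [mul_simpleRefl_symm_apply, mul_simpleRefl_symm_apply]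
        exact simpleRefl_lt_simpleRefl hσ h
    | hc b =>
      intro s hs σ hσ
      rw [← Algebra.smul_def, entry, map_smul]
      exact (hs σ hσ).trans ⟨MvPolynomial.C b, by
        rw [LinearMap.smul_apply, Pi.smul_apply, MvPolynomial.smul_eq_C_mul, mul_comm]; rfl⟩
    | hadd r r' hr hr' =>
      intro s hs σ hσ
      have : entry hQ ((r + r') * s) σ τ = entry hQ (r * s) σ τ + entry hQ (r' * s) σ τ := by
        rw [entry, add_mul, map_add]; rfl
      rw [this]
      exact dvd_add (hr s hs σ hσ) (hr' s hs σ hσ)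
    | hmul r r' hr hr' =>
      intro s hs σ hσ
      rw [mul_assoc]
      exact hr _ (hr' _ hs) σ hσ
  rw [← mul_one r]
  refine key r 1 (fun σ hσ => ?_) σ hσ
  have hne : σ ≠ τ := by
    rintro rfl
    exact hτ.not_gt hσ
  rw [entry, map_one, Module.End.one_apply, Pi.single_eq_of_ne hne]
  exact dvd_zero _

/-- The vector of the diagonal entries. -/
noncomputable def diagonal : Alg Q n β →ₗ[k] (Perm (Fin n) → MvPolynomial (Fin n) k) where
  toFun r σ := entry hQ r σ σ
  map_add' r s := by
    ext1 σ
    simp only [entry, map_add]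
    rfl
  map_smul' c r := by
    ext1 σ
    simp only [entry, map_smul]
    rfl

theorem diagonal_apply (r : Alg Q n β) (σ : Perm (Fin n)) : diagonal hQ r σ = entry hQ r σ σ := rfl

theorem diagonal_ρ_mul_e (f : MvPolynomial (Fin n) k) (ν : Weight n β) :
    diagonal hQ (Alg.ρ Q γ f * Alg.e Q ν) = Pi.single (col γ ν) f := by
  classical
  ext1 σ
  rw [diagonal_apply, entry_mul_of_eq hQ (rep_e_single hQ ν σ), entry, rep_ρ]
  by_cases h : σ = col γ ν
  · subst h; simp
  · simp [h]

/-- The diagonal is a trace modulo the relations of the cocenter. -/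
theorem diagonal_mul_sub_mem (a : I → Polynomial k) (r s : Alg Q n β) :
    diagonal hQ (r * s) - diagonal hQ (s * r) ∈ cocenterRel (qWord Q a γ) := by
  classical
  induction s using Alg.induction_on generalizing r with
  | he ν =>
    have : diagonal hQ (r * Alg.e Q ν) = diagonal hQ (Alg.e Q ν * r) := by
      ext1 σ
      rw [diagonal_apply, diagonal_apply, entry_mul_of_eq hQ (rep_e_single hQ ν σ), entry_e_mul]
      simp
    rw [this, sub_self]
    exact Submodule.zero_mem _
  | hx t =>
    have : diagonal hQ (r * Alg.x Q t) = diagonal hQ (Alg.x Q t * r) := by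
      ext1 σ
      rw [diagonal_apply, diagonal_apply, entry_mul_of_eq hQ (rep_x_single hQ t σ), entry_x_mul]
    rw [this, sub_self]
    exact Submodule.zero_mem _
  | hτ l =>
    set E : Perm (Fin n) → MvPolynomial (Fin n) k := fun σ =>
      crossing Q γ (σ (lo l)) (σ (hi l)) * entry hQ r σ (σ * simpleRefl l) with hE
    have h₁ : diagonal hQ (r * Alg.τ Q l) = ∑ σ, Pi.single σ (E σ) := by
      rw [Finset.univ_sum_single]
      ext1 σ
      rw [diagonal_apply, entry_mul_of_eq hQ (rep_τ_single hQ l σ)]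
    have h₂ : diagonal hQ (Alg.τ Q l * r) = ∑ σ, Pi.single (σ * simpleRefl l) (E σ) := by
      rw [← Equiv.sum_comp (Equiv.mulRight (simpleRefl l))]
      simp only [Equiv.coe_mulRight, mul_simpleRefl_mul_simpleRefl]
      rw [Finset.univ_sum_single (fun σ => E (σ * simpleRefl l))]
      ext1 σ
      rw [diagonal_apply, entry_τ_mul, hE]
      simp only [Perm.mul_apply, simpleRefl_lo, simpleRefl_hi, mul_simpleRefl_mul_simpleRefl]
    rw [h₁, h₂, ← Finset.sum_sub_distrib]
    refine Submodule.sum_mem _ fun σ _ => single_sub_single_mem_moveRel (qWord_symm γ hQ) σ l _ ?_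
    rw [qWord_coe_coe]
    have hne : σ (lo l) ≠ σ (hi l) := fun h => lo_ne_hi l (σ.injective h)
    have hlt : lo l < hi l := by rw [Fin.lt_def]; simp only [lo, hi]; omega
    -- Either the crossing factor in `E σ` is the required `Q`, or it is `1` and the entry of `r`
    -- reverses the two colours in the direction covered by `qCol_dvd_entry`.
    rcases lt_or_gt_of_ne hne with h | h
    · rw [hE]
      simp only [crossing, if_pos h]
      exact dvd_mul_right _ _
    · rw [hQ]
      refine (qCol_dvd_entry hQ r h ?_ ?_).mul_left _
      · rw [mul_simpleRefl_symm_apply, mul_simpleRefl_symm_apply, symm_apply_apply,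
          symm_apply_apply, simpleRefl_lo, simpleRefl_hi]
        exact hlt
      · rw [symm_apply_apply, symm_apply_apply]
        exact hlt
  | hc c =>
    rw [Algebra.commutes, sub_self]
    exact Submodule.zero_mem _
  | hadd s s' hs hs' =>
    rw [mul_add, add_mul, map_add, map_add, add_sub_add_comm]
    exact Submodule.add_mem _ (hs r) (hs' r)
  | hmul s s' hs hs' =>
    -- The factors `s'` and `s` are rotated to the front one after the other.
    have h := Submodule.add_mem _ (hs' (r * s)) (hs (s' * r))
    have : diagonal hQ (r * (s * s')) - diagonal hQ (s * s' * r)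
        = diagonal hQ (r * s * s') - diagonal hQ (s' * (r * s))
          + (diagonal hQ (s' * r * s) - diagonal hQ (s * (s' * r))) := by
      simp only [mul_assoc]
      abel
    rwa [this]

theorem diagonal_mem_of_mem_commutators (a : I → Polynomial k) {r : Alg Q n β}
    (hr : r ∈ commutators k (Alg Q n β)) : diagonal hQ r ∈ cocenterRel (qWord Q a γ) := by
  induction hr using Submodule.span_induction with
  | mem x hx =>
    obtain ⟨r, s, rfl⟩ := hx
    rw [map_sub]
    exact diagonal_mul_sub_mem hQ a r s
  | zero => rw [map_zero]; exact Submodule.zero_mem _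
  | add x y _ _ hx hy => rw [map_add]; exact Submodule.add_mem _ hx hy
  | smul c x _ hx =>
    rw [map_smul]
    exact Submodule.smul_mem ((cocenterRel (qWord Q a γ)).restrictScalars k) c hx

theorem rep_cyc_single (a : I → Polynomial k) (t : Fin n) (σ : Perm (Fin n)) :
    rep hQ (Alg.cyc Q a t) (Pi.single σ 1) = Pi.single σ (qWord Q a γ (σ t) ⊥) := by
  classical
  obtain ⟨ν, rfl⟩ := col_surjective γ σ
  have h : rep hQ (Alg.e Q ν) (Pi.single (col γ ν) 1) = Pi.single (col γ ν) 1 := by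
    rw [rep_e_single, if_pos rfl]
  rw [← h, ← Module.End.mul_apply, ← map_mul, cyc_mul_e γ, map_mul, Module.End.mul_apply, h, rep_ρ,
    ← Pi.single_smul, smul_eq_mul, mul_one]

/-- An arbitrary left multiplier is carried through the induction: right factors are rotated to the
left by the trace property, and on the generator each diagonal entry is a multiple of `a_c(X_c)` for
the first colour `c`. -/
theorem diagonal_mem_of_mem_cycIdeal {r : Alg Q n β} (hr : r ∈ cycIdeal Q n β a) :
    diagonal hQ r ∈ cocenterRel (qWord Q a γ) := by
  have key : ∀ z ∈ cycIdeal Q n β a, ∀ s, diagonal hQ (s * z) ∈ cocenterRel (qWord Q a γ) := by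
    intro z hz
    induction hz using TwoSidedIdeal.span_induction with
    | mem x hx =>
      obtain ⟨t, ht, rfl⟩ := hx
      intro s
      have : diagonal hQ (s * Alg.cyc Q a t)
          = ∑ σ, Pi.single σ (qWord Q a γ (σ t) ⊥ * entry hQ s σ σ) := by
        rw [Finset.univ_sum_single]
        ext1 σ
        rw [diagonal_apply, entry_mul_of_eq hQ (rep_cyc_single hQ a t σ)]
      rw [this]
      exact Submodule.sum_mem _ fun σ _ => single_mem_moveRel σ t ht _ (dvd_mul_right _ _)
    | zero => intro s; rw [mul_zero, map_zero]; exact Submodule.zero_mem _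
    | add x y _ _ hx hy => intro s; rw [mul_add, map_add]; exact Submodule.add_mem _ (hx s) (hy s)
    | neg x _ hx =>
      intro s
      rw [show s * -x = -(s * x) from mul_neg s x, map_neg]
      exact Submodule.neg_mem _ (hx s)
    | left_absorb b x _ hx => intro s; rw [← mul_assoc]; exact hx _
    | right_absorb b x _ hx =>
      intro s
      rw [← mul_assoc]
      have h := Submodule.add_mem _ (diagonal_mul_sub_mem hQ a (s * x) b) (hx (b * s))
      rwa [mul_assoc b, sub_add_cancel] at h
  have := key r hr 1
  rwa [one_mul] at this

/-- The vectors representing zero in the cocenter are the relations. -/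
theorem diagonal_mem_of_toCocenter_eq_zero {r : Alg Q n β} (hr : toCocenter Q n β a r = 0) :
    diagonal hQ r ∈ cocenterRel (qWord Q a γ) := by
  obtain ⟨s, hs, hrs⟩ := exists_of_toCocenter_eq_zero hr
  have := Submodule.add_mem _ (diagonal_mem_of_mem_cycIdeal hQ hrs)
    (diagonal_mem_of_mem_commutators hQ a hs)
  rwa [← map_add, sub_add_cancel] at this

end Trace

end KLR

namespace KLR

/-! ### Degrees: leading terms over a graded field -/

section GradedField

variable {k : Type*} [Field k] {𝒜 : ℕ → AddSubgroup k} [GradedRing 𝒜]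

/-- If `m` were positive, `x * x⁻¹` would have no component in degree `0`, although it equals `1`.
-/
theorem eq_zero_of_mem_graded {m : ℕ} {x : k} (hx : x ∈ 𝒜 m) (hx0 : x ≠ 0) : m = 0 := by
  by_contra hm
  have h₁ := DirectSum.coe_decompose_mul_of_left_mem_of_not_le 𝒜 (b := x⁻¹) (n := 0) hx (by omega)
  rw [mul_inv_cancel₀ hx0, DirectSum.decompose_of_mem_same 𝒜 (SetLike.GradedOne.one_mem)] at h₁
  exact one_ne_zero h₁

theorem eq_zero_of_mem_gradedPiece {m : ℤ} {x : k} (hx : x ∈ gradedPiece 𝒜 m) (hx0 : x ≠ 0) :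
    m = 0 := by
  rw [gradedPiece] at hx
  split_ifs at hx with hm
  · have := eq_zero_of_mem_graded hx hx0
    omega
  · exact absurd (AddSubgroup.mem_bot.1 hx) hx0

end GradedField

section Degrees

open MvPolynomial

variable {I P : Type*} [AddCommGroup P] [Module.Free ℤ P] [Module.Finite ℤ P]
  {D : CartanDatum I P} {k : Type*} [Field k] {𝒜 : ℕ → AddSubgroup k}
  {Q : I → I → MvPolynomial (Fin 2) k} {n : ℕ} {β : I →₀ ℕ}

theorem IsQMatrix.qCol_symm (hQ : IsQMatrix D 𝒜 Q) (γ : Weight n β) (c d : Fin n) :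
    Alg.qCol Q γ c d = Alg.qCol Q γ d c := by
  rw [Alg.qCol, Alg.qCol, hQ.symm (γ c) (γ d), subst₂, subst₂, aeval_rename]
  congr 2
  ext j
  fin_cases j <;> simp

theorem coeff₂_eq (f : MvPolynomial (Fin 2) k) (m : Fin 2 →₀ ℕ) :
    coeff₂ f (m 0) (m 1) = f.coeff m := by
  rw [coeff₂]
  congr 1
  ext j
  fin_cases j <;> simp

variable [GradedRing 𝒜]

/-- Since the ground field is concentrated in degree zero, `Q_{ij}(u, v)` has the single term
`u ^ (-a_{ij})` of degree at least `-a_{ij}` in `u`. -/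
theorem IsQMatrix.lt_of_mem_support (hQ : IsQMatrix D 𝒜 Q) {i j : I} (hij : i ≠ j)
    {m : Fin 2 →₀ ℕ} (hm : m ∈ (Q i j).support) (hne : m ≠ Finsupp.single 0 (-D.A i j).toNat) :
    m 0 < (-D.A i j).toNat := by
  have h := hQ.homogeneous i j hij (m 0) (m 1)
  rw [coeff₂_eq] at h
  have h₁ := eq_zero_of_mem_gradedPiece h (mem_support_iff.1 hm)
  simp only [CartanDatum.form, D.A_diag] at h₁
  have hA := D.A_nonpos i j hij
  have hdi : (0 : ℤ) < D.d i := by exact_mod_cast D.d_pos i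
  have hdj : (0 : ℤ) < D.d j := by exact_mod_cast D.d_pos j
  -- Half of the statement that the coefficient has degree zero. As the right side is nonnegative,
  -- `m 0` is at most `-a_{ij}`, with equality only for `m 1 = 0`.
  have h₂ : (D.d i : ℤ) * (-D.A i j - m 0) = D.d j * m 1 := by linarith
  have h₃ : (0 : ℤ) ≤ D.d j * m 1 := by positivity
  have h₄ : (0 : ℤ) ≤ -D.A i j - m 0 := by
    by_contra hlt
    push Not at hlt
    have := mul_neg_of_pos_of_neg hdi hlt
    omega
  by_contra hge
  have h₅ : (-D.A i j - m 0 : ℤ) = 0 := by omega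
  rw [h₅, mul_zero] at h₂
  have h₆ : m 1 = 0 := by
    rcases mul_eq_zero.1 h₂.symm with h | h
    · omega
    · exact_mod_cast h
  refine hne (Finsupp.ext fun l => ?_)
  fin_cases l
  · simp only [Fin.zero_eta, Finsupp.single_eq_same]
    omega
  · simpa using h₆

theorem support_finset_sum_lt {σ ι : Type*} {i : σ} {b : ℕ} (s : Finset ι)
    (f : ι → MvPolynomial σ k) (h : ∀ x ∈ s, ∀ m ∈ (f x).support, m i < b) :
    ∀ m ∈ (∑ x ∈ s, f x).support, m i < b := by
  classical
  intro m hm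
  obtain ⟨x, hx, hmx⟩ := Finset.mem_biUnion.1 (MvPolynomial.support_sum hm)
  exact h x hx m hmx

theorem subst₂_monomial {c d : Fin n} (m : Fin 2 →₀ ℕ) (u : k) :
    subst₂ (monomial m u) c d = monomial (Finsupp.single c (m 0) + Finsupp.single d (m 1)) u := by
  rw [subst₂, aeval_monomial, Finsupp.prod_fintype _ _ fun _ => pow_zero _, Fin.prod_univ_two,
    ← mul_one u, ← one_mul (1 : k), ← monomial_mul, algebraMap_eq]
  simp [X_pow_eq_monomial, C_mul_monomial, monomial_mul]

theorem IsQMatrix.monicIn_qCol [IsMultiplicityFree β] (hQ : IsQMatrix D 𝒜 Q) (γ : Weight n β)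
    {c d : Fin n} (hcd : c ≠ d) :
    MonicIn c (-D.A (γ c) (γ d)).toNat (Alg.qCol Q γ c d) := by
  classical
  have hij : γ c ≠ γ d := fun h => hcd (γ.injective h)
  set f := Q (γ c) (γ d) with hf
  set b := (-D.A (γ c) (γ d)).toNat with hb
  have hunit : IsUnit (f.coeff (Finsupp.single 0 b)) := by
    have := hQ.isUnit_coeff _ _ hij
    rwa [coeff₂, Finsupp.single_zero, add_zero] at this
  have hmem : Finsupp.single 0 b ∈ f.support := mem_support_iff.2 hunit.ne_zero
  obtain ⟨u, hu⟩ := hunit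
  refine ⟨u, ∑ m ∈ f.support.erase (Finsupp.single 0 b), subst₂ (monomial m (f.coeff m)) c d,
    support_finset_sum_lt _ _ ?_, ?_⟩
  · intro e he m hm
    rw [Finset.mem_erase] at he
    rw [subst₂_monomial] at hm
    rw [Finset.mem_singleton.1 (support_monomial_subset hm)]
    have := hQ.lt_of_mem_support hij he.2 he.1
    rw [Finsupp.add_apply, Finsupp.single_eq_same, Finsupp.single_eq_of_ne hcd, add_zero]
    exact this
  · have : Alg.qCol Q γ c d = ∑ m ∈ f.support, subst₂ (monomial m (f.coeff m)) c d := by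
      rw [Alg.qCol, ← hf]
      conv_lhs => rw [f.as_sum]
      rw [subst₂, map_sum]
      rfl
    rw [this, ← Finset.add_sum_erase _ _ hmem, subst₂_monomial, ← hu, X_pow_eq_monomial,
      C_mul_monomial]
    simp

theorem monicIn_aeval {p : Polynomial k} (hp : p.Monic) (c : Fin n) :
    MonicIn c p.natDegree (Polynomial.aeval (X c : MvPolynomial (Fin n) k) p) := by
  classical
  refine ⟨1, ∑ j ∈ Finset.range p.natDegree, p.coeff j • X c ^ j, support_finset_sum_lt _ _ ?_, ?_⟩
  · intro j hj m hm
    rw [smul_eq_C_mul] at hm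
    exact (support_C_mul_X_pow_le c _ j m hm).trans_lt (Finset.mem_range.1 hj)
  · rw [Polynomial.aeval_eq_sum_range, Finset.sum_range_succ, add_comm, hp.coeff_natDegree]
    simp

variable {a : I → Polynomial k} {Λ : P}

/-- The degrees of the polynomials `qWord`. -/
def degWord (D : CartanDatum I P) (a : I → Polynomial k) (γ : Weight n β) (c : Fin n)
    (d : WithBot (Fin n)) : ℕ :=
  d.recBotCoe (a (γ c)).natDegree fun d => (-D.A (γ c) (γ d)).toNat

theorem degWord_bot (γ : Weight n β) (c : Fin n) : degWord D a γ c ⊥ = (a (γ c)).natDegree := rfl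

theorem degWord_coe (γ : Weight n β) (c d : Fin n) :
    degWord D a γ c d = (-D.A (γ c) (γ d)).toNat := rfl

theorem isMonicSystem [IsMultiplicityFree β] (hQ : IsQMatrix D 𝒜 Q) (ha : ∀ i, (a i).Monic)
    (γ : Weight n β) : IsMonicSystem (qWord Q a γ) (degWord D a γ) where
  symm := qWord_symm γ (hQ.qCol_symm γ)
  monic c d hd := by
    induction d using WithBot.recBotCoe with
    | bot => exact monicIn_aeval (ha _) c
    | coe d => exact hQ.monicIn_qCol γ fun h => hd (by rw [h])
  mem_supported c d := by
    have hX : ∀ {e : Fin n} {Z : Set (Fin n)}, e ∈ Z → (X e : MvPolynomial (Fin n) k) ∈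
      supported k Z := fun h => Algebra.subset_adjoin ⟨_, h, rfl⟩
    have ha : ∀ (e : Fin n) (p : Polynomial k) (Z : Set (Fin n)), e ∈ Z →
        Polynomial.aeval (X e : MvPolynomial (Fin n) k) p ∈ supported k Z := fun e p Z he => by
      rw [Polynomial.aeval_eq_sum_range]
      exact Subalgebra.sum_mem _ fun j _ => Subalgebra.smul_mem _
        (Subalgebra.pow_mem _ (hX he) _) _
    induction c using WithBot.recBotCoe with
    | bot =>
      induction d using WithBot.recBotCoe with
      | bot => exact Subalgebra.zero_mem _
      | coe d => exact ha _ _ _ (Or.inr rfl)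
    | coe c =>
      induction d using WithBot.recBotCoe with
      | bot => exact ha _ _ _ (Or.inl rfl)
      | coe d =>
        rw [qWord_coe_coe, Alg.qCol, subst₂, aeval_def, eval₂_eq]
        refine Subalgebra.sum_mem _ fun m _ => Subalgebra.mul_mem _
          (Subalgebra.algebraMap_mem _ _) (Subalgebra.prod_mem _ fun j _ =>
            Subalgebra.pow_mem _ ?_ _)
        fin_cases j
        exacts [hX (Or.inl rfl), hX (Or.inr rfl)]

end Degrees

/-! ### Degrees of the moves and the exponent bounds -/

section Bounds

open Equiv

variable {n : ℕ}

theorem sum_map_of_ofFn_eq {α : Type*} (f : Fin n → α) (g : α → ℕ) (L M R : List α)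
    (h : List.ofFn f = L ++ (M ++ R)) : (M.map g).sum =
      ∑ l ∈ Finset.univ.filter (fun l : Fin n =>
        L.length ≤ (l : ℕ) ∧ (l : ℕ) < L.length + M.length), g (f l) := by
  induction M generalizing L with
  | nil =>
    rw [Finset.sum_eq_zero]
    · simp
    · intro l hl
      rw [Finset.mem_filter, List.length_nil] at hl
      omega
  | cons x M ih =>
    have h' : List.ofFn f = (L ++ [x]) ++ (M ++ R) := by simpa using h
    rw [List.map_cons, List.sum_cons, ih _ h']
    have hlen := congrArg List.length h
    simp only [List.length_ofFn, List.length_append, List.length_cons] at hlen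
    have hx : f ⟨L.length, by omega⟩ = x := by
      have h₁ : (List.ofFn f)[L.length]? = some x := by rw [h]; simp
      rw [List.getElem?_ofFn, dif_pos (by omega), Option.some_inj] at h₁
      exact h₁
    rw [← hx, ← Finset.sum_insert (f := fun l => g (f l))]
    · congr 1
      ext l
      simp only [Finset.mem_insert, Finset.mem_filter, Finset.mem_univ, true_and, Fin.ext_iff,
        List.length_append, List.length_cons, List.length_nil]
      omega
    · simp

variable {I P : Type*} [AddCommGroup P] [Module.Free ℤ P] [Module.Finite ℤ P]
  {D : CartanDatum I P} {k : Type*} [Field k] {β : I →₀ ℕ} [IsMultiplicityFree β]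
  {a : I → Polynomial k} {Λ : P} {γ : Weight n β}

theorem ltOf_iff (ν : Weight n β) (s t : Fin n) : ltOf γ (ν s) (ν t) ↔ col γ ν s < col γ ν t := by
  constructor
  · rintro ⟨c, d, hcd, h₁, h₂⟩
    rwa [(col_eq_iff γ).2 h₁.symm, (col_eq_iff γ).2 h₂.symm]
  · exact fun h => ⟨_, _, h, apply_col γ ν s, apply_col γ ν t⟩

/-- The degrees of the relations of the moves are the exponent bounds in `T_γ^Λ`. -/
theorem bnd_eq_bound (ha : ∀ i, ((a i).natDegree : ℤ) = D.coroot i Λ) (ν : Weight n β)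
    (t : Fin n) : (bnd (degWord D a γ) (col γ ν) t : ℤ) = bound D Λ γ ν t := by
  classical
  have hdeg : ∀ l : Fin n, l ≠ t →
      ((degWord D a γ (col γ ν t) (col γ ν l) : ℕ) : ℤ) = -D.A (ν t) (ν l) := fun l hl => by
    rw [degWord_coe, apply_col, apply_col]
    have := D.A_nonpos (ν t) (ν l) fun h => hl (ν.injective h).symm
    omega
  have hm := move_word (col γ ν) t
  rw [bnd]
  generalize passed (col γ ν) t = F at hm
  generalize moved (col γ ν) t = w' at hm
  generalize hw : word (col γ ν) = w at hm
  generalize hc : (col γ ν t : WithBot (Fin n)) = c at hm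
  have hpos : ∀ X R : List (WithBot (Fin n)), List.ofFn (fun t => (col γ ν t : WithBot (Fin n)))
      = X ++ c :: R → X.length = t := fun X R h => by
    have hlen := congrArg List.length h
    simp only [List.length_ofFn, List.length_append, List.length_cons] at hlen
    have h₁ : (List.ofFn fun t => (col γ ν t : WithBot (Fin n)))[X.length]? = some c := by
      rw [h]; simp
    rw [List.getElem?_ofFn, dif_pos (by omega), Option.some_inj, ← hc, WithBot.coe_inj] at h₁
    exact congrArg Fin.val ((col γ ν).injective h₁)
  obtain ⟨L, p, B, c, R, hp, hB⟩ := hm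
  rw [bound]
  rcases L with _ | ⟨x, L⟩
  -- The smaller letter passed is `⊥`: no smaller colour precedes place `t`, so `k_{ν,t} = 0`, and
  -- `⊥` contributes the degree of `a_i^Λ`.
  · simp only [word, List.nil_append, List.cons.injEq] at hw
    obtain ⟨rfl, hw⟩ := hw
    have ht := hpos _ _ hw
    have hlt : ∀ l < t, ¬ col γ ν l < col γ ν t := fun l hl h => by
      have h₁ : (List.ofFn fun t => (col γ ν t : WithBot (Fin n)))[(l : ℕ)]? = B[(l : ℕ)]? := by
        rw [hw, List.getElem?_append_left (by omega)]
      rw [List.getElem?_ofFn, dif_pos l.2] at h₁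
      have := hB _ (List.mem_of_getElem? h₁.symm)
      rw [← hc, WithBot.coe_lt_coe] at this
      exact h.not_gt this
    have hk : kIdx γ ν t = 0 := by
      rw [kIdx, Finset.filter_eq_empty_iff.2, Finset.sup_empty]
      · rfl
      · rintro l - ⟨h₁, h₂⟩
        exact hlt l h₁ ((ltOf_iff ν l t).1 h₂)
    rw [hk, if_pos rfl, List.map_cons, List.sum_cons, degWord_bot, apply_col, Nat.cast_add, ha,
      add_comm]
    congr 1
    rw [sum_map_of_ofFn_eq _ _ [] B (c :: R) hw, Nat.cast_sum, ← Finset.sum_neg_distrib]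
    refine Finset.sum_congr ?_ fun l hl => ?_
    · ext l
      simp only [Finset.mem_filter, Finset.mem_univ, true_and, List.length_nil, Fin.lt_def]
      omega
    · exact hdeg l (Finset.mem_filter.1 hl).2.2.ne
  -- Once the initial `⊥` is removed, `p` stands at the place `L.length` counted from `0`, hence
  -- `k_{ν,t} = L.length + 1` in the numbering from `1`.
  · simp only [word, List.cons_append, List.cons.injEq] at hw
    obtain ⟨rfl, hw⟩ := hw
    have ht := hpos (L ++ p :: B) R (by simpa using hw)
    simp only [List.length_append, List.length_cons] at ht
    have hget : ∀ l : Fin n, (L ++ p :: (B ++ c :: R))[(l : ℕ)]? =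
        some (col γ ν l : WithBot (Fin n)) := fun l => by
      rw [← hw, List.getElem?_ofFn, dif_pos l.2]
    have hj : L.length < n := by omega
    have hpj : (col γ ν ⟨L.length, hj⟩ : WithBot (Fin n)) = p := by
      have := hget ⟨L.length, hj⟩
      simpa using this.symm
    have hlt : ∀ l < t, col γ ν l < col γ ν t → (l : ℕ) ≤ L.length := fun l hl h => by
      by_contra hgt
      push Not at hgt
      obtain ⟨i, hi⟩ : ∃ i, (l : ℕ) = L.length + 1 + i := ⟨l - (L.length + 1), by omega⟩
      have h₁ := hget l
      rw [List.getElem?_append_right (by omega), show (l : ℕ) - L.length = i + 1 by omega,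
        List.getElem?_cons_succ, List.getElem?_append_left (by omega)] at h₁
      have := hB _ (List.mem_of_getElem? h₁)
      rw [← hc, WithBot.coe_lt_coe] at this
      exact h.not_gt this
    have hk : kIdx γ ν t = L.length + 1 := by
      rw [kIdx]
      refine le_antisymm (Finset.sup_le fun l hl => ?_) ?_
      · rw [Finset.mem_filter] at hl
        have := hlt l hl.2.1 ((ltOf_iff ν l t).1 hl.2.2)
        omega
      · refine Finset.le_sup (f := fun p : Fin n => (p : ℕ) + 1) (b := ⟨L.length, hj⟩) ?_
        rw [Finset.mem_filter]
        refine ⟨Finset.mem_univ _, by rw [Fin.lt_def]; simp only; omega, (ltOf_iff ν _ t).2 ?_⟩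
        rw [← WithBot.coe_lt_coe, hpj, hc]
        exact hp
    rw [hk, if_neg (by omega), add_zero,
      sum_map_of_ofFn_eq _ _ L (p :: B) (c :: R) (by simpa using hw), Nat.cast_sum,
      ← Finset.sum_neg_distrib]
    refine Finset.sum_congr ?_ fun l hl => ?_
    · ext l
      simp only [Finset.mem_filter, Finset.mem_univ, true_and, List.length_cons, Fin.lt_def]
      omega
    · exact hdeg l (Finset.mem_filter.1 hl).2.2.ne

end Bounds

end KLR

namespace KLR

/-! ### The basis of the cocenter -/

section Basis

open Equiv MvPolynomial

variable {I P : Type*} [AddCommGroup P] [Module.Free ℤ P] [Module.Finite ℤ P]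
  {D : CartanDatum I P} {k : Type*} [Field k] {Q : I → I → MvPolynomial (Fin 2) k} {n : ℕ}
  {β : I →₀ ℕ} [IsMultiplicityFree β] {a : I → Polynomial k} {Λ : P} {γ : Weight n β}

/-- The exponent of the monomial `x ^ a * e(ν)` in the colour variables. -/
noncomputable def colExponent (γ ν : Weight n β) (m : Fin n → ℕ) : Fin n →₀ ℕ :=
  Finsupp.equivFunOnFinite.symm (m ∘ (col γ ν).symm)

theorem colExponent_col (ν : Weight n β) (m : Fin n → ℕ) (t : Fin n) :
    colExponent γ ν m (col γ ν t) = m t := by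
  simp [colExponent]

theorem xe_eq (γ ν : Weight n β) (m : Fin n → ℕ) :
    Alg.xe Q m ν = Alg.ρ Q γ (monomial (colExponent γ ν m) 1) * Alg.e Q ν := by
  rw [Alg.xe, Alg.monomialAt_mul_e γ, monomial_eq, C_1, one_mul,
    Finsupp.prod_fintype _ _ fun _ => pow_zero _]
  congr 2
  exact Fintype.prod_equiv (col γ ν) _ _ fun t => by rw [colExponent_col]

theorem linearIndependent_single_colExponent :
    LinearIndependent k fun i : TIndex D Λ γ =>
      (Pi.single (col γ i.1.1) (monomial (colExponent γ i.1.1 i.1.2) 1) :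
        Perm (Fin n) → MvPolynomial (Fin n) k) := by
  have h := (Pi.basis fun _ : Perm (Fin n) => basisMonomials (Fin n) k).linearIndependent.comp
    (fun i : TIndex D Λ γ => ⟨col γ i.1.1, colExponent γ i.1.1 i.1.2⟩) fun i j hij => by
      rw [Sigma.mk.injEq] at hij
      have h₁ := col_injective γ hij.1
      have h₂ := eq_of_heq hij.2
      refine Subtype.ext (Prod.ext h₁ (funext fun t => ?_))
      rw [← colExponent_col (γ := γ) i.1.1 i.1.2 t, h₂, h₁, colExponent_col]
  simpa only [Function.comp_def, Pi.basis_apply, coe_basisMonomials] using h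

/-- `diagonal` sends a combination that vanishes in the cocenter to a relation with reduced
components, hence to zero, while it keeps the monomials distinct. -/
theorem linearIndependent_toCocenter_xe {𝒜 : ℕ → AddSubgroup k} [GradedRing 𝒜]
    (hQ : IsQMatrix D 𝒜 Q) (ha : ∀ i, (a i).Monic)
    (haΛ : ∀ i, ((a i).natDegree : ℤ) = D.coroot i Λ) :
    LinearIndependent k fun i : TIndex D Λ γ => toCocenter Q n β a (Alg.xe Q i.1.2 i.1.1) := by
  classical
  rw [linearIndependent_iff]
  intro l hl
  have hmap := Finsupp.apply_linearCombination k (toCocenter Q n β a)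
    (fun i : TIndex D Λ γ => Alg.xe Q i.1.2 i.1.1) l
  have hmem := diagonal_mem_of_toCocenter_eq_zero (hQ.qCol_symm γ) (hmap.trans hl)
  rw [Finsupp.apply_linearCombination] at hmem
  refine linearIndependent_iff.1 (linearIndependent_single_colExponent (k := k)) l
    ((isMonicSystem hQ ha γ).eq_zero_of_mem_cocenterRel (Eq.subst (motive := (· ∈ _)) ?_ hmem) ?_)
  · congr 2
    funext i
    rw [Function.comp_apply, xe_eq γ, diagonal_ρ_mul_e]
  · intro σ m hm t
    rw [Finsupp.linearCombination_apply, Finsupp.sum, Finset.sum_apply] at hm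
    obtain ⟨i, -, hmi⟩ := Finset.mem_biUnion.1 (support_sum hm)
    obtain ⟨ν, rfl⟩ := col_surjective γ σ
    rw [Pi.smul_apply] at hmi
    have hmi := support_smul hmi
    rcases eq_or_ne ν i.1.1 with rfl | hν
    · rw [Pi.single_eq_same] at hmi
      rw [Finset.mem_singleton.1 (support_monomial_subset hmi), colExponent_col]
      have := i.2 t
      rw [← bnd_eq_bound haΛ] at this
      exact_mod_cast this
    · rw [Pi.single_eq_of_ne fun h => hν (col_injective γ h)] at hmi
      simp at hmi

/-- Every class comes from a vector of polynomials, and division modulo the relations, which `ofVec`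
kills, leaves reduced monomials only. -/
theorem span_toCocenter_xe {𝒜 : ℕ → AddSubgroup k} [GradedRing 𝒜]
    (hQ : IsQMatrix D 𝒜 Q) (ha : ∀ i, (a i).Monic)
    (haΛ : ∀ i, ((a i).natDegree : ℤ) = D.coroot i Λ) :
    ⊤ ≤ Submodule.span k (Set.range fun i : TIndex D Λ γ =>
      toCocenter Q n β a (Alg.xe Q i.1.2 i.1.1)) := by
  classical
  rintro z -
  obtain ⟨v, rfl⟩ := ofVec_surjective (Q := Q) (a := a) γ z
  rw [← Finset.univ_sum_single v, map_sum]
  refine Submodule.sum_mem _ fun σ _ => ?_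
  obtain ⟨u, hu, w, hw, huw⟩ := Submodule.mem_sup.1
    ((isMonicSystem hQ ha γ).span_reduced_sup σ (v σ))
  rw [← huw, map_add, ofVec_eq_zero_of_mem γ (hQ.qCol_symm γ) hw, add_zero, ← Submodule.mem_comap]
  refine Submodule.span_le.2 ?_ hu
  rintro _ ⟨τ, m, hm, rfl⟩
  obtain ⟨ν, rfl⟩ := col_surjective γ τ
  have hexp : colExponent γ ν (fun t => m (col γ ν t)) = m := by
    ext c
    obtain ⟨t, rfl⟩ := (col γ ν).surjective c
    rw [colExponent_col]
  refine Submodule.subset_span ⟨⟨(ν, fun t => m (col γ ν t)), fun t => ?_⟩, ?_⟩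
  · rw [← bnd_eq_bound haΛ]
    exact_mod_cast hm t
  · change toCocenter Q n β a (Alg.xe Q _ ν) = _
    rw [xe_eq γ, hexp, ofVec_single]

end Basis

end KLR

theorem mainTheorem5 {I P k : Type*} [AddCommGroup P] [Module.Free ℤ P] [Module.Finite ℤ P]
    (D : KLR.CartanDatum I P) [Field k] (𝒜 : ℕ → AddSubgroup k) [GradedRing 𝒜]
    (Q : I → I → MvPolynomial (Fin 2) k) (hQ : KLR.IsQMatrix D 𝒜 Q)
    (Λ : P) (hΛ : D.IsDominant Λ)
    (a : I → Polynomial k) (ha : KLR.IsCyclotomicFamily D 𝒜 Λ a)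
    (n : ℕ) (β : I →₀ ℕ)
    (hβ : ∃ i : Fin n → I, Function.Injective i ∧ β = ∑ j, Finsupp.single (i j) 1)
    (γ : KLR.Weight n β) :
    ∃ b : Module.Basis (KLR.TIndex D Λ γ) k (KLR.Cocenter k (KLR.CycAlg Q n β a)),
      ∀ m : KLR.TIndex D Λ γ,
        b m = Submodule.Quotient.mk (KLR.toCyc Q n β a (KLR.Alg.xe Q m.1.2 m.1.1)) := by
  have := KLR.isMultiplicityFree_of_exists hβ
  refine ⟨Module.Basis.mk (KLR.linearIndependent_toCocenter_xe hQ ha.monic ha.natDegree_eq)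
    (KLR.span_toCocenter_xe hQ ha.monic ha.natDegree_eq), fun m => ?_⟩
  rw [Module.Basis.mk_apply, KLR.toCocenter_apply]
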